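/- Notation. Let $\mathcal{P}(\mathbb{R}^d)$ be the set of probability densities on $\mathbb{R}^d$ (with respect to Lebesgue measure) that are twice continuously differentiable, everywhere positive, and have a finite second moment. For $\rho,\pi\in\mathcal{P}(\mathbb{R}^d)$ put $$\mathrm{KL}(\rho|\pi)=\int \rho\log\frac{\rho}{\pi}\,dx\in[0,\infty],\qquad I(\rho|\pi)=\int\Big|\nabla\log\frac{\rho}{\pi}\Big|^2\rho\,dx\in[0,\infty].$$ A density $\pi\in\mathcal{P}(\mathbb{R}^d)$ satisfies the log-Sobolev inequality with constant $\lambda>0$ if $\mathrm{KL}(\mu|\pi)\le\frac{1}{2\lambda}I(\mu|\pi)$ for all $\mu\in\mathcal{P}(\mathbb{R}^d)$. Let $\mathcal{H}$ be a real reproducing kernel Hilbert space of functions on $\mathbb{R}^d$ whose kernel $k:\mathbb{R}^d\times\mathbb{R}^d\to\mathbb{R}$ is continuous, and let $\mathcal{H}^d$ be the Hilbert space of $d$-tuples of elements of $\mathcal{H}$. For a density $\rho$ with $\int k(x,x)\rho(x)\,dx<\infty$ let $\iota_\rho:\mathcal{H}^d\to L_2^d(\rho)=L^2(\rho;\mathbb{R}^d)$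 be the (bounded) inclusion and $T_\rho=\iota_\rho\iota_\rho^*$, a compact positive self-adjoint operator on $L_2^d(\rho)$. For $\gamma\in(0,\frac12]$ let $\mathfrak{I}(\rho,\gamma)=T_\rho^{-\gamma}\nabla\log\frac{\rho}{\pi}$ be the pre-image of $\nabla\log\frac{\rho}{\pi}$ under $T_\rho^{\gamma}$ (the one of least norm, if $T_\rho$ is not injective), with $\|\mathfrak{I}(\rho,\gamma)\|_{L_2^d(\rho)}=\infty$ if there is no pre-image in $L_2^d(\rho)$. Let $\nu\in(0,1)$. A solution of the regularized Stein variational gradient flow (R-SVGF) with target $\pi$ is a family $(\rho_t)_{t\ge0}$ in $\mathcal{P}(\mathbb{R}^d)$ which is continuous in $t$ for weak convergence of probability measures, for which $\int k(x,x)\rho_t(x)\,dx$ is finite and bounded on bounded time intervals and $I(\rho_t|\pi)<\infty$ for $t>0$, and which is a weak solution on $[0,\infty)\times\mathbb{R}^d$ of $$\partial_t\rho_t=\nabla\cdot\big(\rho_t\,v_t\big),\qquad v_t=\iota_{\rho_t}\big((1-\nu)\iota_{\rho_t}^*\iota_{\rho_t}+\nu\,\mathrm{Id}\big)^{-1}\iota_{\rho_t}^*\Big(\nabla\log\frac{\rho_t}{\pi}\Big),$$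 that is, $(t,x)\mapsto\rho_t(x)v_t(x)$ is integrable on $(0,T]\times B$ for every $T>0$ and every ball $B$, and for all $\varphi\in C_c^\infty([0,\infty)\times\mathbb{R}^d)$ $$\int_0^\infty\!\!\int_{\mathbb{R}^d}\big(\partial_t\varphi(t,x)-\nabla\varphi(t,x)\cdot v_t(x)\big)\rho_t(x)\,dx\,dt+\int_{\mathbb{R}^d}\varphi(0,x)\rho_0(x)\,dx=0.$$ Theorem. Let $\pi\in\mathcal{P}(\mathbb{R}^d)$ satisfy the log-Sobolev inequality with constant $\lambda>0$, let $\nu\in(0,1)$, and let $(\rho_t)_{t\ge0}$ be a solution of the R-SVGF with target $\pi$. Suppose that for every $t>0$ a number $\gamma_t\in(0,\frac12]$ is given with $\|\mathfrak{I}(\rho_t,\gamma_t)\|_{L_2^d(\rho_t)}<\infty$. Then, for every $T\in(0,\infty)$, $$\mathrm{KL}(\rho_T|\pi)\le e^{-2\lambda T/(1-\nu)}\,\mathrm{KL}(\rho_0|\pi)+\int_0^T\nu^{2\gamma_t}(1-\nu)^{-2\gamma_t-1}\,\|\mathfrak{I}(\rho_t,\gamma_t)\|_{L_2^d(\rho_t)}^2\,e^{2\lambda(t-T)/(1-\nu)}\,dt,$$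 as an inequality in $[0,\infty]$ (for a non-measurable integrand the integral is the lower integral). -/

import Mathlib

open MeasureTheory Set
open scoped ENNReal InnerProductSpace ContDiff BoundedContinuousFunction

noncomputable section

namespace RSVGF

/-- The Euclidean space `ℝ^d`. -/
abbrev Rd (d : ℕ) := EuclideanSpace ℝ (Fin d)

/-! ### Densities, relative Fisher information, log-Sobolev inequality -/

/-- The class `𝓟(ℝ^d)` of probability densities (with respect to Lebesgue measure) that are twice
continuously differentiable, positive on all of `ℝ^d`, and have a finite second moment.
(The value `1` of the integral forces integrability.) -/
structure IsDensity {d : ℕ} (ρ : Rd d → ℝ) : Prop where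
  contDiff : ContDiff ℝ 2 ρ
  pos : ∀ x, 0 < ρ x
  integral_eq_one : ∫ x, ρ x = 1
  second_moment : Integrable (fun x => ‖x‖ ^ 2 * ρ x)

/-- The measure `ρ(x) dx`. -/
def dens {d : ℕ} (ρ : Rd d → ℝ) : Measure (Rd d) :=
  volume.withDensity (fun x => ENNReal.ofReal (ρ x))

/-- `KL(ρ | π)`, as an element of `[0, ∞]`. -/
def KL {d : ℕ} (ρ π : Rd d → ℝ) : ℝ≥0∞ :=
  InformationTheory.klDiv (dens ρ) (dens π)

/-- The vector field `∇ log (ρ / π)`. -/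
def score {d : ℕ} (ρ π : Rd d → ℝ) (x : Rd d) : Rd d :=
  gradient (fun y => Real.log (ρ y / π y)) x

/-- The relative Fisher information `I(ρ | π) = ∫ |∇ log (ρ / π)|² ρ dx`, in `[0, ∞]`. -/
def fisher {d : ℕ} (ρ π : Rd d → ℝ) : ℝ≥0∞ :=
  ∫⁻ x, ‖score ρ π x‖ₑ ^ 2 ∂(dens ρ)

/-- The log-Sobolev inequality with constant `lam`:
`KL(μ | π) ≤ I(μ | π) / (2 lam)` for all `μ` in `𝓟(ℝ^d)`. -/
def SatisfiesLSI {d : ℕ} (π : Rd d → ℝ) (lam : ℝ) : Prop :=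
  ∀ μ : Rd d → ℝ, IsDensity μ → KL μ π ≤ ENNReal.ofReal (1 / (2 * lam)) * fisher μ π

/-! ### The reproducing kernel Hilbert space and its inclusion into `L²` -/

section kernel

variable {d : ℕ} (H : Type*) [NormedAddCommGroup H] [InnerProductSpace ℝ H] [CompleteSpace H]
  [RKHS ℝ H (Rd d) ℝ]

/-- The scalar reproducing kernel `k(x, y) = ⟪k(x, ·), k(y, ·)⟫` of `H`. -/
def ker (x y : Rd d) : ℝ := RKHS.kernel H x y 1

/-- `H^d`: `d`-tuples of elements of `H`, with `‖φ‖² = ∑ i, ‖φ i‖²`. -/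
abbrev Hd (d : ℕ) (H : Type*) [NormedAddCommGroup H] := PiLp 2 (fun _ : Fin d => H)

variable {H} in
/-- The value at `x` of an element of `H^d`, seen as a function `ℝ^d → ℝ^d`. -/
def evalVec (φ : Hd d H) (x : Rd d) : Rd d := WithLp.toLp 2 (fun i => φ i x)

/-- The kernel is continuous and `∫ k(x, x) dμ(x) < ∞`. -/
def Admissible (μ : Measure (Rd d)) : Prop :=
  Continuous (fun p : Rd d × Rd d => ker H p.1 p.2) ∧ Integrable (fun x => ker H x x) μ

variable {H}

theorem ker_eq_inner (x y : Rd d) :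
    ker H x y = ⟪RKHS.kerFun H x (1 : ℝ), RKHS.kerFun H y (1 : ℝ)⟫_ℝ := by
  have h := RKHS.kernel_inner H x y (1 : ℝ) (1 : ℝ)
  rw [real_inner_comm, ← h]
  simp [ker]

theorem eval_eq_inner (f : H) (x : Rd d) : f x = ⟪RKHS.kerFun H x (1 : ℝ), f⟫_ℝ := by
  rw [RKHS.kerFun_inner]
  simp

theorem norm_kerFun_sub (x y : Rd d) :
    ‖RKHS.kerFun H y (1 : ℝ) - RKHS.kerFun H x (1 : ℝ)‖
      = Real.sqrt (ker H y y - 2 * ker H y x + ker H x x) := by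
  rw [← Real.sqrt_sq (norm_nonneg _), norm_sub_sq_real, ker_eq_inner, ker_eq_inner, ker_eq_inner,
    real_inner_self_eq_norm_sq, real_inner_self_eq_norm_sq]

theorem continuous_kerFun (hk : Continuous (fun p : Rd d × Rd d => ker H p.1 p.2)) :
    Continuous (fun x : Rd d => RKHS.kerFun H x (1 : ℝ)) := by
  rw [continuous_iff_continuousAt]
  intro x
  have a : Continuous (fun y : Rd d => ker H y y) :=
    hk.comp (f := fun y : Rd d => (y, y)) (by fun_prop)
  have b : Continuous (fun y : Rd d => ker H y x) :=
    hk.comp (f := fun y : Rd d => (y, x)) (by fun_prop)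
  have h1 : Continuous (fun y : Rd d => Real.sqrt (ker H y y - 2 * ker H y x + ker H x x)) :=
    ((a.sub (continuous_const.mul b)).add continuous_const).sqrt
  have h2 := h1.tendsto x
  have h3 : Real.sqrt (ker H x x - 2 * ker H x x + ker H x x) = 0 := by
    rw [show ker H x x - 2 * ker H x x + ker H x x = 0 by ring, Real.sqrt_zero]
  rw [h3] at h2
  refine tendsto_iff_norm_sub_tendsto_zero.mpr ?_
  refine h2.congr fun y => ?_
  exact (norm_kerFun_sub x y).symm

theorem continuous_eval (hk : Continuous (fun p : Rd d × Rd d => ker H p.1 p.2)) (f : H) :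
    Continuous (fun x : Rd d => f x) := by
  have h : (fun x : Rd d => f x) = fun x => ⟪RKHS.kerFun H x (1 : ℝ), f⟫_ℝ :=
    funext fun x => eval_eq_inner f x
  rw [h]
  exact (continuous_kerFun hk).inner continuous_const

theorem abs_eval_le (f : H) (x : Rd d) : |f x| ≤ ‖f‖ * Real.sqrt (ker H x x) := by
  have hx : Real.sqrt (ker H x x) = ‖RKHS.kerFun H x (1 : ℝ)‖ := by
    rw [ker_eq_inner, real_inner_self_eq_norm_sq, Real.sqrt_sq (norm_nonneg _)]
  rw [hx, eval_eq_inner, mul_comm]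
  exact abs_real_inner_le_norm _ _

theorem norm_evalVec_le (φ : Hd d H) (x : Rd d) :
    ‖evalVec φ x‖ ≤ ‖φ‖ * Real.sqrt (ker H x x) := by
  refine le_of_sq_le_sq ?_ (by positivity)
  rw [mul_pow, PiLp.norm_sq_eq_of_L2, PiLp.norm_sq_eq_of_L2, Finset.sum_mul]
  refine Finset.sum_le_sum fun i _ => ?_
  rw [← mul_pow]
  exact pow_le_pow_left₀ (norm_nonneg _) (abs_eval_le (φ i) x) 2

theorem memLp_evalVec {μ : Measure (Rd d)} (h : Admissible H μ) (φ : Hd d H) :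
    MemLp (evalVec φ) 2 μ := by
  have hc : Continuous (evalVec φ) :=
    (PiLp.continuous_toLp 2 (fun _ : Fin d => ℝ)).comp
      (continuous_pi fun i => continuous_eval h.1 (φ i))
  rw [memLp_two_iff_integrable_sq_norm hc.aestronglyMeasurable]
  refine (h.2.const_mul (‖φ‖ ^ 2)).mono (hc.norm.pow 2).aestronglyMeasurable ?_
  refine Filter.Eventually.of_forall fun x => ?_
  have h0 : 0 ≤ ker H x x := by
    rw [ker_eq_inner]
    exact real_inner_self_nonneg
  have h1 := pow_le_pow_left₀ (norm_nonneg _) (norm_evalVec_le φ x) 2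
  rw [mul_pow, Real.sq_sqrt h0] at h1
  rw [Real.norm_of_nonneg (by positivity), Real.norm_of_nonneg (by positivity)]
  exact h1

theorem norm_toLp_evalVec_le {μ : Measure (Rd d)} (h : Admissible H μ) (φ : Hd d H) :
    ‖(memLp_evalVec h φ).toLp‖ ≤ Real.sqrt (∫ x, ker H x x ∂μ) * ‖φ‖ := by
  have h0 : ∀ x : Rd d, 0 ≤ ker H x x := fun x => by
    rw [ker_eq_inner]
    exact real_inner_self_nonneg
  refine le_of_sq_le_sq ?_ (by positivity)
  rw [mul_pow, Real.sq_sqrt (integral_nonneg h0), ← real_inner_self_eq_norm_sq, L2.inner_def,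
    ← integral_mul_const]
  refine integral_mono_ae (L2.integrable_inner _ _) (h.2.mul_const _) ?_
  filter_upwards [(memLp_evalVec h φ).coeFn_toLp] with x hx
  rw [hx, real_inner_self_eq_norm_sq]
  have h1 := pow_le_pow_left₀ (norm_nonneg _) (norm_evalVec_le φ x) 2
  rw [mul_pow, Real.sq_sqrt (h0 x)] at h1
  rw [mul_comm]
  exact h1

variable (H)

open Classical in
/-- The inclusion `ι : H^d → L²(μ; ℝ^d)`. It is only meaningful for `Admissible H μ`, and is given
the value `0` otherwise. -/
def inclusion (μ : Measure (Rd d)) : Hd d H →L[ℝ] Lp (Rd d) 2 μ :=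
  if h : Admissible H μ then
    LinearMap.mkContinuous
      { toFun := fun φ => (memLp_evalVec h φ).toLp
        map_add' := fun φ ψ => by
          rw [← MemLp.toLp_add]
          congr 1
          funext x
          ext i
          simp [evalVec]
        map_smul' := fun c φ => by
          rw [RingHom.id_apply, ← MemLp.toLp_const_smul]
          congr 1
          funext x
          ext i
          simp [evalVec] }
      (Real.sqrt (∫ x, ker H x x ∂μ)) (norm_toLp_evalVec_le h)
  else 0

theorem coeFn_inclusion {μ : Measure (Rd d)} (h : Admissible H μ) (φ : Hd d H) :
    inclusion H μ φ =ᵐ[μ] evalVec φ := by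
  rw [inclusion, dif_pos h]
  exact (memLp_evalVec h φ).coeFn_toLp

/-- The integral operator `T = ι ι*` on `L²(μ; ℝ^d)`. -/
def integralOp (μ : Measure (Rd d)) : Lp (Rd d) 2 μ →L[ℝ] Lp (Rd d) 2 μ :=
  inclusion H μ ∘L (inclusion H μ).adjoint

/-- The regularized operator `(1 - ν) ι* ι + ν I` on `H^d`. -/
def regOp (ν : ℝ) (μ : Measure (Rd d)) : Hd d H →L[ℝ] Hd d H :=
  (1 - ν) • ((inclusion H μ).adjoint ∘L inclusion H μ) + ν • ContinuousLinearMap.id ℝ (Hd d H)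

/-- For `0 < ν ≤ 1` the regularized operator is invertible, so that its inverse below is genuine. -/
theorem isInvertible_regOp {ν : ℝ} (h0 : 0 < ν) (h1 : ν ≤ 1) (μ : Measure (Rd d)) :
    (regOp H ν μ).IsInvertible := by
  have hB : IsCoercive ((innerSL ℝ (E := Hd d H)) ∘L regOp H ν μ) := by
    refine ⟨ν, h0, fun φ => ?_⟩
    have e : ((innerSL ℝ (E := Hd d H)) ∘L regOp H ν μ) φ φ
        = (1 - ν) * ‖inclusion H μ φ‖ ^ 2 + ν * ‖φ‖ ^ 2 := by
      rw [ContinuousLinearMap.comp_apply, innerSL_apply_apply, regOp,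
        add_apply, smul_apply,
        smul_apply, ContinuousLinearMap.comp_apply,
        ContinuousLinearMap.id_apply, inner_add_left, real_inner_smul_left, real_inner_smul_left,
        ContinuousLinearMap.adjoint_inner_left, real_inner_self_eq_norm_sq,
        real_inner_self_eq_norm_sq]
    rw [e]
    nlinarith [mul_nonneg (sub_nonneg.mpr h1) (sq_nonneg ‖inclusion H μ φ‖)]
  refine ⟨hB.continuousLinearEquivOfBilin, ?_⟩
  ext1 φ
  refine ext_inner_right ℝ fun ψ => ?_
  exact hB.continuousLinearEquivOfBilin_apply φ ψ

open Classical in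
/-- `∇ log (ρ / π)` as an element of `L²(ρ; ℝ^d)` (and `0` if it is not square integrable). -/
def scoreLp (ρ π : Rd d → ℝ) : Lp (Rd d) 2 (dens ρ) :=
  if h : MemLp (score ρ π) 2 (dens ρ) then h.toLp else 0

/-- The element `((1 - ν) ι* ι + ν I)⁻¹ ι* ∇ log (ρ / π)` of `H^d`. -/
def direction (ν : ℝ) (ρ π : Rd d → ℝ) : Hd d H :=
  (regOp H ν (dens ρ)).inverse ((inclusion H (dens ρ)).adjoint (scoreLp ρ π))

end kernel

/-! ### Fractional powers and pre-images -/

/-- The power `T ^ γ` (with `γ > 0`) of a compact positive self-adjoint operator `T`, applied to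
`h`: the sum over the positive eigenvalues `c` of `T` of `c ^ γ` times the orthogonal projection of
`h` to the eigenspace of `c`. (For the other `c > 0` the eigenspace is trivial and the
corresponding term is zero.) -/
def fracPow {F : Type*} [NormedAddCommGroup F] [InnerProductSpace ℝ F] [CompleteSpace F]
    (T : F →L[ℝ] F) (γ : ℝ) (h : F) : F :=
  ∑' c : Ioi (0 : ℝ), (c : ℝ) ^ γ •
    (Module.End.eigenspace (T : F →ₗ[ℝ] F) (c : ℝ)).starProjection h

/-- `‖𝔍(ρ, γ)‖` in `L²(ρ; ℝ^d)`, where `𝔍(ρ, γ) = T ^ (-γ) ∇ log (ρ / π)` with `T = ι ι*`: the norm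
of the pre-image of `∇ log (ρ / π)` under `T ^ γ` (the least norm, if `T` is not injective);
it is `∞` exactly if there is no pre-image in `L²(ρ; ℝ^d)`. -/
def preimageNorm {d : ℕ} (H : Type*) [NormedAddCommGroup H] [InnerProductSpace ℝ H]
    [CompleteSpace H] [RKHS ℝ H (Rd d) ℝ] (π ρ : Rd d → ℝ) (γ : ℝ) : ℝ≥0∞ :=
  ⨅ (h : Lp (Rd d) 2 (dens ρ))
    (_ : ⇑(fracPow (integralOp H (dens ρ)) γ h) =ᵐ[dens ρ] score ρ π), ‖h‖ₑ

/-! ### The regularized Stein variational gradient flow -/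

/-- `ρ` is a (weak) solution on `[0, ∞)`, with densities in `𝓟(ℝ^d)`, of
`∂ₜ ρ = ∇ · (ρ ι ((1 - ν) ι* ι + ν I)⁻¹ ι* ∇ log (ρ / π))`, where `ι` is the inclusion of `H^d` into
`L²(ρ t; ℝ^d)`. -/
structure IsSolution {d : ℕ} (H : Type*) [NormedAddCommGroup H] [InnerProductSpace ℝ H]
    [CompleteSpace H] [RKHS ℝ H (Rd d) ℝ] (ν : ℝ) (π : Rd d → ℝ) (ρ : ℝ → Rd d → ℝ) : Prop where
  isDensity : ∀ t, 0 ≤ t → IsDensity (ρ t)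
  /-- `t ↦ ρ t` is continuous for the weak convergence of probability measures. -/
  continuousOn : ∀ f : Rd d →ᵇ ℝ, ContinuousOn (fun t => ∫ x, f x * ρ t x) (Ici 0)
  /-- `∫ k(x, x) ρ t x dx` is finite, and bounded on bounded time intervals. -/
  kernel_integrable : ∀ t, 0 ≤ t → Integrable (fun x => ker H x x) (dens (ρ t))
  kernel_bounded : ∀ T, BddAbove ((fun t => ∫ x, ker H x x ∂(dens (ρ t))) '' Icc 0 T)
  /-- The Fisher information is finite, so that `ι*` applies to `∇ log (ρ t / π)`. -/
  score_memLp : ∀ t, 0 < t → MemLp (score (ρ t) π) 2 (dens (ρ t))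
  /-- The flux is locally integrable, so that the weak formulation makes sense. -/
  flux_integrable : ∀ T R : ℝ, IntegrableOn
    (fun p : ℝ × Rd d => ρ p.1 p.2 • evalVec (direction H ν (ρ p.1) π) p.2)
    (Ioc 0 T ×ˢ Metric.closedBall 0 R)
  weak_form : ∀ φ : ℝ × Rd d → ℝ, ContDiff ℝ ∞ φ → HasCompactSupport φ →
    (∫ t in Ioi (0 : ℝ), ∫ x, (deriv (fun s => φ (s, x)) t
        - ⟪gradient (fun y => φ (t, y)) x, evalVec (direction H ν (ρ t) π) x⟫_ℝ) * ρ t x)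
      + ∫ x, φ (0, x) * ρ 0 x = 0

end RSVGF

end

open RSVGF

/-!
Along the flow the relative entropy `y(t) = KL(ρ t | π)` dissipates at the rate
`D(t) = ∫ ρ t ⟪∇ log (ρ t / π), v t⟫`, and with `E = I(ρ t | π) - (1 - ν) D` (the `defect`) one has
`D = (I - E) / (1 - ν)`. The log-Sobolev inequality gives `I ≥ 2 λ y`, so Grönwall's inequality
yields the exponential decay up to the weighted time integral of `E / (1 - ν)`. Writing
`S = ∇ log (ρ t / π)`, the residual `S - (1 - ν) v t` equals `ν ((1 - ν) T + ν)⁻¹ S` with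
`T = ι ι*`. If `S = T ^ γ h`, then `E = ⟪S, S - (1 - ν) v t⟫` is a sum over the eigenvalues `c` of
`T` of `ν c ^ (2 γ) / ((1 - ν) c + ν)` times squared norms of projections of `h`. With
`a = (1 - ν) c / ν` this factor is
`(ν / (1 - ν)) ^ (2 γ) * a ^ (2 γ) / (1 + a) ≤ (ν / (1 - ν)) ^ (2 γ)`, which bounds `E`
(`inner_fracPow_le`, `ofReal_defect_le`).

The work is in the dissipation identity `y(t) - y(0) = - ∫₀ᵗ D` (`IsEnergyFlow.entropy_sub_eq`) for
a merely weak solution. It rests on the following.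

* Integrability in time. Nothing is assumed about `∫ I(ρ t | π) dt`. Since the operators `T` are
  bounded, uniformly on bounded time intervals, `((1 - ν) T + ν)⁻¹` is bounded below, so `I ≤ M E`
  (`norm_scoreLp_sq_le_mul_defect`). If the right-hand side of the estimate is finite, then so is
  the time integral of `E`, hence that of `I`; otherwise, as for `KL(ρ 0 | π) = ∞`, there is nothing
  to prove. The velocity is bounded, on balls and in `L²(ρ t)`, by multiples of `√I`, so the
  solution is an `IsEnergyFlow`.
* Mollification in space. For fixed `x`, the mollified density `t ↦ (η * ρ t)(x)` is a positive
  primitive of an integrable function, by testing the weak formulation with `η (x - ·)` times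
  functions of time. This gives the chain rule in time for functions of the mollified density.
* Truncation. The entropy `klFun` is replaced by functions `truncEntropy` with bounded derivative,
  and the integral is cut off in space. The mollification can then be removed, because densities,
  velocities and gradients are continuous in `x` and the local dissipation is dominated in `t`
  (`IsEnergyFlow.localEntropy_sub_eq`). Finally the cutoff and the truncation are removed together,
  by dominated convergence; the log-Sobolev inequality makes `KL(ρ t | π)` finite for `t > 0`.
-/

noncomputable section

namespace RSVGF

/-! ### The regularized problem in Hilbert space -/

section hilbert

variable {F X : Type*} [NormedAddCommGroup F] [InnerProductSpace ℝ F] [CompleteSpace F]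
  [NormedAddCommGroup X] [InnerProductSpace ℝ X] [CompleteSpace X]

theorem inner_starProjection_eigenspace_eq_zero {T : F →L[ℝ] F}
    (hT : (T : F →ₗ[ℝ] F).IsSymmetric) (h : F) {c c' : ℝ} (hc : c ≠ c') :
    ⟪(Module.End.eigenspace (T : F →ₗ[ℝ] F) c).starProjection h,
      (Module.End.eigenspace (T : F →ₗ[ℝ] F) c').starProjection h⟫_ℝ = 0 :=
  hT.orthogonalFamily_eigenspaces hc
    ⟨_, Submodule.starProjection_apply_mem _ h⟩ ⟨_, Submodule.starProjection_apply_mem _ h⟩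

/-- Bessel's inequality for the projections to distinct eigenspaces of a symmetric operator. -/
theorem sum_norm_sq_starProjection_eigenspace_le {T : F →L[ℝ] F}
    (hT : (T : F →ₗ[ℝ] F).IsSymmetric) (h : F) (s : Finset (Ioi (0 : ℝ))) :
    ∑ c ∈ s, ‖(Module.End.eigenspace (T : F →ₗ[ℝ] F) (c : ℝ)).starProjection h‖ ^ 2
      ≤ ‖h‖ ^ 2 := by
  set P : Ioi (0 : ℝ) → F := fun c =>
    (Module.End.eigenspace (T : F →ₗ[ℝ] F) (c : ℝ)).starProjection h with hP
  have horth : ∀ c c' : Ioi (0 : ℝ), c ≠ c' → ⟪P c, P c'⟫_ℝ = 0 := fun c c' hcc =>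
    inner_starProjection_eigenspace_eq_zero hT h fun e => hcc (Subtype.ext e)
  have hself : ∀ c, ⟪h, P c⟫_ℝ = ‖P c‖ ^ 2 := fun c => by
    rw [hP, ← real_inner_self_eq_norm_sq]
    dsimp only
    rw [Submodule.inner_starProjection_left_eq_right,
      Submodule.starProjection_eq_self_iff.mpr (Submodule.starProjection_apply_mem _ h)]
  have h1 : ⟪h, ∑ c ∈ s, P c⟫_ℝ = ∑ c ∈ s, ‖P c‖ ^ 2 := by
    rw [inner_sum]
    exact Finset.sum_congr rfl fun c _ => hself c
  have h2 : ‖∑ c ∈ s, P c‖ ^ 2 = ∑ c ∈ s, ‖P c‖ ^ 2 := by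
    rw [← real_inner_self_eq_norm_sq, sum_inner]
    refine Finset.sum_congr rfl fun c hc => ?_
    rw [inner_sum, Finset.sum_eq_single_of_mem c hc fun c' _ hne => horth c c' hne.symm,
      real_inner_self_eq_norm_sq]
  have h3 := real_inner_le_norm h (∑ c ∈ s, P c)
  rw [h1] at h3
  change ∑ c ∈ s, ‖P c‖ ^ 2 ≤ ‖h‖ ^ 2
  nlinarith [norm_nonneg h, norm_nonneg (∑ c ∈ s, P c), sq_nonneg (‖h‖ - ‖∑ c ∈ s, P c‖)]

/-- The scalar inequality behind the approximation error: the map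
`c ↦ c ^ (2 γ) ν / ((1 - ν) c + ν)` is bounded for `γ ≤ 1 / 2`. -/
theorem rpow_mul_div_le {ν γ c : ℝ} (hν : ν ∈ Ioo (0 : ℝ) 1) (hγ : γ ∈ Ioc (0 : ℝ) (1 / 2))
    (hc : 0 < c) :
    c ^ γ * (ν * c ^ γ / ((1 - ν) * c + ν)) ≤ (ν / (1 - ν)) ^ (2 * γ) := by
  have h0 := hν.1
  have h1 : 0 < 1 - ν := sub_pos.mpr hν.2
  -- in terms of `a = (1 - ν) c / ν` the claim reads `a ^ (2 γ) ≤ 1 + a`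
  set a := (1 - ν) * c / ν with ha
  have ha0 : 0 < a := by positivity
  have hca : c = ν / (1 - ν) * a := by rw [ha]; field_simp
  have hpow : c ^ γ * c ^ γ = (ν / (1 - ν)) ^ (2 * γ) * a ^ (2 * γ) := by
    rw [← Real.rpow_add hc, ← two_mul, hca, Real.mul_rpow (by positivity) ha0.le]
  have hden : (1 - ν) * c + ν = ν * (1 + a) := by rw [ha]; field_simp; ring
  have hle : a ^ (2 * γ) ≤ 1 + a := by
    rcases le_total a 1 with h | h
    · exact (Real.rpow_le_one ha0.le h (by linarith [hγ.1])).trans (by linarith)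
    · calc a ^ (2 * γ) ≤ a ^ (1 : ℝ) :=
            Real.rpow_le_rpow_of_exponent_le h (by linarith [hγ.2])
        _ ≤ 1 + a := by rw [Real.rpow_one]; linarith
  have e : c ^ γ * (ν * c ^ γ / ((1 - ν) * c + ν)) = (ν / (1 - ν)) ^ (2 * γ) *
      (a ^ (2 * γ) / (1 + a)) := by
    rw [hden, show c ^ γ * (ν * c ^ γ / (ν * (1 + a))) = (c ^ γ * c ^ γ) / (1 + a) by field_simp,
      hpow, mul_div_assoc]
  rw [e]
  exact mul_le_of_le_one_right (by positivity) ((div_le_one (by positivity)).mpr hle)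

/-- If `z = ν ((1 - ν) T + ν)⁻¹ T ^ γ h`, then `⟪T ^ γ h, z⟫ ≤ (ν / (1 - ν)) ^ (2 γ) ‖h‖²`.
Neither compactness of `T` nor summability of the series defining `T ^ γ h` is used: where the
series diverges, `fracPow` has the value `0`. -/
theorem inner_fracPow_le {T : F →L[ℝ] F} (hT : (T : F →ₗ[ℝ] F).IsSymmetric) {ν γ : ℝ}
    (hν : ν ∈ Ioo (0 : ℝ) 1) (hγ : γ ∈ Ioc (0 : ℝ) (1 / 2)) {h z : F}
    (hz : (1 - ν) • T z + ν • z = ν • fracPow T γ h) :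
    ⟪fracPow T γ h, z⟫_ℝ ≤ (ν / (1 - ν)) ^ (2 * γ) * ‖h‖ ^ 2 := by
  have h0 := hν.1
  have h1 : 0 < 1 - ν := sub_pos.mpr hν.2
  set P : Ioi (0 : ℝ) → F := fun c =>
    (Module.End.eigenspace (T : F →ₗ[ℝ] F) (c : ℝ)).starProjection h with hP
  by_cases hs : Summable fun c : Ioi (0 : ℝ) => (c : ℝ) ^ γ • P c
  swap
  · have : fracPow T γ h = 0 := tsum_eq_zero_of_not_summable hs
    rw [this, inner_zero_left]
    positivity
  have hsum : HasSum (fun c : Ioi (0 : ℝ) => (c : ℝ) ^ γ • P c) (fracPow T γ h) := hs.hasSum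
  have horth : ∀ c c' : Ioi (0 : ℝ), c ≠ c' → ⟪P c, P c'⟫_ℝ = 0 := fun c c' hcc =>
    inner_starProjection_eigenspace_eq_zero hT h fun e => hcc (Subtype.ext e)
  have hTP : ∀ c, T (P c) = (c : ℝ) • P c := fun c =>
    Module.End.mem_eigenspace_iff.mp (Submodule.starProjection_apply_mem _ h)
  have hS : ∀ c, ⟪P c, fracPow T γ h⟫_ℝ = (c : ℝ) ^ γ * ‖P c‖ ^ 2 := fun c => by
    have e1 := hsum.mapL (innerSL ℝ (P c))
    have e2 := hasSum_single (f := fun c' : Ioi (0 : ℝ) => innerSL ℝ (P c) ((c' : ℝ) ^ γ • P c')) c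
      (fun c' hne => by
        simp only [innerSL_apply_apply, inner_smul_right, horth c c' hne.symm, mul_zero])
    have e3 := e1.unique e2
    simpa only [innerSL_apply_apply, inner_smul_right, real_inner_self_eq_norm_sq] using e3
  have hzP : ∀ c, ⟪z, P c⟫_ℝ = ν * (c : ℝ) ^ γ / ((1 - ν) * c + ν) * ‖P c‖ ^ 2 := fun c => by
    have hc : (0 : ℝ) < c := c.2
    have e1 : ⟪(1 - ν) • T z + ν • z, P c⟫_ℝ = ((1 - ν) * c + ν) * ⟪z, P c⟫_ℝ := by
      have e2 : ⟪T z, P c⟫_ℝ = ⟪z, T (P c)⟫_ℝ := hT z (P c)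
      rw [inner_add_left, real_inner_smul_left, real_inner_smul_left, e2, hTP, inner_smul_right]
      ring
    rw [hz, real_inner_smul_left, real_inner_comm, hS] at e1
    have : (1 - ν) * (c : ℝ) + ν ≠ 0 := by positivity
    field_simp
    linarith
  have hinner := hsum.mapL (innerSL ℝ z)
  rw [innerSL_apply_apply, real_inner_comm] at hinner
  refine hasSum_le_of_sum_le hinner fun s => ?_
  calc ∑ c ∈ s, innerSL ℝ z ((c : ℝ) ^ γ • P c)
      ≤ ∑ c ∈ s, (ν / (1 - ν)) ^ (2 * γ) * ‖P c‖ ^ 2 := by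
        refine Finset.sum_le_sum fun c _ => ?_
        rw [innerSL_apply_apply, inner_smul_right, hzP, ← mul_assoc]
        exact mul_le_mul_of_nonneg_right (rpow_mul_div_le hν hγ c.2) (sq_nonneg _)
    _ ≤ (ν / (1 - ν)) ^ (2 * γ) * ‖h‖ ^ 2 := by
        rw [← Finset.mul_sum]
        exact mul_le_mul_of_nonneg_left (sum_norm_sq_starProjection_eigenspace_le hT h s)
          (by positivity)

section regularized

variable {j : X →L[ℝ] F} {ν : ℝ} {φ : X} {S : F}

theorem inner_regularized (hφ : (1 - ν) • j.adjoint (j φ) + ν • φ = j.adjoint S) :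
    ⟪S, j φ⟫_ℝ = (1 - ν) * ‖j φ‖ ^ 2 + ν * ‖φ‖ ^ 2 := by
  rw [← ContinuousLinearMap.adjoint_inner_left, ← hφ, inner_add_left, real_inner_smul_left,
    real_inner_smul_left, ContinuousLinearMap.adjoint_inner_left, real_inner_self_eq_norm_sq,
    real_inner_self_eq_norm_sq]

theorem norm_apply_regularized_le (hν : ν ∈ Ioo (0 : ℝ) 1)
    (hφ : (1 - ν) • j.adjoint (j φ) + ν • φ = j.adjoint S) :
    ‖j φ‖ ≤ ‖S‖ / (1 - ν) := by
  have h1 : 0 < 1 - ν := sub_pos.mpr hν.2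
  have e := inner_regularized hφ
  have h2 := real_inner_le_norm S (j φ)
  rw [le_div_iff₀ h1]
  have h3 : (‖j φ‖ * (1 - ν)) * ‖j φ‖ ≤ ‖S‖ * ‖j φ‖ := by
    nlinarith [mul_nonneg hν.1.le (sq_nonneg ‖φ‖)]
  rcases (norm_nonneg (j φ)).eq_or_lt with h4 | h4
  · rw [← h4]; simp
  · exact le_of_mul_le_mul_right h3 h4

theorem norm_sq_regularized_le (hν : ν ∈ Ioo (0 : ℝ) 1)
    (hφ : (1 - ν) • j.adjoint (j φ) + ν • φ = j.adjoint S) :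
    ‖φ‖ ^ 2 ≤ ‖S‖ ^ 2 / (ν * (1 - ν)) := by
  have h0 := hν.1
  have h1 : 0 < 1 - ν := sub_pos.mpr hν.2
  have e := inner_regularized hφ
  have h2 := real_inner_le_norm S (j φ)
  have h3 := norm_apply_regularized_le hν hφ
  have h4 : ‖S‖ * ‖j φ‖ ≤ ‖S‖ * (‖S‖ / (1 - ν)) := mul_le_mul_of_nonneg_left h3 (norm_nonneg _)
  have h5 : ν * ‖φ‖ ^ 2 ≤ ‖S‖ ^ 2 / (1 - ν) := by
    calc ν * ‖φ‖ ^ 2 ≤ ‖S‖ * (‖S‖ / (1 - ν)) := by nlinarith [mul_nonneg h1.le (sq_nonneg ‖j φ‖)]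
      _ = ‖S‖ ^ 2 / (1 - ν) := by ring
  rw [le_div_iff₀ (by positivity)]
  rw [le_div_iff₀ h1] at h5
  linarith

/-- The residual `z = S - (1 - ν) j φ` solves `((1 - ν) j j* + ν) z = ν S`. -/
theorem residual_eq (hφ : (1 - ν) • j.adjoint (j φ) + ν • φ = j.adjoint S) :
    (1 - ν) • (j ∘L j.adjoint) (S - (1 - ν) • j φ) + ν • (S - (1 - ν) • j φ) = ν • S := by
  have h : j.adjoint (S - (1 - ν) • j φ) = ν • φ := by
    rw [map_sub, map_smul, ← hφ, add_sub_cancel_left]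
  rw [ContinuousLinearMap.comp_apply, h, map_smul, smul_sub, smul_smul, smul_smul, mul_comm ν]
  abel

/-- The defect `⟪S, S - (1 - ν) j φ⟫` controls `‖S‖²`, because `j j*` is bounded. -/
theorem norm_sq_le_mul_inner_residual (hν : ν ∈ Ioo (0 : ℝ) 1)
    (hφ : (1 - ν) • j.adjoint (j φ) + ν • φ = j.adjoint S) :
    ‖S‖ ^ 2 ≤ (1 + (1 - ν) / ν * ‖j‖ ^ 2) ^ 2 * ⟪S, S - (1 - ν) • j φ⟫_ℝ := by
  have h0 := hν.1
  have h1 : 0 < 1 - ν := sub_pos.mpr hν.2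
  set z := S - (1 - ν) • j φ with hz
  have hjz : j.adjoint z = ν • φ := by
    rw [hz, map_sub, map_smul, ← hφ, add_sub_cancel_left]
  have hS : S = z + (1 - ν) • j φ := by rw [hz]; abel
  have hE : ⟪S, z⟫_ℝ = ‖z‖ ^ 2 + (1 - ν) * ν * ‖φ‖ ^ 2 := by
    nth_rewrite 1 [hS]
    rw [inner_add_left, real_inner_self_eq_norm_sq, real_inner_smul_left,
      ← ContinuousLinearMap.adjoint_inner_right, hjz, inner_smul_right, real_inner_self_eq_norm_sq]
    ring
  have hφz : ‖φ‖ ≤ ‖j‖ * ‖z‖ / ν := by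
    rw [le_div_iff₀ h0]
    calc ‖φ‖ * ν = ‖ν • φ‖ := by rw [norm_smul, Real.norm_of_nonneg h0.le, mul_comm]
      _ = ‖j.adjoint z‖ := by rw [hjz]
      _ ≤ ‖j.adjoint‖ * ‖z‖ := j.adjoint.le_opNorm z
      _ = ‖j‖ * ‖z‖ := by rw [LinearIsometryEquiv.norm_map]
  have hSz : ‖S‖ ≤ (1 + (1 - ν) / ν * ‖j‖ ^ 2) * ‖z‖ := by
    calc ‖S‖ ≤ ‖z‖ + (1 - ν) * ‖j φ‖ := by
          nth_rewrite 1 [hS]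
          refine (norm_add_le _ _).trans ?_
          rw [norm_smul, Real.norm_of_nonneg h1.le]
      _ ≤ ‖z‖ + (1 - ν) * (‖j‖ * (‖j‖ * ‖z‖ / ν)) := by
          gcongr
          exact (j.le_opNorm φ).trans (by gcongr)
      _ = (1 + (1 - ν) / ν * ‖j‖ ^ 2) * ‖z‖ := by field_simp
  calc ‖S‖ ^ 2 ≤ ((1 + (1 - ν) / ν * ‖j‖ ^ 2) * ‖z‖) ^ 2 := by gcongr
    _ = (1 + (1 - ν) / ν * ‖j‖ ^ 2) ^ 2 * ‖z‖ ^ 2 := by ring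
    _ ≤ _ := by
      rw [hE]
      gcongr
      have : 0 ≤ (1 - ν) * ν * ‖φ‖ ^ 2 := by positivity
      linarith

end regularized

end hilbert

/-! ### Truncated entropies -/

/-- A smooth bounded truncation `κ_m` of the identity of `ℝ` at height `m`, with derivative in
`(0, 1]`. -/
def truncId (m s : ℝ) : ℝ := m * Real.arctan (s / m)

/-- The derivative of `truncId m`. -/
def truncIdDeriv (m s : ℝ) : ℝ := 1 / (1 + (s / m) ^ 2)

/-- The entropy function with derivative `truncId m (log q)`: a convex function with linear growth
which approximates `q log q + 1 - q` from below. -/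
def truncEntropy (m q : ℝ) : ℝ := ∫ u in (1 : ℝ)..q, truncId m (Real.log u)

theorem hasDerivAt_truncId {m : ℝ} (hm : 0 < m) (s : ℝ) :
    HasDerivAt (truncId m) (truncIdDeriv m s) s := by
  have h := (((hasDerivAt_id s).div_const m).arctan).const_mul m
  refine h.congr_deriv ?_
  simp only [id, truncIdDeriv]
  field_simp

theorem contDiff_truncId (m : ℝ) : ContDiff ℝ ∞ (truncId m) :=
  contDiff_const.mul (Real.contDiff_arctan.comp (contDiff_id.div_const m))

theorem continuous_truncId (m : ℝ) : Continuous (truncId m) := (contDiff_truncId m).continuous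

theorem continuous_truncIdDeriv (m : ℝ) : Continuous (truncIdDeriv m) := by
  refine continuous_const.div (by fun_prop) fun s => ?_
  positivity

theorem truncIdDeriv_nonneg (m s : ℝ) : 0 ≤ truncIdDeriv m s := by
  unfold truncIdDeriv; positivity

theorem truncIdDeriv_le_one (m s : ℝ) : truncIdDeriv m s ≤ 1 := by
  unfold truncIdDeriv
  rw [div_le_one (by positivity)]
  linarith [sq_nonneg (s / m)]

theorem abs_truncId_le {m : ℝ} (hm : 0 < m) (s : ℝ) : |truncId m s| ≤ 2 * m := by
  have h1 := Real.arctan_lt_pi_div_two (s / m)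
  have h2 := Real.neg_pi_div_two_lt_arctan (s / m)
  have h3 := Real.pi_le_four
  rw [truncId, abs_mul, abs_of_pos hm, mul_comm]
  refine mul_le_mul_of_nonneg_right (abs_le.mpr ⟨?_, ?_⟩) hm.le <;> linarith

theorem truncId_nonneg {m s : ℝ} (hm : 0 < m) (hs : 0 ≤ s) : 0 ≤ truncId m s :=
  mul_nonneg hm.le (Real.arctan_nonneg.mpr (by positivity))

theorem truncId_le_self {m s : ℝ} (hm : 0 < m) (hs : 0 ≤ s) : truncId m s ≤ s := by
  have h : Real.arctan (s / m) ≤ s / m := by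
    have := Real.le_tan (Real.arctan_nonneg.mpr (by positivity : 0 ≤ s / m))
      (Real.arctan_lt_pi_div_two _)
    rwa [Real.tan_arctan] at this
  calc truncId m s ≤ m * (s / m) := mul_le_mul_of_nonneg_left h hm.le
    _ = s := by field_simp

theorem truncId_neg (m s : ℝ) : truncId m (-s) = -truncId m s := by
  simp [truncId, neg_div, Real.arctan_neg]

theorem abs_truncId_le_abs {m : ℝ} (hm : 0 < m) (s : ℝ) : |truncId m s| ≤ |s| := by
  rcases le_total 0 s with hs | hs
  · rw [abs_of_nonneg (truncId_nonneg hm hs), abs_of_nonneg hs]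
    exact truncId_le_self hm hs
  · have h := neg_nonneg.mpr hs
    rw [← abs_neg, ← truncId_neg, ← abs_neg s, abs_of_nonneg (truncId_nonneg hm h),
      abs_of_nonneg h]
    exact truncId_le_self hm h

theorem tendsto_truncId (s : ℝ) :
    Filter.Tendsto (fun m => truncId m s) Filter.atTop (nhds s) := by
  have h := (Real.hasDerivAt_arctan 0).hasFDerivAt.lim_real s
  simpa [truncId, div_eq_inv_mul] using h

theorem tendsto_truncIdDeriv (s : ℝ) :
    Filter.Tendsto (fun m => truncIdDeriv m s) Filter.atTop (nhds 1) := by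
  have h : Filter.Tendsto (fun m : ℝ => s / m) Filter.atTop (nhds 0) :=
    Filter.Tendsto.div_atTop tendsto_const_nhds Filter.tendsto_id
  have h2 := ((h.pow 2).const_add 1).inv₀ (by norm_num)
  simpa [truncIdDeriv] using h2

theorem uIcc_one_subset_Ioi {q : ℝ} (hq : 0 < q) : uIcc 1 q ⊆ Ioi 0 := fun _ hu =>
  lt_of_lt_of_le (lt_min one_pos hq) hu.1

theorem continuousOn_truncId_log (m : ℝ) :
    ContinuousOn (fun u => truncId m (Real.log u)) (Ioi 0) :=
  (continuous_truncId m).comp_continuousOn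
    (Real.continuousOn_log.mono fun _ hu => (ne_of_gt hu))

theorem intervalIntegrable_truncId_log (m : ℝ) {q : ℝ} (hq : 0 < q) :
    IntervalIntegrable (fun u => truncId m (Real.log u)) volume 1 q :=
  ((continuousOn_truncId_log m).mono (uIcc_one_subset_Ioi hq)).intervalIntegrable

theorem hasDerivAt_truncEntropy (m : ℝ) {q : ℝ} (hq : 0 < q) :
    HasDerivAt (truncEntropy m) (truncId m (Real.log q)) q :=
  intervalIntegral.integral_hasDerivAt_right (intervalIntegrable_truncId_log m hq)
    ((continuousOn_truncId_log m).stronglyMeasurableAtFilter isOpen_Ioi q hq)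
    ((continuousOn_truncId_log m).continuousAt (isOpen_Ioi.mem_nhds hq))

theorem klFun_eq_integral_log (q : ℝ) :
    InformationTheory.klFun q = ∫ u in (1 : ℝ)..q, Real.log u := by
  rw [integral_log, InformationTheory.klFun_apply]
  simp
  ring

theorem truncEntropy_nonneg {m q : ℝ} (hm : 0 < m) (hq : 0 < q) : 0 ≤ truncEntropy m q := by
  rcases le_total 1 q with h | h
  · exact intervalIntegral.integral_nonneg h fun u hu =>
      truncId_nonneg hm (Real.log_nonneg hu.1)
  · rw [truncEntropy, intervalIntegral.integral_symm, ← intervalIntegral.integral_neg]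
    refine intervalIntegral.integral_nonneg h fun u hu => ?_
    rw [← truncId_neg]
    exact truncId_nonneg hm (neg_nonneg.mpr (Real.log_nonpos (hq.le.trans hu.1) hu.2))

theorem truncEntropy_le_klFun {m q : ℝ} (hm : 0 < m) (hq : 0 < q) :
    truncEntropy m q ≤ InformationTheory.klFun q := by
  rw [klFun_eq_integral_log]
  have hi := intervalIntegrable_truncId_log m hq
  have hl : IntervalIntegrable Real.log volume 1 q := intervalIntegral.intervalIntegrable_log'
  rcases le_total 1 q with h | h
  · exact intervalIntegral.integral_mono_on h hi hl fun u hu =>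
      truncId_le_self hm (Real.log_nonneg hu.1)
  · rw [truncEntropy, intervalIntegral.integral_symm, intervalIntegral.integral_symm q,
      neg_le_neg_iff]
    refine intervalIntegral.integral_mono_on h hl.symm hi.symm fun u hu => ?_
    have h1 := neg_nonneg.mpr (Real.log_nonpos (hq.le.trans hu.1) hu.2)
    have h2 := truncId_le_self hm h1
    rw [truncId_neg] at h2
    linarith

theorem abs_truncEntropy_le {m q : ℝ} (hm : 0 < m) : |truncEntropy m q| ≤ 2 * m * |q - 1| := by
  have := intervalIntegral.norm_integral_le_of_norm_le_const (a := 1) (b := q)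
    (f := fun u => truncId m (Real.log u)) (C := 2 * m) fun u _ => abs_truncId_le hm _
  simpa [truncEntropy] using this

theorem tendsto_truncEntropy {q : ℝ} (hq : 0 < q) :
    Filter.Tendsto (fun m => truncEntropy m q) Filter.atTop
      (nhds (InformationTheory.klFun q)) := by
  rw [klFun_eq_integral_log]
  refine intervalIntegral.tendsto_integral_filter_of_dominated_convergence
    (fun u => |Real.log u|) ?_ ?_ ?_ ?_
  · filter_upwards with m
    exact (intervalIntegrable_truncId_log m hq).aestronglyMeasurable_restrict_uIoc
  · filter_upwards [Filter.eventually_gt_atTop 0] with m hm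
    exact Filter.Eventually.of_forall fun u _ => abs_truncId_le_abs hm _
  · exact (intervalIntegral.intervalIntegrable_log').abs
  · exact Filter.Eventually.of_forall fun u _ => tendsto_truncId _

/-! ### Primitives of integrable functions -/

theorem absolutelyContinuousOnInterval_of_dist_le {f F : ℝ → ℝ} {a b K : ℝ}
    (hf : AbsolutelyContinuousOnInterval f a b)
    (hF : ∀ x ∈ uIcc a b, ∀ y ∈ uIcc a b, dist (F x) (F y) ≤ K * dist (f x) (f y)) :
    AbsolutelyContinuousOnInterval F a b := by
  unfold AbsolutelyContinuousOnInterval at hf ⊢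
  have h := hf.const_mul K
  rw [mul_zero] at h
  refine squeeze_zero' (Filter.Eventually.of_forall fun E =>
    Finset.sum_nonneg fun _ _ => dist_nonneg) ?_ h
  filter_upwards [Filter.mem_inf_of_right (Filter.mem_principal_self _)] with E hE
  rw [Finset.mul_sum]
  exact Finset.sum_le_sum fun i hi => hF _ (hE.1 i hi).1 _ (hE.1 i hi).2

/-- The chain rule for a positive primitive `u` of an integrable function and a differentiable
`Ψ`. -/
theorem comp_primitive_sub_eq_integral {u g Ψ ψ : ℝ → ℝ} {t : ℝ} (ht : 0 ≤ t)
    (hg : IntervalIntegrable g volume 0 t)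
    (hu : ∀ s ∈ Icc 0 t, u s = u 0 + ∫ r in (0 : ℝ)..s, g r)
    (hpos : ∀ s ∈ Icc 0 t, 0 < u s)
    (hΨ : ∀ q, 0 < q → HasDerivAt Ψ (ψ q) q) {K : ℝ} (hψ : ∀ q, 0 < q → |ψ q| ≤ K) :
    Ψ (u t) - Ψ (u 0) = ∫ s in (0 : ℝ)..t, ψ (u s) * g s := by
  set U : ℝ → ℝ := fun s => u 0 + ∫ r in (0 : ℝ)..s, g r with hU
  have huU : ∀ s ∈ Icc 0 t, u s = U s := hu
  have h0t : (0 : ℝ) ∈ uIcc 0 t := left_mem_uIcc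
  have hAC : AbsolutelyContinuousOnInterval U 0 t := by
    refine absolutelyContinuousOnInterval_of_dist_le (K := 1)
      (hg.absolutelyContinuousOnInterval_intervalIntegral h0t) fun x _ y _ => ?_
    rw [one_mul, hU, dist_add_left]
  have hLip : ∀ x ∈ Ioi (0 : ℝ), ∀ y ∈ Ioi (0 : ℝ), dist (Ψ x) (Ψ y) ≤ K * dist x y := by
    intro x hx y hy
    rw [dist_eq_norm, dist_eq_norm]
    exact (convex_Ioi (0 : ℝ)).norm_image_sub_le_of_norm_hasDerivWithin_le
      (fun q hq => (hΨ q hq).hasDerivWithinAt) (fun q hq => hψ q hq) hy hx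
  have hposU : ∀ s ∈ uIcc 0 t, 0 < U s := fun s hs => by
    rw [uIcc_of_le ht] at hs
    rw [← huU s hs]
    exact hpos s hs
  have hAC2 : AbsolutelyContinuousOnInterval (fun s => Ψ (U s)) 0 t :=
    absolutelyContinuousOnInterval_of_dist_le hAC fun x hx y hy =>
      hLip _ (hposU x hx) _ (hposU y hy)
  have e := hAC2.integral_deriv_eq_sub
  rw [huU t (right_mem_Icc.mpr ht), huU 0 (left_mem_Icc.mpr ht), ← e]
  refine intervalIntegral.integral_congr_ae ?_
  filter_upwards [hg.ae_hasDerivAt_integral] with s hs hst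
  have hs' : s ∈ uIcc 0 t := uIoc_subset_uIcc hst
  have h1 : HasDerivAt U (g s) s := (hs hs' 0 h0t).const_add (u 0)
  have h2 : HasDerivAt (fun s => Ψ (U s)) (ψ (U s) * g s) s := (hΨ _ (hposU s hs')).comp s h1
  rw [h2.deriv, huU s (by rwa [uIcc_of_le ht] at hs')]

/-- A continuous function on `[0, ∞)` whose distributional derivative, including the initial
value, is the locally integrable function `-q`, is a primitive of `-q`. -/
theorem eq_sub_integral_of_weak {m q : ℝ → ℝ} (hm : ContinuousOn m (Ici 0))
    (hq : ∀ t, 0 ≤ t → IntervalIntegrable q volume 0 t)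
    (hweak : ∀ θ : ℝ → ℝ, ContDiff ℝ ∞ θ → HasCompactSupport θ →
      (∫ t in Ioi (0 : ℝ), (deriv θ t * m t - θ t * q t)) + θ 0 * m 0 = 0)
    {t : ℝ} (ht : 0 ≤ t) : m t = m 0 - ∫ s in (0 : ℝ)..t, q s := by
  set Q : ℝ → ℝ := fun t => ∫ s in (0 : ℝ)..t, q s with hQ
  have hQc : ContinuousOn Q (Ici 0) := by
    intro x hx
    have hx1 : (0 : ℝ) ≤ x + 1 := by linarith [mem_Ici.mp hx]
    have h1 : ContinuousOn Q (uIcc 0 (x + 1)) :=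
      ((hq (x + 1) hx1).absolutelyContinuousOnInterval_intervalIntegral
        left_mem_uIcc).continuousOn
    rw [uIcc_of_le hx1] at h1
    refine (h1 x ⟨hx, by linarith⟩).mono_of_mem_nhdsWithin ?_
    rw [← Ici_inter_Iic]
    exact Filter.inter_mem self_mem_nhdsWithin
      (mem_nhdsWithin_of_mem_nhds (Iic_mem_nhds (by linarith)))
  set u : ℝ → ℝ := fun t => m t + Q t - m 0 with hu
  have huc : ContinuousOn u (Ici 0) := (hm.add hQc).sub continuousOn_const
  have key : ∀ h : ℝ → ℝ, ContDiff ℝ ∞ h → HasCompactSupport h → tsupport h ⊆ Ioi 0 →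
      ∫ t, h t • u t = 0 := by
    intro h hh hhc hhs
    obtain ⟨b, hb⟩ : ∃ b, ∀ t, b ≤ t → h t = 0 := by
      obtain ⟨b, hb⟩ := hhc.isCompact.bddAbove
      refine ⟨b + 1, fun t ht => image_eq_zero_of_notMem_tsupport fun hmem => ?_⟩
      linarith [hb hmem]
    have hneg : ∀ t, t ≤ 0 → h t = 0 := fun t ht =>
      image_eq_zero_of_notMem_tsupport fun hmem => (not_lt.mpr ht) (hhs hmem)
    set b' := max b 0 with hb'
    have hb0 : (0 : ℝ) ≤ b' := le_max_right _ _
    -- the test function is a primitive `P` of `h` vanishing for large times, cut off smoothly at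
    -- negative times, which changes neither its value at `0` nor its derivative on `(0, ∞)`
    set P : ℝ → ℝ := fun t => ∫ s in b'..t, h s with hP
    have hPd : ∀ t, HasDerivAt P (h t) t := fun t =>
      hh.continuous.integral_hasStrictDerivAt b' t |>.hasDerivAt
    have hPs : ContDiff ℝ ∞ P := by
      rw [contDiff_infty_iff_deriv]
      refine ⟨fun t => (hPd t).differentiableAt, ?_⟩
      rw [show deriv P = h from funext fun t => (hPd t).deriv]
      exact hh
    have hP0 : ∀ t, b' ≤ t → P t = 0 := fun t ht => by
      rw [hP]
      refine (intervalIntegral.integral_congr fun s hs => ?_).trans intervalIntegral.integral_zero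
      rw [uIcc_of_le ht] at hs
      exact hb s ((le_max_left _ _).trans hs.1)
    set θ : ℝ → ℝ := fun t => Real.smoothTransition (t + 1) * P t with hθ
    have hθs : ContDiff ℝ ∞ θ :=
      (Real.smoothTransition.contDiff.comp (contDiff_id.add contDiff_const)).mul hPs
    have hθc : HasCompactSupport θ := by
      refine HasCompactSupport.of_support_subset_isCompact (isCompact_Icc (a := -1) (b := b')) ?_
      intro t ht
      rw [Function.mem_support] at ht
      constructor
      · by_contra hlt
        exact ht (by rw [hθ]; simp [Real.smoothTransition.zero_of_nonpos
          (by linarith : t + 1 ≤ 0)])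
      · by_contra hlt
        exact ht (by rw [hθ]; simp [hP0 t (by linarith)])
    have hθP : ∀ t, 0 ≤ t → θ t = P t := fun t ht => by
      rw [hθ]
      simp [Real.smoothTransition.one_of_one_le (by linarith : 1 ≤ t + 1)]
    have hθd : ∀ t, 0 < t → deriv θ t = h t := fun t ht => by
      have : θ =ᶠ[nhds t] P := by
        filter_upwards [Ioi_mem_nhds ht] with s hs using hθP s (le_of_lt hs)
      rw [this.deriv_eq, (hPd t).deriv]
    have hw := hweak θ hθs hθc
    have hqi := hq b' hb0
    have hmi : IntervalIntegrable (fun t => h t * m t) volume 0 b' := by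
      refine ContinuousOn.intervalIntegrable ?_
      rw [uIcc_of_le hb0]
      exact hh.continuous.continuousOn.mul (hm.mono Icc_subset_Ici_self)
    have hPq : IntervalIntegrable (fun t => P t * q t) volume 0 b' :=
      hqi.continuousOn_mul hPs.continuous.continuousOn
    have e1 : ∫ t in Ioi (0 : ℝ), (deriv θ t * m t - θ t * q t)
        = ∫ t in (0 : ℝ)..b', (h t * m t - P t * q t) := by
      rw [intervalIntegral.integral_of_le hb0]
      refine (setIntegral_eq_of_subset_of_forall_sdiff_eq_zero measurableSet_Ioi
        Ioc_subset_Ioi_self fun t ht => ?_).trans (setIntegral_congr_fun measurableSet_Ioc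
          fun t ht => ?_)
      · have ht0 : 0 < t := ht.1
        have htb : b' ≤ t := by
          by_contra hlt
          exact ht.2 ⟨ht0, by linarith⟩
        rw [hθd t ht0, hθP t ht0.le, hP0 t htb, hb t ((le_max_left _ _).trans htb)]
        ring
      · rw [hθd t ht.1, hθP t ht.1.le]
    have hACQ := hqi.absolutelyContinuousOnInterval_intervalIntegral (left_mem_uIcc (a := 0))
    have hACP : AbsolutelyContinuousOnInterval P 0 b' :=
      (hPs.of_le (by norm_num)).contDiffOn.absolutelyContinuousOnInterval
    have e2 := hACP.integral_mul_deriv_eq_deriv_mul hACQ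
    have e3 : ∫ t in (0 : ℝ)..b', P t * deriv (fun x => ∫ v in (0 : ℝ)..x, q v) t
        = ∫ t in (0 : ℝ)..b', P t * q t := by
      refine intervalIntegral.integral_congr_ae ?_
      filter_upwards [hqi.ae_hasDerivAt_integral] with s hs hst
      rw [(hs (uIoc_subset_uIcc hst) 0 left_mem_uIcc).deriv]
    have e4 : ∫ t in (0 : ℝ)..b', deriv P t * (∫ v in (0 : ℝ)..t, q v)
        = ∫ t in (0 : ℝ)..b', h t * Q t :=
      intervalIntegral.integral_congr fun s _ => by
        simp only [(hPd s).deriv, hQ]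
    rw [e3, e4, hP0 b' le_rfl, intervalIntegral.integral_same] at e2
    have e5 : ∫ t in (0 : ℝ)..b', h t = - P 0 := by
      rw [hP, intervalIntegral.integral_symm]
    have hQi : IntervalIntegrable (fun t => h t * Q t) volume 0 b' := by
      refine ContinuousOn.intervalIntegrable ?_
      rw [uIcc_of_le hb0]
      exact hh.continuous.continuousOn.mul (hQc.mono Icc_subset_Ici_self)
    have e6 : ∫ t in (0 : ℝ)..b', h t * u t = 0 := by
      have e7 : ∫ t in (0 : ℝ)..b', h t * u t = (∫ t in (0 : ℝ)..b', h t * m t)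
          + (∫ t in (0 : ℝ)..b', h t * Q t) - (∫ t in (0 : ℝ)..b', h t) * m 0 := by
        have hci : IntervalIntegrable (fun t => h t * m 0) volume 0 b' :=
          (hh.continuous.mul continuous_const).intervalIntegrable _ _
        rw [← intervalIntegral.integral_mul_const, ← intervalIntegral.integral_add hmi hQi,
          ← intervalIntegral.integral_sub (hmi.add hQi) hci]
        refine intervalIntegral.integral_congr fun s _ => ?_
        simp only [hu]
        ring
      rw [e1, intervalIntegral.integral_sub hmi hPq, hθP 0 le_rfl] at hw
      rw [e7, e5]
      linarith
    rw [← e6, intervalIntegral.integral_of_le hb0]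
    refine (setIntegral_eq_integral_of_forall_compl_eq_zero fun t ht => ?_).symm
    have : h t = 0 := by
      rcases le_or_gt t 0 with h0 | h0
      · exact hneg t h0
      · refine hb t ((le_max_left b 0).trans ?_)
        by_contra hlt
        exact ht ⟨h0, by linarith⟩
    simp [this]
  have hloc : LocallyIntegrableOn u (Ioi 0) :=
    (huc.mono Ioi_subset_Ici_self).locallyIntegrableOn measurableSet_Ioi
  have hae := isOpen_Ioi.ae_eq_zero_of_integral_contDiff_smul_eq_zero hloc key
  have hzero : EqOn u (fun _ => 0) (Ioi 0) :=
    Measure.eqOn_open_of_ae_eq ((ae_restrict_iff' measurableSet_Ioi).mpr hae) isOpen_Ioi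
      (huc.mono Ioi_subset_Ici_self) continuousOn_const
  rcases ht.eq_or_lt with h | h
  · rw [← h]; simp
  · have := hzero h
    simp only [hu] at this
    linarith

/-! ### Mollification in space -/

section mollify

variable {d : ℕ} {E : Type*} [NormedAddCommGroup E] [NormedSpace ℝ E]

/-- A smooth probability density supported in the closed unit ball. -/
structure IsMollifier (η : Rd d → ℝ) : Prop where
  contDiff : ContDiff ℝ ∞ η
  nonneg : ∀ x, 0 ≤ η x
  integral_eq_one : ∫ x, η x = 1
  norm_le_one : ∀ x, η x ≠ 0 → ‖x‖ ≤ 1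

/-- The convolution `η * g`. -/
def mollify (η : Rd d → ℝ) (g : Rd d → E) (x : Rd d) : E := ∫ y, η (x - y) • g y

theorem mollify_eq_integral_sub (η : Rd d → ℝ) (g : Rd d → E) (x : Rd d) :
    mollify η g x = ∫ y, η y • g (x - y) := by
  rw [mollify, ← integral_sub_left_eq_self (fun y => η y • g (x - y)) volume x]
  simp

namespace IsMollifier

variable {η : Rd d → ℝ} (hη : IsMollifier η)

include hη

theorem continuous : Continuous η := hη.contDiff.continuous

theorem hasCompactSupport : HasCompactSupport η :=
  HasCompactSupport.of_support_subset_isCompact (isCompact_closedBall (0 : Rd d) 1) fun x hx => by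
    rw [mem_closedBall_zero_iff]
    exact hη.norm_le_one x hx

theorem integrable : Integrable η := hη.continuous.integrable_of_hasCompactSupport
  hη.hasCompactSupport

theorem integrable_smul {g : Rd d → E} (hg : Continuous g) (x : Rd d) :
    Integrable fun y => η y • g (x - y) :=
  Continuous.integrable_of_hasCompactSupport
    (hη.continuous.smul (hg.comp (continuous_const.sub continuous_id)))
    hη.hasCompactSupport.smul_right

theorem norm_mollify_le_mollify {g : Rd d → E} {a : Rd d → ℝ} (ha : Continuous a) {x : Rd d}
    (h : ∀ y ∈ Metric.closedBall x 1, ‖g y‖ ≤ a y) : ‖mollify η g x‖ ≤ mollify η a x := by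
  rw [mollify_eq_integral_sub, mollify_eq_integral_sub]
  refine norm_integral_le_of_norm_le (hη.integrable_smul ha x) (Filter.Eventually.of_forall
    fun y => ?_)
  rw [norm_smul, Real.norm_of_nonneg (hη.nonneg y), smul_eq_mul]
  by_cases hy : η y = 0
  · simp [hy]
  · refine mul_le_mul_of_nonneg_left (h _ ?_) (hη.nonneg y)
    rw [Metric.mem_closedBall, dist_eq_norm]
    simpa using hη.norm_le_one y hy

theorem mollify_const (c : ℝ) (x : Rd d) : mollify η (fun _ => c) x = c := by
  rw [mollify_eq_integral_sub]
  simp only [smul_eq_mul]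
  rw [integral_mul_const, hη.integral_eq_one, one_mul]

theorem norm_mollify_le_of_forall {g : Rd d → E} {C : ℝ} {x : Rd d}
    (h : ∀ y ∈ Metric.closedBall x 1, ‖g y‖ ≤ C) : ‖mollify η g x‖ ≤ C := by
  have := hη.norm_mollify_le_mollify (a := fun _ => C) continuous_const h
  rwa [hη.mollify_const] at this

theorem mollify_pos {g : Rd d → ℝ} (hg : Continuous g) (hpos : ∀ x, 0 < g x) (x : Rd d) :
    0 < mollify η g x := by
  rw [mollify_eq_integral_sub]
  obtain ⟨y, hy⟩ : ∃ y, η y ≠ 0 := by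
    by_contra h
    push Not at h
    have := hη.integral_eq_one
    simp [h] at this
  refine Continuous.integral_pos_of_hasCompactSupport_nonneg_nonzero (x := y)
    (hη.continuous.mul (hg.comp (continuous_const.sub continuous_id)))
    hη.hasCompactSupport.mul_right
    (fun y => mul_nonneg (hη.nonneg y) (hpos _).le) (mul_ne_zero hy (hpos _).ne')

theorem hasFDerivAt_mollify {g : Rd d → ℝ} (hg : ContDiff ℝ 1 g) (x : Rd d) :
    HasFDerivAt (mollify η g) (mollify η (fderiv ℝ g) x) x := by
  have hg' : Continuous (fderiv ℝ g) := hg.continuous_fderiv one_ne_zero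
  obtain ⟨C, hC⟩ := (isCompact_closedBall x 2).exists_bound_of_continuousOn hg'.continuousOn
  have e : mollify η g = fun x => ∫ y, η y • g (x - y) := funext (mollify_eq_integral_sub η g)
  rw [e, mollify_eq_integral_sub]
  refine hasFDerivAt_integral_of_dominated_of_fderiv_le (bound := fun y => η y * C)
    (F' := fun x y => η y • fderiv ℝ g (x - y)) (Metric.ball_mem_nhds x one_pos)
    (Filter.Eventually.of_forall fun x => (hη.integrable_smul hg.continuous x).aestronglyMeasurable)
    (hη.integrable_smul hg.continuous x)
    (hη.integrable_smul hg' x).aestronglyMeasurable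
    (Filter.Eventually.of_forall fun y z hz => ?_) (hη.integrable.mul_const C)
    (Filter.Eventually.of_forall fun y z _ => ?_)
  · rw [norm_smul, Real.norm_of_nonneg (hη.nonneg y)]
    by_cases hy : η y = 0
    · simp [hy]
    · refine mul_le_mul_of_nonneg_left (hC _ ?_) (hη.nonneg y)
      rw [Metric.mem_closedBall, dist_eq_norm]
      have h1 := hη.norm_le_one y hy
      have h2 := mem_ball_iff_norm.mp hz
      calc ‖z - y - x‖ = ‖(z - x) - y‖ := by congr 1; abel
        _ ≤ ‖z - x‖ + ‖y‖ := norm_sub_le _ _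
        _ ≤ 2 := by linarith
  · have h1 : HasFDerivAt (fun z => g (z - y)) (fderiv ℝ g (z - y)) z :=
      (hasFDerivAt_comp_sub y).mpr
      (hg.differentiable one_ne_zero (z - y)).hasFDerivAt
    exact h1.const_smul (η y)

theorem continuous_mollify [CompleteSpace E] {g : Rd d → E} (hg : Continuous g) :
    Continuous (mollify η g) := by
  have e : mollify η g = convolution η g (ContinuousLinearMap.lsmul ℝ ℝ) volume := by
    funext x
    rw [mollify_eq_integral_sub]
    rfl
  rw [e]
  exact hη.hasCompactSupport.continuous_convolution_left _ hη.continuous hg.locallyIntegrable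

theorem contDiff_mollify {g : Rd d → ℝ} (hg : ContDiff ℝ 1 g) : ContDiff ℝ 1 (mollify η g) := by
  rw [contDiff_one_iff_fderiv]
  refine ⟨fun x => (hη.hasFDerivAt_mollify hg x).differentiableAt, ?_⟩
  rw [show fderiv ℝ (mollify η g) = mollify η (fderiv ℝ g) from
    funext fun x => (hη.hasFDerivAt_mollify hg x).fderiv]
  exact hη.continuous_mollify (hg.continuous_fderiv one_ne_zero)

theorem setIntegral_mollify_le {a : Rd d → ℝ} (ha : Continuous a) (ha0 : ∀ x, 0 ≤ a x) (R : ℝ) :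
    ∫ x in Metric.closedBall 0 R, mollify η a x ≤ ∫ x in Metric.closedBall 0 (R + 1), a x := by
  have hcomp : IsCompact (Metric.closedBall (0 : Rd d) R ×ˢ Metric.closedBall (0 : Rd d) 1) :=
    (isCompact_closedBall _ _).prod (isCompact_closedBall _ _)
  have hcont : Continuous fun p : Rd d × Rd d => η p.2 • a (p.1 - p.2) :=
    (hη.continuous.comp continuous_snd).smul (ha.comp (continuous_fst.sub continuous_snd))
  have hint : Integrable (fun p : Rd d × Rd d => η p.2 • a (p.1 - p.2))
      ((volume.restrict (Metric.closedBall 0 R)).prod volume) := by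
    have h1 : IntegrableOn (fun p : Rd d × Rd d => η p.2 • a (p.1 - p.2))
        (Metric.closedBall (0 : Rd d) R ×ˢ Metric.closedBall (0 : Rd d) 1) :=
      hcont.continuousOn.integrableOn_compact hcomp
    have h2 : IntegrableOn (fun p : Rd d × Rd d => η p.2 • a (p.1 - p.2))
        (Metric.closedBall (0 : Rd d) R ×ˢ univ) := by
      refine h1.of_forall_sdiff_eq_zero (measurableSet_closedBall.prod .univ) fun p hp => ?_
      have : η p.2 = 0 := by
        by_contra h
        exact hp.2 ⟨hp.1.1, mem_closedBall_zero_iff.mpr (hη.norm_le_one _ h)⟩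
      simp [this]
    rwa [IntegrableOn, Measure.volume_eq_prod, ← Measure.prod_restrict,
      Measure.restrict_univ] at h2
  have e1 : ∫ x in Metric.closedBall 0 R, mollify η a x
      = ∫ y, ∫ x in Metric.closedBall 0 R, η y • a (x - y) := by
    rw [← integral_integral_swap hint]
    exact integral_congr_ae (Filter.Eventually.of_forall fun x => mollify_eq_integral_sub η a x)
  have hle : ∀ y, ∫ x in Metric.closedBall 0 R, η y • a (x - y)
      ≤ η y * ∫ x in Metric.closedBall 0 (R + 1), a x := fun y => by
    simp only [smul_eq_mul]
    rw [integral_const_mul]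
    by_cases hy : η y = 0
    · simp [hy]
    refine mul_le_mul_of_nonneg_left ?_ (hη.nonneg y)
    have e2 : ∫ x in Metric.closedBall 0 R, a (x - y)
        = ∫ x in (fun x => x - y) ⁻¹' Metric.closedBall (-y) R, a (x - y) := by
      congr 2
      ext x
      simp [dist_eq_norm]
    rw [e2, (measurePreserving_sub_right volume y).setIntegral_preimage_emb
      (MeasurableEquiv.subRight y).measurableEmbedding]
    refine setIntegral_mono_set (ha.continuousOn.integrableOn_compact (isCompact_closedBall _ _))
      (Filter.Eventually.of_forall ha0) (LE.le.eventuallyLE ?_)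
    refine Metric.closedBall_subset_closedBall' ?_
    rw [dist_zero_right, norm_neg]
    linarith [hη.norm_le_one y hy]
  calc ∫ x in Metric.closedBall 0 R, mollify η a x
      = ∫ y, ∫ x in Metric.closedBall 0 R, η y • a (x - y) := e1
    _ ≤ ∫ y, η y * ∫ x in Metric.closedBall 0 (R + 1), a x :=
        integral_mono hint.integral_prod_right (hη.integrable.mul_const _) hle
    _ = ∫ x in Metric.closedBall 0 (R + 1), a x := by
        rw [integral_mul_const, hη.integral_eq_one, one_mul]

theorem norm_le_one_of_fderiv_ne_zero {z : Rd d} (hz : fderiv ℝ η z ≠ 0) : ‖z‖ ≤ 1 := by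
  have h1 : tsupport η ⊆ Metric.closedBall 0 1 :=
    closure_minimal (fun x hx => mem_closedBall_zero_iff.mpr (hη.norm_le_one x hx))
      Metric.isClosed_closedBall
  exact mem_closedBall_zero_iff.mp (h1 (support_fderiv_subset ℝ hz))

/-- Integration by parts: the mollified divergence of `f`, written with the derivative on the
mollifier, is tested against `w`. -/
theorem integral_mul_integral_fderiv {w : Rd d → ℝ} (hw : ContDiff ℝ 1 w)
    (hwc : HasCompactSupport w) {f : Rd d → Rd d} (hf : Continuous f) :
    ∫ x, w x * ∫ y, fderiv ℝ η (x - y) (f y) = - ∫ x, fderiv ℝ w x (mollify η f x) := by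
  have hη' : Continuous (fderiv ℝ η) := hη.contDiff.continuous_fderiv (by simp)
  have hw' : Continuous (fderiv ℝ w) := hw.continuous_fderiv one_ne_zero
  have hK : IsCompact ((fun p : Rd d × Rd d => (p.1, p.1 - p.2)) ''
      (tsupport w ×ˢ Metric.closedBall (0 : Rd d) 1)) :=
    (hwc.isCompact.prod (isCompact_closedBall _ _)).image (by fun_prop)
  have hmem : ∀ x y : Rd d, x ∈ tsupport w → ‖x - y‖ ≤ 1 → (x, y) ∈
      (fun p : Rd d × Rd d => (p.1, p.1 - p.2)) ''
      (tsupport w ×ˢ Metric.closedBall (0 : Rd d) 1) := fun x y hx hxy =>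
    ⟨(x, x - y), ⟨hx, mem_closedBall_zero_iff.mpr hxy⟩, by simp⟩
  have s1 : HasCompactSupport (Function.uncurry fun x y : Rd d =>
      w x * fderiv ℝ η (x - y) (f y)) := by
    refine HasCompactSupport.of_support_subset_isCompact hK fun p hp => hmem _ _ ?_ ?_
    · exact subset_tsupport w (left_ne_zero_of_mul hp)
    · exact hη.norm_le_one_of_fderiv_ne_zero fun h => right_ne_zero_of_mul hp (by rw [h]; rfl)
  have s2 : HasCompactSupport (Function.uncurry fun y x : Rd d =>
      fderiv ℝ w x (f y) * η (x - y)) := by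
    refine HasCompactSupport.of_support_subset_isCompact (hK.image continuous_swap) fun p hp =>
      ⟨(p.2, p.1), hmem _ _ ?_ ?_, rfl⟩
    · exact support_fderiv_subset ℝ (fun h => left_ne_zero_of_mul hp (by rw [h]; rfl))
    · exact hη.norm_le_one _ (right_ne_zero_of_mul hp)
  have c1 : Continuous (Function.uncurry fun x y : Rd d => w x * fderiv ℝ η (x - y) (f y)) :=
    (hw.continuous.comp continuous_fst).mul
      ((hη'.comp (continuous_fst.sub continuous_snd)).clm_apply (hf.comp continuous_snd))
  have c2 : Continuous (Function.uncurry fun y x : Rd d => fderiv ℝ w x (f y) * η (x - y)) :=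
    ((hw'.comp continuous_snd).clm_apply (hf.comp continuous_fst)).mul
      (hη.continuous.comp (continuous_snd.sub continuous_fst))
  have hparts : ∀ y, ∫ x, w x * fderiv ℝ η (x - y) (f y)
      = - ∫ x, fderiv ℝ w x (f y) * η (x - y) := fun y => by
    have hd : ∀ x, fderiv ℝ (fun x => η (x - y)) x = fderiv ℝ η (x - y) := fun x =>
      fderiv_comp_sub y
    have := integral_mul_fderiv_eq_neg_fderiv_mul_of_integrable (μ := (volume : Measure (Rd d)))
      (f := w) (g := fun x => η (x - y)) (v := f y) ?_ ?_ ?_ ?_ ?_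
    · simpa only [hd] using this
    · exact (c2.comp (Continuous.prodMk_right y)).integrable_of_hasCompactSupport
        ((hwc.fderiv ℝ).mono fun x hx h => hx (by simp [h]))
    · simp only [hd]
      exact (c1.comp (Continuous.prodMk_left y)).integrable_of_hasCompactSupport
        (hwc.mono fun x hx => left_ne_zero_of_mul hx)
    · exact (hw.continuous.mul (hη.continuous.comp
        (continuous_id.sub continuous_const))).integrable_of_hasCompactSupport hwc.mul_right
    · exact fun x _ => hw.differentiable one_ne_zero x
    · exact fun x _ => ((hη.contDiff.differentiable (by simp)).comp
        (differentiable_id.sub_const y)) x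
  calc ∫ x, w x * ∫ y, fderiv ℝ η (x - y) (f y)
      = ∫ x, ∫ y, w x * fderiv ℝ η (x - y) (f y) := by simp_rw [integral_const_mul]
    _ = ∫ y, ∫ x, w x * fderiv ℝ η (x - y) (f y) :=
        integral_integral_swap_of_hasCompactSupport c1 s1
    _ = - ∫ y, ∫ x, fderiv ℝ w x (f y) * η (x - y) := by simp_rw [hparts, integral_neg]
    _ = - ∫ x, ∫ y, fderiv ℝ w x (f y) * η (x - y) := by
        rw [integral_integral_swap_of_hasCompactSupport c2 s2]
    _ = - ∫ x, fderiv ℝ w x (mollify η f x) := by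
        congr 1
        refine integral_congr_ae (Filter.Eventually.of_forall fun x => ?_)
        have hi : Integrable fun y => η (x - y) • f y := by
          have := (hη.integrable_smul hf x).comp_sub_left x
          simpa using this
        change _ = fderiv ℝ w x (∫ y, η (x - y) • f y)
        rw [← ContinuousLinearMap.integral_comp_comm _ hi]
        refine integral_congr_ae (Filter.Eventually.of_forall fun y => ?_)
        simp [mul_comm]

end IsMollifier

/-- A standard mollifier supported in the ball of radius `1 / (n + 1)`. -/
def stdMollifier (d n : ℕ) : Rd d → ℝ :=
  ContDiffBump.normed (c := 0) ⟨1 / (2 * ((n : ℝ) + 1)), 1 / ((n : ℝ) + 1), by positivity,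
    one_div_lt_one_div_of_lt (by positivity) (by linarith [n.cast_nonneg (α := ℝ)])⟩ volume

theorem isMollifier_stdMollifier (d n : ℕ) : IsMollifier (stdMollifier d n) where
  contDiff := ContDiffBump.contDiff_normed _
  nonneg := ContDiffBump.nonneg_normed _
  integral_eq_one := ContDiffBump.integral_normed _
  norm_le_one x hx := by
    have h := ContDiffBump.support_normed_eq (μ := (volume : Measure (Rd d)))
      (f := (⟨1 / (2 * ((n : ℝ) + 1)), 1 / ((n : ℝ) + 1), by positivity,
      one_div_lt_one_div_of_lt (by positivity) (by linarith [n.cast_nonneg (α := ℝ)])⟩ :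
        ContDiffBump (0 : Rd d)))
    have h2 : x ∈ Metric.ball (0 : Rd d) (1 / ((n : ℝ) + 1)) := by
      rw [← h]
      exact hx
    rw [mem_ball_zero_iff] at h2
    refine h2.le.trans ?_
    rw [div_le_one (by positivity)]
    linarith [n.cast_nonneg (α := ℝ)]

theorem tendsto_mollify_stdMollifier [CompleteSpace E] {g : Rd d → E} (hg : Continuous g)
    (x : Rd d) :
    Filter.Tendsto (fun n => mollify (stdMollifier d n) g x) Filter.atTop (nhds (g x)) := by
  have h := ContDiffBump.convolution_tendsto_right_of_continuous
    (μ := (volume : Measure (Rd d))) (l := Filter.atTop)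
    (φ := fun n : ℕ => (⟨1 / (2 * ((n : ℝ) + 1)), 1 / ((n : ℝ) + 1), by positivity,
      one_div_lt_one_div_of_lt (by positivity) (by linarith [n.cast_nonneg (α := ℝ)])⟩ :
        ContDiffBump (0 : Rd d))) tendsto_one_div_add_atTop_nhds_zero_nat hg x
  refine h.congr fun n => ?_
  rw [mollify_eq_integral_sub]
  rfl

end mollify

/-! ### The continuity equation for the mollified densities -/

section flow

variable {d : ℕ}

/-- A weak solution of `∂ₜ ρ = ∇ · (ρ v)` on `[0, T]` whose velocities are continuous in space and
whose energy is square integrable in time: the function `b`, with `∫ b² < ∞`, bounds up to constants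
the velocity on every ball, its `L²(ρ)` norm, and the `L²(ρ)` norm of `∇ log (ρ / π)`. -/
structure IsEnergyFlow (π : Rd d → ℝ) (ρ : ℝ → Rd d → ℝ) (v : ℝ → Rd d → Rd d) (b : ℝ → ℝ)
    (T : ℝ) : Prop where
  target : IsDensity π
  isDensity : ∀ t, 0 ≤ t → IsDensity (ρ t)
  weakly_continuous : ∀ f : Rd d →ᵇ ℝ, ContinuousOn (fun t => ∫ x, f x * ρ t x) (Ici 0)
  continuous_velocity : ∀ t, 0 < t → Continuous (v t)
  flux_integrable : ∀ T R : ℝ, IntegrableOn (fun p : ℝ × Rd d => ρ p.1 p.2 • v p.1 p.2)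
    (Ioc 0 T ×ˢ Metric.closedBall 0 R)
  weak_form : ∀ φ : ℝ × Rd d → ℝ, ContDiff ℝ ∞ φ → HasCompactSupport φ →
    (∫ t in Ioi (0 : ℝ), ∫ x, (deriv (fun s => φ (s, x)) t
        - ⟪gradient (fun y => φ (t, y)) x, v t x⟫_ℝ) * ρ t x) + ∫ x, φ (0, x) * ρ 0 x = 0
  bound_nonneg : ∀ t, 0 ≤ b t
  bound_integrable : IntegrableOn (fun t => b t ^ 2) (Ioc 0 T)
  speed_le : ∀ R : ℝ, ∃ C, 0 ≤ C ∧ ∀ t ∈ Ioc 0 T, ∀ x ∈ Metric.closedBall 0 R,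
    ‖v t x‖ ≤ C * b t
  velocity_memLp : ∀ t ∈ Ioc 0 T, MemLp (v t) 2 (dens (ρ t))
  velocity_le : ∃ C, 0 ≤ C ∧ ∀ t ∈ Ioc 0 T, ∫ x, ‖v t x‖ ^ 2 ∂(dens (ρ t)) ≤ (C * b t) ^ 2
  score_memLp : ∀ t ∈ Ioc 0 T, MemLp (score (ρ t) π) 2 (dens (ρ t))
  score_le : ∀ t ∈ Ioc 0 T, ∫ x, ‖score (ρ t) π x‖ ^ 2 ∂(dens (ρ t)) ≤ b t ^ 2

theorem IsDensity.continuous {ρ : Rd d → ℝ} (h : IsDensity ρ) : Continuous ρ :=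
  h.contDiff.continuous

theorem IsDensity.integrable {ρ : Rd d → ℝ} (h : IsDensity ρ) : Integrable ρ := by
  by_contra hn
  have := h.integral_eq_one
  rw [integral_undef hn] at this
  exact zero_ne_one this

/-- The mollified divergence `η * (∇ · f)`, with the derivative placed on the mollifier. For
`f = ρ t v t` it is the rate of change of the mollified density `η * ρ t`. -/
def mollifiedDiv (η : Rd d → ℝ) (f : Rd d → Rd d) (x : Rd d) : ℝ :=
  ∫ y, fderiv ℝ η (x - y) (f y)

namespace IsMollifier

variable {η : Rd d → ℝ} (hη : IsMollifier η)

include hη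

theorem hasCompactSupport_fderiv_sub (x : Rd d) :
    HasCompactSupport fun y => fderiv ℝ η (x - y) :=
  (hη.hasCompactSupport.fderiv ℝ).comp_homeomorph (Homeomorph.subLeft x)

theorem continuous_fderiv_sub (x : Rd d) : Continuous fun y => fderiv ℝ η (x - y) :=
  (hη.contDiff.continuous_fderiv (by simp)).comp (continuous_const.sub continuous_id)

theorem fderiv_comp_sub_left (x y : Rd d) :
    fderiv ℝ (fun y => η (x - y)) y = - fderiv ℝ η (x - y) := by
  have h1 := (hη.contDiff.differentiable (by simp) (x - y)).hasFDerivAt.comp y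
    ((hasFDerivAt_id y).const_sub x)
  rw [show (fun y => η (x - y)) = η ∘ HSub.hSub x from rfl, h1.fderiv]
  ext e
  simp

end IsMollifier

namespace IsEnergyFlow

variable {π : Rd d → ℝ} {ρ : ℝ → Rd d → ℝ} {v : ℝ → Rd d → Rd d} {b : ℝ → ℝ} {T : ℝ}
  (F : IsEnergyFlow π ρ v b T)

include F

theorem continuous_flux {t : ℝ} (ht : 0 < t) : Continuous fun x => ρ t x • v t x :=
  (F.isDensity t ht.le).continuous.smul (F.continuous_velocity t ht)

theorem aestronglyMeasurable_flux (T : ℝ) :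
    AEStronglyMeasurable (fun p : ℝ × Rd d => ρ p.1 p.2 • v p.1 p.2)
      ((volume.restrict (Ioc 0 T)).prod volume) := by
  have e : (volume.restrict (Ioc 0 T)).prod (volume : Measure (Rd d))
      = volume.restrict (⋃ n : ℕ, Ioc 0 T ×ˢ Metric.closedBall (0 : Rd d) n) := by
    rw [← prod_iUnion, Metric.iUnion_closedBall_nat, Measure.volume_eq_prod,
      ← Measure.prod_restrict, Measure.restrict_univ]
  rw [e, aestronglyMeasurable_iUnion_iff]
  exact fun n => (F.flux_integrable T n).aestronglyMeasurable

theorem integrable_apply_flux {ℓ : Rd d → (Rd d →L[ℝ] ℝ)} (hℓ : Continuous ℓ)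
    (hc : HasCompactSupport ℓ) (T : ℝ) :
    Integrable (fun p : ℝ × Rd d => ℓ p.2 (ρ p.1 p.2 • v p.1 p.2))
      ((volume.restrict (Ioc 0 T)).prod volume) := by
  obtain ⟨R, hR⟩ := hc.isCompact.isBounded.subset_closedBall (0 : Rd d)
  obtain ⟨C, hC⟩ := hℓ.bounded_above_of_compact_support hc
  have h1 : IntegrableOn (fun p : ℝ × Rd d => ℓ p.2 (ρ p.1 p.2 • v p.1 p.2))
      (Ioc 0 T ×ˢ Metric.closedBall 0 R) := by
    refine Integrable.mono' ((F.flux_integrable T R).norm.const_mul C) ?_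
      (Filter.Eventually.of_forall fun p => ?_)
    · exact (ContinuousLinearMap.id ℝ (Rd d →L[ℝ] ℝ)).aestronglyMeasurable_comp₂
        (hℓ.comp continuous_snd).aestronglyMeasurable (F.flux_integrable T R).aestronglyMeasurable
    · exact (ContinuousLinearMap.le_opNorm _ _).trans
        (mul_le_mul_of_nonneg_right (hC _) (norm_nonneg _))
  have h2 : IntegrableOn (fun p : ℝ × Rd d => ℓ p.2 (ρ p.1 p.2 • v p.1 p.2))
      (Ioc 0 T ×ˢ univ) := by
    refine h1.of_forall_sdiff_eq_zero (measurableSet_Ioc.prod .univ) fun p hp => ?_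
    have : ℓ p.2 = 0 := image_eq_zero_of_notMem_tsupport fun h => hp.2 ⟨hp.1.1, hR h⟩
    rw [this]; rfl
  rwa [IntegrableOn, Measure.volume_eq_prod, ← Measure.prod_restrict, Measure.restrict_univ] at h2

/-- The weak formulation with a test function that depends on space only. -/
theorem integral_mul_eq {ψ : Rd d → ℝ} (hψ : ContDiff ℝ ∞ ψ) (hc : HasCompactSupport ψ)
    {t : ℝ} (ht : 0 ≤ t) :
    ∫ x, ψ x * ρ t x = (∫ x, ψ x * ρ 0 x)
      - ∫ s in (0 : ℝ)..t, ∫ x, fderiv ℝ ψ x (ρ s x • v s x) := by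
  obtain ⟨C, hC⟩ := hψ.continuous.bounded_above_of_compact_support hc
  have hψ' : Continuous (fderiv ℝ ψ) := hψ.continuous_fderiv (by simp)
  refine eq_sub_integral_of_weak (m := fun t => ∫ x, ψ x * ρ t x)
    (q := fun s => ∫ x, fderiv ℝ ψ x (ρ s x • v s x))
    (F.weakly_continuous (BoundedContinuousFunction.ofNormedAddCommGroup ψ hψ.continuous C hC))
    (fun t (ht : 0 ≤ t) => ?_) (fun θ hθ hθc => ?_) ht
  · rw [intervalIntegrable_iff_integrableOn_Ioc_of_le ht]
    exact (F.integrable_apply_flux hψ' (hc.fderiv ℝ) t).integral_prod_left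
  · have hφ : ContDiff ℝ ∞ fun p : ℝ × Rd d => θ p.1 * ψ p.2 :=
      (hθ.comp contDiff_fst).mul (hψ.comp contDiff_snd)
    have hφc : HasCompactSupport fun p : ℝ × Rd d => θ p.1 * ψ p.2 := by
      refine HasCompactSupport.of_support_subset_isCompact
        (hθc.isCompact.prod hc.isCompact) fun p hp => ⟨?_, ?_⟩
      · exact subset_tsupport _ (left_ne_zero_of_mul hp)
      · exact subset_tsupport _ (right_ne_zero_of_mul hp)
    have hw := F.weak_form _ hφ hφc
    refine Eq.trans ?_ hw
    dsimp only
    congr 1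
    · refine setIntegral_congr_fun measurableSet_Ioi fun t ht => ?_
      have ht : 0 < t := ht
      have i1 : Integrable fun x => ψ x * ρ t x :=
        (hψ.continuous.mul (F.isDensity t ht.le).continuous).integrable_of_hasCompactSupport
          hc.mul_right
      have i2 : Integrable fun x => fderiv ℝ ψ x (ρ t x • v t x) :=
        (hψ'.clm_apply (F.continuous_flux ht)).integrable_of_hasCompactSupport
          ((hc.fderiv ℝ).mono fun x hx h => hx (by simp [h]))
      rw [← integral_const_mul, ← integral_const_mul, ← integral_sub (i1.const_mul _)
        (i2.const_mul _)]
      refine integral_congr_ae (Filter.Eventually.of_forall fun x => ?_)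
      have e1 : deriv (fun s => θ s * ψ x) t = deriv θ t * ψ x :=
        deriv_mul_const (hθ.differentiable (by simp) t) _
      have e2 : ⟪gradient (fun y => θ t * ψ y) x, v t x⟫_ℝ = θ t * fderiv ℝ ψ x (v t x) := by
        rw [gradient, InnerProductSpace.toDual_symm_apply,
          fderiv_const_mul (hψ.differentiable (by simp) x)]
        rfl
      simp only [e1, e2, map_smul, smul_eq_mul]
      ring
    · rw [← integral_const_mul]
      exact integral_congr_ae (Filter.Eventually.of_forall fun x => by simp only; ring)

variable {η : Rd d → ℝ} (hη : IsMollifier η)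

include hη

theorem intervalIntegrable_mollifiedDiv (x : Rd d) {t : ℝ} (ht : 0 ≤ t) :
    IntervalIntegrable (fun s => mollifiedDiv η (fun y => ρ s y • v s y) x) volume 0 t := by
  rw [intervalIntegrable_iff_integrableOn_Ioc_of_le ht]
  exact (F.integrable_apply_flux (hη.continuous_fderiv_sub x)
    (hη.hasCompactSupport_fderiv_sub x) t).integral_prod_left

/-- The mollified density at a fixed point is a primitive in time of the mollified divergence of the
flux. -/
theorem mollify_eq_add_integral (x : Rd d) {t : ℝ} (ht : 0 ≤ t) :
    mollify η (ρ t) x = mollify η (ρ 0) x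
      + ∫ s in (0 : ℝ)..t, mollifiedDiv η (fun y => ρ s y • v s y) x := by
  have h := F.integral_mul_eq (ψ := fun y => η (x - y))
    (hη.contDiff.comp (contDiff_const.sub contDiff_id))
    (hη.hasCompactSupport.comp_homeomorph (Homeomorph.subLeft x)) ht
  simp only [hη.fderiv_comp_sub_left x, neg_apply, integral_neg,
    intervalIntegral.integral_neg, sub_neg_eq_add] at h
  exact h

end IsEnergyFlow

end flow

/-! ### Entropy dissipation along the mollified flow -/

section flow

variable {d : ℕ}

/-- The test function `χ κ_m(log (r / π))` for a cutoff `χ`. -/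
def entropyTest (m : ℝ) (χ π r : Rd d → ℝ) (x : Rd d) : ℝ :=
  χ x * truncId m (Real.log (r x) - Real.log (π x))

/-- The localized truncated entropy of `r` relative to `π`. -/
def localEntropy (m : ℝ) (χ π r : Rd d → ℝ) : ℝ :=
  ∫ x, χ x * (truncEntropy m (r x / π x) * π x)

theorem contDiff_entropyTest {m : ℝ} {χ π r : Rd d → ℝ} (hχ : ContDiff ℝ 1 χ)
    (hπ : ContDiff ℝ 1 π) (hπ0 : ∀ x, 0 < π x) (hr : ContDiff ℝ 1 r) (hr0 : ∀ x, 0 < r x) :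
    ContDiff ℝ 1 (entropyTest m χ π r) :=
  hχ.mul (((contDiff_truncId m).of_le (by norm_num)).comp
    ((hr.log fun x => (hr0 x).ne').sub (hπ.log fun x => (hπ0 x).ne')))

theorem hasCompactSupport_entropyTest {m : ℝ} {χ π r : Rd d → ℝ} (hχ : HasCompactSupport χ) :
    HasCompactSupport (entropyTest m χ π r) := hχ.mul_right

theorem continuous_truncEntropy_div {m : ℝ} {π r : Rd d → ℝ} (hπ : Continuous π)
    (hπ0 : ∀ x, 0 < π x) (hr : Continuous r) (hr0 : ∀ x, 0 < r x) :
    Continuous fun x => truncEntropy m (r x / π x) * π x := by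
  refine Continuous.mul (continuous_iff_continuousAt.mpr fun x => ?_) hπ
  exact ContinuousAt.comp (f := fun x => r x / π x)
    (hasDerivAt_truncEntropy m (div_pos (hr0 x) (hπ0 x))).continuousAt
    (hr.div hπ fun x => (hπ0 x).ne').continuousAt

/-- Mollifications of a weakly continuous family of densities are jointly measurable; the family is
extended to negative times as a constant. -/
theorem stronglyMeasurable_mollify {ρ : ℝ → Rd d → ℝ} (hρ : ∀ t, 0 ≤ t → IsDensity (ρ t))
    (hc : ∀ f : Rd d →ᵇ ℝ, ContinuousOn (fun t => ∫ x, f x * ρ t x) (Ici 0))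
    {η : Rd d → ℝ} (hη : IsMollifier η) :
    StronglyMeasurable (fun p : ℝ × Rd d => mollify η (ρ (max p.1 0)) p.2) := by
  refine stronglyMeasurable_uncurry_of_continuous_of_stronglyMeasurable
    (u := fun s x => mollify η (ρ (max s 0)) x) (fun x => ?_) fun s => ?_
  · obtain ⟨C, hC⟩ := hη.continuous.bounded_above_of_compact_support hη.hasCompactSupport
    have h := hc (BoundedContinuousFunction.ofNormedAddCommGroup
      (fun y => η (x - y)) (hη.continuous.comp (continuous_const.sub continuous_id)) C
      fun y => hC _)
    exact h.comp_continuous (f := fun s : ℝ => max s 0) (by fun_prop)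
      fun s => mem_Ici.mpr (le_max_right _ _)
  · exact (hη.continuous_mollify (hρ _ (le_max_right s 0)).continuous).stronglyMeasurable

namespace IsEnergyFlow

variable {π : Rd d → ℝ} {ρ : ℝ → Rd d → ℝ} {v : ℝ → Rd d → Rd d} {b : ℝ → ℝ} {T : ℝ}
  (F : IsEnergyFlow π ρ v b T) {η : Rd d → ℝ} (hη : IsMollifier η)

include F hη

theorem aestronglyMeasurable_mollifiedDiv (t : ℝ) :
    AEStronglyMeasurable
      (fun p : ℝ × Rd d => mollifiedDiv η (fun y => ρ p.1 y • v p.1 y) p.2)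
      ((volume.restrict (Ioc 0 t)).prod volume) := by
  have hq : Measure.QuasiMeasurePreserving (fun q : (ℝ × Rd d) × Rd d => (q.1.1, q.2))
      (((volume.restrict (Ioc 0 t)).prod volume).prod volume)
      ((volume.restrict (Ioc 0 t)).prod volume) :=
    QuasiMeasurePreserving.prodMap Measure.quasiMeasurePreserving_fst
      (Measure.QuasiMeasurePreserving.id _)
  have h1 := (F.aestronglyMeasurable_flux t).comp_quasiMeasurePreserving hq
  have h2 : Continuous fun q : (ℝ × Rd d) × Rd d => fderiv ℝ η (q.1.2 - q.2) :=
    (hη.contDiff.continuous_fderiv (by simp)).comp (by fun_prop)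
  exact ((ContinuousLinearMap.id ℝ (Rd d →L[ℝ] ℝ)).aestronglyMeasurable_comp₂
    h2.aestronglyMeasurable h1).integral_prod_right'

theorem integrable_test_mul_mollifiedDiv {m : ℝ} (hm : 0 < m) {χ : Rd d → ℝ} (hχ : Continuous χ)
    (hχc : HasCompactSupport χ) (t : ℝ) :
    Integrable (fun p : ℝ × Rd d => entropyTest m χ π (mollify η (ρ p.1)) p.2
        * mollifiedDiv η (fun y => ρ p.1 y • v p.1 y) p.2)
      ((volume.restrict (Ioc 0 t)).prod volume) := by
  obtain ⟨R, hR⟩ := hχc.isCompact.isBounded.subset_closedBall (0 : Rd d)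
  have hη' : Continuous (fderiv ℝ η) := hη.contDiff.continuous_fderiv (by simp)
  obtain ⟨C, hC⟩ := hη'.bounded_above_of_compact_support (hη.hasCompactSupport.fderiv ℝ)
  have hC0 : 0 ≤ C := (norm_nonneg _).trans (hC 0)
  set N : ℝ → ℝ := fun s => ∫ y in Metric.closedBall 0 (R + 1), ‖ρ s y • v s y‖ with hN
  have hNi : Integrable N (volume.restrict (Ioc 0 t)) := by
    have h := (F.flux_integrable t (R + 1)).norm
    rw [Measure.volume_eq_prod, ← Measure.prod_restrict] at h
    exact h.integral_prod_left
  have hres : ∀ᵐ p ∂((volume.restrict (Ioc 0 t)).prod (volume : Measure (Rd d))),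
      p.1 ∈ Ioc 0 t := Measure.quasiMeasurePreserving_fst.ae (ae_restrict_mem measurableSet_Ioc)
  refine Integrable.mono' ((hNi.const_mul C).mul_prod
    ((hχ.norm.integrable_of_hasCompactSupport hχc.norm).mul_const (2 * m))) ?_ ?_
  · refine AEStronglyMeasurable.mul ?_ (F.aestronglyMeasurable_mollifiedDiv hη t)
    have h1 : Measurable fun p : ℝ × Rd d => χ p.2 * truncId m
        (Real.log (mollify η (ρ (max p.1 0)) p.2) - Real.log (π p.2)) := by
      refine (hχ.measurable.comp measurable_snd).mul ((continuous_truncId m).measurable.comp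
        (((stronglyMeasurable_mollify F.isDensity F.weakly_continuous hη).measurable.log).sub
          ((F.target.continuous.measurable.comp measurable_snd).log)))
    refine h1.aestronglyMeasurable.congr ?_
    filter_upwards [hres] with p hp
    rw [entropyTest, max_eq_left hp.1.le]
  · filter_upwards [hres] with p hp
    by_cases hχp : χ p.2 = 0
    · simp [entropyTest, hχp]
    have hpR : p.2 ∈ Metric.closedBall (0 : Rd d) R := hR (subset_tsupport _ hχp)
    have hg : ‖mollifiedDiv η (fun y => ρ p.1 y • v p.1 y) p.2‖ ≤ C * N p.1 := by
      have hf := F.continuous_flux hp.1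
      rw [hN, mollifiedDiv]
      dsimp only
      rw [← integral_const_mul, ← setIntegral_eq_integral_of_forall_compl_eq_zero
        (s := Metric.closedBall (0 : Rd d) (R + 1))]
      · refine norm_integral_le_of_norm_le
          ((hf.norm.continuousOn.integrableOn_compact (isCompact_closedBall _ _)).const_mul C)
          (Filter.Eventually.of_forall fun y => ?_)
        exact (ContinuousLinearMap.le_opNorm _ _).trans
          (mul_le_mul_of_nonneg_right (hC _) (norm_nonneg _))
      · intro y hy
        have h0 : fderiv ℝ η (p.2 - y) = 0 := by
          by_contra h
          have h1 : ‖p.2 - y‖ ≤ 1 := hη.norm_le_one_of_fderiv_ne_zero h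
          refine hy ?_
          rw [mem_closedBall_zero_iff] at hpR ⊢
          have := norm_sub_norm_le y p.2
          rw [norm_sub_rev] at this
          linarith
        rw [h0]; rfl
    rw [norm_mul, entropyTest, norm_mul]
    have h2 : ‖truncId m (Real.log (mollify η (ρ p.1) p.2) - Real.log (π p.2))‖ ≤ 2 * m :=
      abs_truncId_le hm _
    calc _ ≤ (‖χ p.2‖ * (2 * m)) * (C * N p.1) := by gcongr
      _ = C * N p.1 * (‖χ p.2‖ * (2 * m)) := by ring

/-- The dissipation of the localized truncated entropy along the mollified flow. -/
theorem localEntropy_mollify_sub {m : ℝ} (hm : 0 < m) {χ : Rd d → ℝ} (hχ : ContDiff ℝ 1 χ)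
    (hχc : HasCompactSupport χ) {t : ℝ} (ht : 0 ≤ t) :
    localEntropy m χ π (mollify η (ρ t)) - localEntropy m χ π (mollify η (ρ 0))
      = - ∫ s in (0 : ℝ)..t, ∫ x, fderiv ℝ (entropyTest m χ π (mollify η (ρ s))) x
          (mollify η (fun y => ρ s y • v s y) x) := by
  have hpos : ∀ s, 0 ≤ s → ∀ x, 0 < mollify η (ρ s) x := fun s hs x =>
    hη.mollify_pos (F.isDensity s hs).continuous (F.isDensity s hs).pos x
  have hcont : ∀ s, 0 ≤ s → Continuous (mollify η (ρ s)) := fun s hs =>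
    hη.continuous_mollify (F.isDensity s hs).continuous
  have hπ := F.target
  have hint : ∀ s, 0 ≤ s → Integrable fun x => χ x *
      (truncEntropy m (mollify η (ρ s) x / π x) * π x) := fun s hs =>
    (hχ.continuous.mul (continuous_truncEntropy_div hπ.continuous hπ.pos (hcont s hs)
      (hpos s hs))).integrable_of_hasCompactSupport hχc.mul_right
  have hA := F.integrable_test_mul_mollifiedDiv hη hm hχ.continuous hχc t
  -- the chain rule in time at a fixed point of space
  have hx : ∀ x, χ x * (truncEntropy m (mollify η (ρ t) x / π x) * π x)
      - χ x * (truncEntropy m (mollify η (ρ 0) x / π x) * π x)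
      = ∫ s in Ioc 0 t, entropyTest m χ π (mollify η (ρ s)) x
        * mollifiedDiv η (fun y => ρ s y • v s y) x := fun x => by
    have hπx := hπ.pos x
    have h := comp_primitive_sub_eq_integral (u := fun s => mollify η (ρ s) x)
      (g := fun s => mollifiedDiv η (fun y => ρ s y • v s y) x)
      (Ψ := fun q => truncEntropy m (q / π x) * π x)
      (ψ := fun q => truncId m (Real.log (q / π x))) ht
      (F.intervalIntegrable_mollifiedDiv hη x ht)
      (fun s hs => F.mollify_eq_add_integral hη x hs.1) (fun s hs => hpos s hs.1 x)
      (fun q hq => by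
        have h1 := (hasDerivAt_truncEntropy m (div_pos hq hπx)).comp q
          ((hasDerivAt_id q).div_const (π x))
        refine (h1.mul_const (π x)).congr_deriv ?_
        field_simp)
      (K := 2 * m) (fun q _ => abs_truncId_le hm _)
    rw [← mul_sub, h, intervalIntegral.integral_of_le ht, ← integral_const_mul]
    refine setIntegral_congr_fun measurableSet_Ioc fun s hs => ?_
    simp only [entropyTest]
    rw [Real.log_div (hpos s hs.1.le x).ne' hπx.ne', mul_assoc]
  rw [localEntropy, localEntropy, ← integral_sub (hint t ht) (hint 0 le_rfl)]
  simp_rw [hx]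
  rw [← integral_integral_swap hA, intervalIntegral.integral_of_le ht, ← integral_neg]
  refine setIntegral_congr_fun measurableSet_Ioc fun s hs => ?_
  have hs0 : 0 < s := hs.1
  have hρ := F.isDensity s hs0.le
  exact hη.integral_mul_integral_fderiv
    (contDiff_entropyTest hχ (hπ.contDiff.of_le (by norm_num)) hπ.pos
      (hη.contDiff_mollify (hρ.contDiff.of_le (by norm_num))) (hpos s hs0.le))
    (hasCompactSupport_entropyTest hχc) (F.continuous_flux hs0)

theorem aestronglyMeasurable_integral_fderiv_entropyTest {m : ℝ} (hm : 0 < m) {χ : Rd d → ℝ}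
    (hχ : ContDiff ℝ 1 χ) (hχc : HasCompactSupport χ) (t : ℝ) :
    AEStronglyMeasurable (fun s => ∫ x, fderiv ℝ (entropyTest m χ π (mollify η (ρ s))) x
      (mollify η (fun y => ρ s y • v s y) x)) (volume.restrict (Ioc 0 t)) := by
  have hA := F.integrable_test_mul_mollifiedDiv hη hm hχ.continuous hχc t
  refine hA.integral_prod_left.neg.aestronglyMeasurable.congr ?_
  filter_upwards [ae_restrict_mem measurableSet_Ioc] with s hs
  have hs0 : 0 < s := hs.1
  have hρ := F.isDensity s hs0.le
  have hπ := F.target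
  have h := hη.integral_mul_integral_fderiv
    (contDiff_entropyTest (m := m) hχ (hπ.contDiff.of_le (by norm_num)) hπ.pos
      (hη.contDiff_mollify (hρ.contDiff.of_le (by norm_num)))
      (hη.mollify_pos hρ.continuous hρ.pos))
    (hasCompactSupport_entropyTest hχc) (F.continuous_flux hs0)
  rw [Pi.neg_apply, neg_eq_iff_eq_neg]
  exact h

end IsEnergyFlow

end flow

/-! ### Removing the mollification -/

section limit

variable {d : ℕ}

theorem IsMollifier.mollify_add_const_mul {η : Rd d → ℝ} (hη : IsMollifier η) {g h : Rd d → ℝ}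
    (hg : Continuous g) (hh : Continuous h) (A : ℝ) (x : Rd d) :
    mollify η (fun y => g y + A * h y) x = mollify η g x + A * mollify η h x := by
  rw [mollify_eq_integral_sub, mollify_eq_integral_sub, mollify_eq_integral_sub,
    ← integral_const_mul, ← integral_add (hη.integrable_smul hg x)
      ((hη.integrable_smul hh x).const_mul A)]
  refine integral_congr_ae (Filter.Eventually.of_forall fun y => ?_)
  simp only [smul_eq_mul]
  ring

theorem fderiv_entropyTest {m : ℝ} (hm : 0 < m) {χ π r : Rd d → ℝ} (hχ : ContDiff ℝ 1 χ)
    (hπ : ContDiff ℝ 1 π) (hπ0 : ∀ x, 0 < π x) (hr : ContDiff ℝ 1 r) (hr0 : ∀ x, 0 < r x)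
    (x e : Rd d) :
    fderiv ℝ (entropyTest m χ π r) x e
      = truncId m (Real.log (r x) - Real.log (π x)) * fderiv ℝ χ x e
        + χ x * (truncIdDeriv m (Real.log (r x) - Real.log (π x))
          * (fderiv ℝ r x e / r x - fderiv ℝ π x e / π x)) := by
  have h1 := (hχ.differentiable one_ne_zero x).hasFDerivAt
  have h2 := ((hr.differentiable one_ne_zero x).hasFDerivAt.log (hr0 x).ne').sub
    ((hπ.differentiable one_ne_zero x).hasFDerivAt.log (hπ0 x).ne')
  have h3 := (hasDerivAt_truncId hm (Real.log (r x) - Real.log (π x))).comp_hasFDerivAt x h2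
  have h4 := h1.mul h3
  have e1 : fderiv ℝ (entropyTest m χ π r) x = _ := h4.fderiv
  rw [e1]
  simp only [add_apply, smul_apply, sub_apply, smul_eq_mul, Function.comp_apply, Pi.sub_apply]
  ring

/-- The data controlling the localized dissipation: a cutoff supported in the ball of radius `R`,
with bounds for its derivative and for the logarithmic derivative of `π`. -/
structure IsCutoff (π χ : Rd d → ℝ) (R A : ℝ) : Prop where
  contDiff : ContDiff ℝ 1 χ
  tsupport_subset : tsupport χ ⊆ Metric.closedBall 0 R
  abs_le_one : ∀ x, |χ x| ≤ 1
  norm_fderiv_le : ∀ x, ‖fderiv ℝ χ x‖ ≤ A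
  norm_log_fderiv_le : ∀ x ∈ Metric.closedBall 0 (R + 1), ‖fderiv ℝ π x‖ / π x ≤ A

namespace IsCutoff

variable {π χ : Rd d → ℝ} {R A : ℝ} (hχ : IsCutoff π χ R A)

include hχ

theorem hasCompactSupport : HasCompactSupport χ :=
  HasCompactSupport.of_support_subset_isCompact (isCompact_closedBall (0 : Rd d) R)
    ((subset_tsupport χ).trans hχ.tsupport_subset)

theorem nonneg : 0 ≤ A := (norm_nonneg _).trans (hχ.norm_fderiv_le 0)

theorem fderiv_entropyTest_eq_zero {m : ℝ} {r : Rd d → ℝ} {x : Rd d}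
    (hx : x ∉ Metric.closedBall 0 R) : fderiv ℝ (entropyTest m χ π r) x = 0 := by
  by_contra h
  have h1 := support_fderiv_subset ℝ h
  have h2 : tsupport (entropyTest m χ π r) ⊆ tsupport χ :=
    closure_mono fun y hy => left_ne_zero_of_mul hy
  exact hx (hχ.tsupport_subset (h2 h1))

/-- The localized dissipation density of the mollified flow is bounded by the mollification of
`‖D r‖ + C r`, uniformly in the mollifier. -/
theorem abs_fderiv_entropyTest_mollify_le {m : ℝ} (hm : 0 < m) (hπ : ContDiff ℝ 1 π)
    (hπ0 : ∀ x, 0 < π x) {r : Rd d → ℝ} (hr : ContDiff ℝ 1 r) (hr0 : ∀ x, 0 < r x)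
    {v : Rd d → Rd d} {V : ℝ}
    (hV : ∀ x ∈ Metric.closedBall 0 (R + 1), ‖v x‖ ≤ V) {η : Rd d → ℝ} (hη : IsMollifier η)
    {x : Rd d} (hx : x ∈ Metric.closedBall 0 R) :
    |fderiv ℝ (entropyTest m χ π (mollify η r)) x (mollify η (fun y => r y • v y) x)|
      ≤ V * mollify η (fun y => ‖fderiv ℝ r y‖ + (2 * m * A + A) * r y) x := by
  have hr' : Continuous (fderiv ℝ r) := hr.continuous_fderiv one_ne_zero
  have hball : ∀ y ∈ Metric.closedBall x 1, y ∈ Metric.closedBall (0 : Rd d) (R + 1) :=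
    fun y hy => Metric.closedBall_subset_closedBall'
      (by linarith [Metric.mem_closedBall.mp hx]) hy
  set q := mollify η r x with hq
  set p := mollify η (fun y => ‖fderiv ℝ r y‖) x with hp
  set J := mollify η (fun y => r y • v y) x with hJ
  have hq0 : 0 < q := hη.mollify_pos hr.continuous hr0 x
  have hJle : ‖J‖ ≤ V * q := by
    have h1 := hη.norm_mollify_le_mollify (g := fun y => r y • v y) (a := fun y => 0 + V * r y)
      (x := x) (by have := hr.continuous; fun_prop) fun y hy => by
        rw [norm_smul, Real.norm_of_nonneg (hr0 y).le, zero_add, mul_comm]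
        exact mul_le_mul_of_nonneg_right (hV y (hball y hy)) (hr0 y).le
    rwa [hη.mollify_add_const_mul continuous_const hr.continuous, hη.mollify_const, zero_add] at h1
  have hDr : ‖fderiv ℝ (mollify η r) x‖ ≤ p := by
    rw [(hη.hasFDerivAt_mollify hr x).fderiv]
    exact hη.norm_mollify_le_mollify hr'.norm fun y _ => le_rfl
  have hVq : 0 ≤ V * q := (norm_nonneg _).trans hJle
  have hA := hχ.nonneg
  rw [fderiv_entropyTest hm hχ.contDiff hπ hπ0 (hη.contDiff_mollify hr)
    (hη.mollify_pos hr.continuous hr0), hη.mollify_add_const_mul hr'.norm hr.continuous, ← hp, ← hq]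
  set L := Real.log q - Real.log (π x)
  have b1 : |truncId m L * fderiv ℝ χ x J| ≤ 2 * m * (A * (V * q)) := by
    rw [abs_mul]
    refine mul_le_mul (abs_truncId_le hm L) ?_ (abs_nonneg _) (by positivity)
    exact (ContinuousLinearMap.le_opNorm _ _).trans
      (mul_le_mul (hχ.norm_fderiv_le x) hJle (norm_nonneg _) hA)
  have b2 : |fderiv ℝ (mollify η r) x J / q| ≤ V * p := by
    rw [abs_div, abs_of_pos hq0, div_le_iff₀ hq0]
    calc |fderiv ℝ (mollify η r) x J| ≤ p * (V * q) :=
          (ContinuousLinearMap.le_opNorm _ _).trans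
            (mul_le_mul hDr hJle (norm_nonneg _) ((norm_nonneg _).trans hDr))
      _ = V * p * q := by ring
  have b3 : |fderiv ℝ π x J / π x| ≤ A * (V * q) := by
    rw [abs_div, abs_of_pos (hπ0 x)]
    calc |fderiv ℝ π x J| / π x ≤ ‖fderiv ℝ π x‖ * ‖J‖ / π x :=
          div_le_div_of_nonneg_right ((fderiv ℝ π x).le_opNorm J) (hπ0 x).le
      _ = ‖fderiv ℝ π x‖ / π x * ‖J‖ := by ring
      _ ≤ A * (V * q) := mul_le_mul (hχ.norm_log_fderiv_le x
          (hball x (Metric.mem_closedBall_self zero_le_one))) hJle (norm_nonneg _) hA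
  have b4 : |χ x * (truncIdDeriv m L * (fderiv ℝ (mollify η r) x J / q - fderiv ℝ π x J / π x))|
      ≤ V * p + A * (V * q) := by
    rw [abs_mul, abs_mul, abs_of_nonneg (truncIdDeriv_nonneg m L)]
    have h1 : |fderiv ℝ (mollify η r) x J / q - fderiv ℝ π x J / π x| ≤ V * p + A * (V * q) :=
      (abs_sub _ _).trans (add_le_add b2 b3)
    calc _ ≤ 1 * (1 * |fderiv ℝ (mollify η r) x J / q - fderiv ℝ π x J / π x|) := by
          gcongr
          · exact mul_nonneg (truncIdDeriv_nonneg m L) (abs_nonneg _)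
          · exact hχ.abs_le_one x
          · exact truncIdDeriv_le_one m L
      _ ≤ _ := by simpa using h1
  calc _ ≤ 2 * m * (A * (V * q)) + (V * p + A * (V * q)) :=
        (abs_add_le _ _).trans (add_le_add b1 b4)
    _ = V * (p + (2 * m * A + A) * q) := by ring

theorem continuous_fderiv_entropyTest {m : ℝ} (hπ : ContDiff ℝ 1 π)
    (hπ0 : ∀ x, 0 < π x) {r : Rd d → ℝ} (hr : ContDiff ℝ 1 r) (hr0 : ∀ x, 0 < r x)
    {f : Rd d → Rd d} (hf : Continuous f) :
    Continuous fun x => fderiv ℝ (entropyTest m χ π r) x (f x) :=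
  ((contDiff_entropyTest hχ.contDiff hπ hπ0 hr hr0).continuous_fderiv one_ne_zero).clm_apply hf

theorem abs_integral_fderiv_entropyTest_mollify_le {m : ℝ} (hm : 0 < m) (hπ : ContDiff ℝ 1 π)
    (hπ0 : ∀ x, 0 < π x) {r : Rd d → ℝ} (hr : ContDiff ℝ 1 r) (hr0 : ∀ x, 0 < r x)
    {v : Rd d → Rd d} {V : ℝ} (hV0 : 0 ≤ V)
    (hV : ∀ x ∈ Metric.closedBall 0 (R + 1), ‖v x‖ ≤ V) {η : Rd d → ℝ} (hη : IsMollifier η) :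
    |∫ x, fderiv ℝ (entropyTest m χ π (mollify η r)) x (mollify η (fun y => r y • v y) x)|
      ≤ V * ∫ y in Metric.closedBall 0 (R + 1),
        (‖fderiv ℝ r y‖ + (2 * m * A + A) * r y) := by
  have hA := hχ.nonneg
  have ha : Continuous fun y => ‖fderiv ℝ r y‖ + (2 * m * A + A) * r y :=
    (hr.continuous_fderiv one_ne_zero).norm.add (continuous_const.mul hr.continuous)
  rw [← setIntegral_eq_integral_of_forall_compl_eq_zero (s := Metric.closedBall (0 : Rd d) R)
    fun x hx => by rw [hχ.fderiv_entropyTest_eq_zero hx]; rfl]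
  have hi : IntegrableOn (fun x => V * mollify η (fun y => ‖fderiv ℝ r y‖
      + (2 * m * A + A) * r y) x) (Metric.closedBall 0 R) :=
    ((hη.continuous_mollify ha).continuousOn.integrableOn_compact
      (isCompact_closedBall _ _)).const_mul V
  rw [← Real.norm_eq_abs]
  refine le_trans (norm_integral_le_of_norm_le hi ?_) ?_
  · filter_upwards [ae_restrict_mem measurableSet_closedBall] with x hx
    exact hχ.abs_fderiv_entropyTest_mollify_le hm hπ hπ0 hr hr0 hV hη hx
  · rw [integral_const_mul]
    exact mul_le_mul_of_nonneg_left (hη.setIntegral_mollify_le ha (fun y => by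
      have := (hr0 y).le; positivity) R) hV0

theorem tendsto_integral_fderiv_entropyTest {m : ℝ} (hm : 0 < m) (hπ : ContDiff ℝ 1 π)
    (hπ0 : ∀ x, 0 < π x) {r : Rd d → ℝ} (hr : ContDiff ℝ 1 r) (hr0 : ∀ x, 0 < r x)
    {v : Rd d → Rd d} (hv : Continuous v) :
    Filter.Tendsto (fun n => ∫ x, fderiv ℝ (entropyTest m χ π (mollify (stdMollifier d n) r)) x
        (mollify (stdMollifier d n) (fun y => r y • v y) x)) Filter.atTop
      (nhds (∫ x, fderiv ℝ (entropyTest m χ π r) x (r x • v x))) := by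
  have hA := hχ.nonneg
  have hr' : Continuous (fderiv ℝ r) := hr.continuous_fderiv one_ne_zero
  have hf : Continuous fun y => r y • v y := hr.continuous.smul hv
  have ha : Continuous fun y => ‖fderiv ℝ r y‖ + (2 * m * A + A) * r y :=
    hr'.norm.add (continuous_const.mul hr.continuous)
  obtain ⟨V, hV⟩ := (isCompact_closedBall (0 : Rd d) (R + 1)).exists_bound_of_continuousOn
    hv.continuousOn
  obtain ⟨M, hM⟩ := (isCompact_closedBall (0 : Rd d) (R + 1)).exists_bound_of_continuousOn
    ha.continuousOn
  refine tendsto_integral_of_dominated_convergence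
    ((Metric.closedBall (0 : Rd d) R).indicator fun _ => |V| * M) (fun n => ?_) ?_ (fun n => ?_) ?_
  · have hη := isMollifier_stdMollifier d n
    exact (hχ.continuous_fderiv_entropyTest hπ hπ0 (hη.contDiff_mollify hr)
      (hη.mollify_pos hr.continuous hr0) (hη.continuous_mollify hf)).aestronglyMeasurable
  · rw [integrable_indicator_iff measurableSet_closedBall]
    exact continuous_const.continuousOn.integrableOn_compact (isCompact_closedBall _ _)
  · have hη := isMollifier_stdMollifier d n
    refine Filter.Eventually.of_forall fun x => ?_
    by_cases hx : x ∈ Metric.closedBall (0 : Rd d) R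
    · rw [indicator_of_mem hx]
      refine (hχ.abs_fderiv_entropyTest_mollify_le hm hπ hπ0 hr hr0
        (fun y hy => (hV y hy).trans (le_abs_self V)) hη hx).trans
        (mul_le_mul_of_nonneg_left ?_ (abs_nonneg V))
      refine (le_abs_self _).trans (hη.norm_mollify_le_of_forall fun y hy => hM y ?_)
      exact Metric.closedBall_subset_closedBall' (by linarith [Metric.mem_closedBall.mp hx]) hy
    · rw [indicator_of_notMem hx, hχ.fderiv_entropyTest_eq_zero hx]
      simp
  · refine Filter.Eventually.of_forall fun x => ?_
    have t1 := tendsto_mollify_stdMollifier hr.continuous x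
    have t2 := tendsto_mollify_stdMollifier hr' x
    have t3 := tendsto_mollify_stdMollifier hf x
    have t4 := (t1.log (hr0 x).ne').sub_const (Real.log (π x))
    rw [fderiv_entropyTest hm hχ.contDiff hπ hπ0 hr hr0]
    have e : ∀ n, fderiv ℝ (entropyTest m χ π (mollify (stdMollifier d n) r)) x
        (mollify (stdMollifier d n) (fun y => r y • v y) x) = _ := fun n => by
      have hη := isMollifier_stdMollifier d n
      rw [fderiv_entropyTest hm hχ.contDiff hπ hπ0 (hη.contDiff_mollify hr)
        (hη.mollify_pos hr.continuous hr0), (hη.hasFDerivAt_mollify hr x).fderiv]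
    simp_rw [e]
    refine Filter.Tendsto.add ?_ (Filter.Tendsto.const_mul _ ?_)
    · exact (((continuous_truncId m).tendsto _).comp t4).mul
        (((fderiv ℝ χ x).continuous.tendsto _).comp t3)
    · exact (((continuous_truncIdDeriv m).tendsto _).comp t4).mul
        (((((isBoundedBilinearMap_apply (𝕜 := ℝ) (E := Rd d) (F := ℝ)).continuous.tendsto
          (fderiv ℝ r x, r x • v x)).comp (t2.prodMk_nhds t3)).div t1 (hr0 x).ne').sub
          ((((fderiv ℝ π x).continuous.tendsto _).comp t3).div_const _))

theorem tendsto_localEntropy_mollify {m : ℝ} (hm : 0 < m) (hπ : Continuous π)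
    (hπ0 : ∀ x, 0 < π x) {r : Rd d → ℝ} (hr : Continuous r) (hr0 : ∀ x, 0 < r x) :
    Filter.Tendsto (fun n => localEntropy m χ π (mollify (stdMollifier d n) r)) Filter.atTop
      (nhds (localEntropy m χ π r)) := by
  obtain ⟨M, hM⟩ := (isCompact_closedBall (0 : Rd d) (R + 1)).exists_bound_of_continuousOn
    hr.continuousOn
  refine tendsto_integral_of_dominated_convergence
    ((Metric.closedBall (0 : Rd d) R).indicator fun x => 2 * m * (M + π x)) (fun n => ?_) ?_
    (fun n => ?_) ?_
  · have hη := isMollifier_stdMollifier d n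
    exact (hχ.contDiff.continuous.mul (continuous_truncEntropy_div hπ hπ0 (hη.continuous_mollify hr)
      (hη.mollify_pos hr hr0))).aestronglyMeasurable
  · rw [integrable_indicator_iff measurableSet_closedBall]
    exact Continuous.continuousOn (by fun_prop) |>.integrableOn_compact (isCompact_closedBall _ _)
  · have hη := isMollifier_stdMollifier d n
    refine Filter.Eventually.of_forall fun x => ?_
    by_cases hx : x ∈ Metric.closedBall (0 : Rd d) R
    · rw [indicator_of_mem hx, norm_mul, norm_mul]
      have hq0 := hη.mollify_pos hr hr0 x
      have hq : mollify (stdMollifier d n) r x ≤ M := (le_abs_self _).trans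
        (hη.norm_mollify_le_of_forall fun y hy => hM y
          (Metric.closedBall_subset_closedBall' (by linarith [Metric.mem_closedBall.mp hx]) hy))
      set q := mollify (stdMollifier d n) r x
      have hπx := hπ0 x
      have h1 : ‖truncEntropy m (q / π x)‖ * ‖π x‖ ≤ 2 * m * (M + π x) := by
        rw [Real.norm_of_nonneg hπx.le]
        calc ‖truncEntropy m (q / π x)‖ * π x ≤ 2 * m * |q / π x - 1| * π x :=
              mul_le_mul_of_nonneg_right (abs_truncEntropy_le hm) hπx.le
          _ ≤ 2 * m * (q / π x + 1) * π x := by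
              gcongr
              have : 0 ≤ q / π x := by positivity
              rw [abs_le]; constructor <;> linarith
          _ = 2 * m * (q + π x) := by field_simp
          _ ≤ 2 * m * (M + π x) := by gcongr
      calc _ ≤ 1 * (‖truncEntropy m (q / π x)‖ * ‖π x‖) := by
            gcongr
            exact hχ.abs_le_one x
        _ ≤ _ := by simpa using h1
    · have : χ x = 0 := image_eq_zero_of_notMem_tsupport fun h => hx (hχ.tsupport_subset h)
      rw [indicator_of_notMem hx, this]
      simp
  · refine Filter.Eventually.of_forall fun x => ?_
    have t1 := (tendsto_mollify_stdMollifier hr x).div_const (π x)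
    have h1 := (hasDerivAt_truncEntropy m (div_pos (hr0 x) (hπ0 x))).continuousAt
    exact ((h1.tendsto.comp t1).mul_const _).const_mul _

end IsCutoff

end limit

/-! ### Local entropy dissipation along the flow -/

section density

variable {d : ℕ} {r π : Rd d → ℝ}

theorem integral_dens (hr : Continuous r) (hr0 : ∀ x, 0 < r x) (g : Rd d → ℝ) :
    ∫ x, g x ∂(dens r) = ∫ x, r x * g x := by
  rw [dens, integral_withDensity_eq_integral_toReal_smul (by fun_prop) (by simp)]
  refine integral_congr_ae (Filter.Eventually.of_forall fun x => ?_)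
  simp [ENNReal.toReal_ofReal (hr0 x).le]

theorem integrable_dens_iff (hr : Continuous r) (hr0 : ∀ x, 0 < r x) {g : Rd d → ℝ} :
    Integrable g (dens r) ↔ Integrable fun x => r x * g x := by
  rw [dens, integrable_withDensity_iff_integrable_smul' (by fun_prop) (by simp)]
  refine integrable_congr (Filter.Eventually.of_forall fun x => ?_)
  simp [ENNReal.toReal_ofReal (hr0 x).le]

theorem IsDensity.isProbabilityMeasure (h : IsDensity r) : IsProbabilityMeasure (dens r) := by
  refine ⟨?_⟩
  rw [dens, withDensity_apply _ MeasurableSet.univ, Measure.restrict_univ,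
    ← ofReal_integral_eq_lintegral_ofReal h.integrable
      (Filter.Eventually.of_forall fun x => (h.pos x).le), h.integral_eq_one, ENNReal.ofReal_one]

theorem IsDensity.contDiff_one (h : IsDensity r) : ContDiff ℝ 1 r := h.contDiff.of_le (by norm_num)

theorem inner_score (hr : IsDensity r) (hπ : IsDensity π) (x e : Rd d) :
    ⟪score r π x, e⟫_ℝ = fderiv ℝ r x e / r x - fderiv ℝ π x e / π x := by
  have h1 := ((hr.contDiff_one.differentiable one_ne_zero x).hasFDerivAt.log (hr.pos x).ne').sub
    ((hπ.contDiff_one.differentiable one_ne_zero x).hasFDerivAt.log (hπ.pos x).ne')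
  have e1 : (fun y => Real.log (r y / π y))
      = (fun x => Real.log (r x)) - fun x => Real.log (π x) :=
    funext fun y => Real.log_div (hr.pos y).ne' (hπ.pos y).ne'
  rw [score, gradient, InnerProductSpace.toDual_symm_apply, e1, h1.fderiv]
  simp only [sub_apply, smul_apply, smul_eq_mul]
  ring

theorem norm_fderiv_le_mul_score (hr : IsDensity r) (hπ : IsDensity π) (x : Rd d) :
    ‖fderiv ℝ r x‖ ≤ r x * (‖score r π x‖ + ‖fderiv ℝ π x‖ / π x) := by
  have hrx := hr.pos x
  have hπx := hπ.pos x
  refine ContinuousLinearMap.opNorm_le_bound _ (by positivity) fun e => ?_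
  have e1 : fderiv ℝ r x e = r x * (⟪score r π x, e⟫_ℝ + fderiv ℝ π x e / π x) := by
    rw [inner_score hr hπ]; field_simp; ring
  rw [e1, norm_mul, Real.norm_of_nonneg hrx.le, mul_assoc]
  refine mul_le_mul_of_nonneg_left ((norm_add_le _ _).trans ?_) hrx.le
  rw [add_mul]
  refine add_le_add (norm_inner_le_norm _ _) ?_
  rw [norm_div, Real.norm_of_nonneg hπx.le, div_mul_eq_mul_div]
  exact div_le_div_of_nonneg_right (ContinuousLinearMap.le_opNorm _ _) hπx.le

end density

namespace IsEnergyFlow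

variable {d : ℕ} {π : Rd d → ℝ} {ρ : ℝ → Rd d → ℝ} {v : ℝ → Rd d → Rd d} {b : ℝ → ℝ} {T : ℝ}
  (F : IsEnergyFlow π ρ v b T)

include F

theorem integrable_score_sq {s : ℝ} (hs : s ∈ Ioc 0 T) :
    Integrable (fun x => ρ s x * ‖score (ρ s) π x‖ ^ 2) :=
  have hρ := F.isDensity s hs.1.le
  (integrable_dens_iff hρ.continuous hρ.pos).mp
    ((F.score_memLp s hs).integrable_norm_pow two_ne_zero)

theorem integrable_velocity_sq {s : ℝ} (hs : s ∈ Ioc 0 T) :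
    Integrable (fun x => ρ s x * ‖v s x‖ ^ 2) :=
  have hρ := F.isDensity s hs.1.le
  (integrable_dens_iff hρ.continuous hρ.pos).mp
    ((F.velocity_memLp s hs).integrable_norm_pow two_ne_zero)

theorem integral_score_sq_le {s : ℝ} (hs : s ∈ Ioc 0 T) :
    ∫ x, ρ s x * ‖score (ρ s) π x‖ ^ 2 ≤ b s ^ 2 := by
  have hρ := F.isDensity s hs.1.le
  rw [← integral_dens hρ.continuous hρ.pos]
  exact F.score_le s hs

/-- The local variation of the densities is controlled by the energy. -/
theorem mul_setIntegral_norm_fderiv_le {s : ℝ} (hs : s ∈ Ioc 0 T) {R A B : ℝ} (hA : 0 ≤ A)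
    (hB : 0 ≤ B) (hπA : ∀ x ∈ Metric.closedBall 0 R, ‖fderiv ℝ π x‖ / π x ≤ A) :
    b s * ∫ y in Metric.closedBall 0 R, (‖fderiv ℝ (ρ s) y‖ + B * ρ s y)
      ≤ b s ^ 2 + (A + B) * (1 + b s ^ 2) := by
  have hρ := F.isDensity s hs.1.le
  have hb := F.bound_nonneg s
  have i1 := F.integrable_score_sq hs
  have i2 := hρ.integrable
  have i3 : Integrable fun y => 1 / 2 * (ρ s y * ‖score (ρ s) π y‖ ^ 2)
      + (b s ^ 2 / 2 + b s * (A + B)) * ρ s y := (i1.const_mul _).add (i2.const_mul _)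
  have hpos : ∀ y, 0 ≤ 1 / 2 * (ρ s y * ‖score (ρ s) π y‖ ^ 2)
      + (b s ^ 2 / 2 + b s * (A + B)) * ρ s y := fun y => by
    have := (hρ.pos y).le
    positivity
  have hcont : Continuous fun y => b s * (‖fderiv ℝ (ρ s) y‖ + B * ρ s y) :=
    continuous_const.mul ((hρ.contDiff_one.continuous_fderiv one_ne_zero).norm.add
      (continuous_const.mul hρ.continuous))
  rw [← integral_const_mul]
  calc ∫ y in Metric.closedBall 0 R, b s * (‖fderiv ℝ (ρ s) y‖ + B * ρ s y)
      ≤ ∫ y in Metric.closedBall 0 R, (1 / 2 * (ρ s y * ‖score (ρ s) π y‖ ^ 2)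
          + (b s ^ 2 / 2 + b s * (A + B)) * ρ s y) := by
        refine setIntegral_mono_on
          (hcont.continuousOn.integrableOn_compact (isCompact_closedBall _ _)) i3.integrableOn
          measurableSet_closedBall fun y hy => ?_
        have h1 := norm_fderiv_le_mul_score hρ F.target y
        have h2 := hπA y hy
        have hρy := (hρ.pos y).le
        have h3 : ‖fderiv ℝ (ρ s) y‖ ≤ ρ s y * (‖score (ρ s) π y‖ + A) :=
          h1.trans (mul_le_mul_of_nonneg_left (by linarith) hρy)
        have h4 : b s * ‖score (ρ s) π y‖ ≤ (b s ^ 2 + ‖score (ρ s) π y‖ ^ 2) / 2 := by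
          nlinarith [sq_nonneg (b s - ‖score (ρ s) π y‖)]
        calc b s * (‖fderiv ℝ (ρ s) y‖ + B * ρ s y)
            ≤ b s * (ρ s y * (‖score (ρ s) π y‖ + A) + B * ρ s y) := by gcongr
          _ = ρ s y * (b s * ‖score (ρ s) π y‖) + b s * (A + B) * ρ s y := by ring
          _ ≤ ρ s y * ((b s ^ 2 + ‖score (ρ s) π y‖ ^ 2) / 2) + b s * (A + B) * ρ s y := by
              gcongr
          _ = _ := by ring
    _ ≤ ∫ y, (1 / 2 * (ρ s y * ‖score (ρ s) π y‖ ^ 2)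
          + (b s ^ 2 / 2 + b s * (A + B)) * ρ s y) :=
        setIntegral_le_integral i3 (Filter.Eventually.of_forall hpos)
    _ = 1 / 2 * (∫ y, ρ s y * ‖score (ρ s) π y‖ ^ 2) + (b s ^ 2 / 2 + b s * (A + B)) := by
        rw [integral_add (i1.const_mul _) (i2.const_mul _), integral_const_mul,
          integral_const_mul, hρ.integral_eq_one, mul_one]
    _ ≤ b s ^ 2 + (A + B) * (1 + b s ^ 2) := by
        have h5 := F.integral_score_sq_le hs
        have h6 : b s * (A + B) ≤ (A + B) * (1 + b s ^ 2) := by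
          nlinarith [add_nonneg hA hB, sq_nonneg (b s - 1), sq_nonneg (b s)]
        linarith

variable {m : ℝ} {χ : Rd d → ℝ} {R A : ℝ}

/-- The dissipation of the localized truncated entropy along the flow. -/
theorem localEntropy_sub_eq (hm : 0 < m) (hχ : IsCutoff π χ R A) {t : ℝ} (ht : t ∈ Icc 0 T) :
    AEStronglyMeasurable (fun s => ∫ x, fderiv ℝ (entropyTest m χ π (ρ s)) x (ρ s x • v s x))
      (volume.restrict (Ioc 0 t)) ∧
    localEntropy m χ π (ρ t) - localEntropy m χ π (ρ 0)
      = - ∫ s in (0 : ℝ)..t, ∫ x, fderiv ℝ (entropyTest m χ π (ρ s)) x (ρ s x • v s x) := by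
  have hπ := F.target
  have hA := hχ.nonneg
  obtain ⟨C, hC0, hC⟩ := F.speed_le (R + 1)
  have hlim : ∀ s ∈ Ioc 0 t, Filter.Tendsto (fun n => ∫ x,
      fderiv ℝ (entropyTest m χ π (mollify (stdMollifier d n) (ρ s))) x
        (mollify (stdMollifier d n) (fun y => ρ s y • v s y) x)) Filter.atTop
      (nhds (∫ x, fderiv ℝ (entropyTest m χ π (ρ s)) x (ρ s x • v s x))) := fun s hs =>
    have hρ := F.isDensity s hs.1.le
    hχ.tendsto_integral_fderiv_entropyTest hm hπ.contDiff_one hπ.pos hρ.contDiff_one hρ.pos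
      (F.continuous_velocity s hs.1)
  have hmeas := fun n => F.aestronglyMeasurable_integral_fderiv_entropyTest
    (isMollifier_stdMollifier d n) hm hχ.contDiff hχ.hasCompactSupport t
  have hlim' : ∀ᵐ s ∂(volume.restrict (Ioc 0 t)), Filter.Tendsto (fun n => ∫ x,
      fderiv ℝ (entropyTest m χ π (mollify (stdMollifier d n) (ρ s))) x
        (mollify (stdMollifier d n) (fun y => ρ s y • v s y) x)) Filter.atTop
      (nhds (∫ x, fderiv ℝ (entropyTest m χ π (ρ s)) x (ρ s x • v s x))) := by
    filter_upwards [ae_restrict_mem measurableSet_Ioc] with s hs using hlim s hs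
  refine ⟨aestronglyMeasurable_of_tendsto_ae _ hmeas hlim', ?_⟩
  have hb2 : IntegrableOn (fun s => b s ^ 2) (Ioc 0 t) :=
    F.bound_integrable.mono_set (Ioc_subset_Ioc_right ht.2)
  have hone : IntegrableOn (fun _ : ℝ => (1 : ℝ)) (Ioc 0 t) := integrableOn_const (by simp)
  have hR : Filter.Tendsto (fun n => - ∫ s in Ioc 0 t, ∫ x,
      fderiv ℝ (entropyTest m χ π (mollify (stdMollifier d n) (ρ s))) x
        (mollify (stdMollifier d n) (fun y => ρ s y • v s y) x)) Filter.atTop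
      (nhds (- ∫ s in Ioc 0 t, ∫ x, fderiv ℝ (entropyTest m χ π (ρ s)) x (ρ s x • v s x))) := by
    refine (tendsto_integral_of_dominated_convergence
      (fun s => C * (b s ^ 2 + (A + (2 * m * A + A)) * (1 + b s ^ 2))) hmeas
      ((hb2.add ((hone.add hb2).const_mul _)).const_mul C) (fun n => ?_) hlim').neg
    filter_upwards [ae_restrict_mem measurableSet_Ioc] with s hs
    have hsT : s ∈ Ioc 0 T := ⟨hs.1, hs.2.trans ht.2⟩
    have hρ := F.isDensity s hs.1.le
    refine (hχ.abs_integral_fderiv_entropyTest_mollify_le hm hπ.contDiff_one hπ.pos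
      hρ.contDiff_one hρ.pos (mul_nonneg hC0 (F.bound_nonneg s)) (hC s hsT)
      (isMollifier_stdMollifier d n)).trans ?_
    rw [mul_assoc]
    exact mul_le_mul_of_nonneg_left (F.mul_setIntegral_norm_fderiv_le hsT hA (by positivity)
      hχ.norm_log_fderiv_le) hC0
  have hL : ∀ s, 0 ≤ s → Filter.Tendsto (fun n => localEntropy m χ π
      (mollify (stdMollifier d n) (ρ s))) Filter.atTop (nhds (localEntropy m χ π (ρ s))) :=
    fun s hs => hχ.tendsto_localEntropy_mollify hm hπ.continuous hπ.pos
      (F.isDensity s hs).continuous (F.isDensity s hs).pos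
  rw [intervalIntegral.integral_of_le ht.1]
  refine tendsto_nhds_unique ((hL t ht.1).sub (hL 0 le_rfl)) (hR.congr fun n => ?_)
  rw [F.localEntropy_mollify_sub (isMollifier_stdMollifier d n) hm hχ.contDiff
    hχ.hasCompactSupport ht.1, intervalIntegral.integral_of_le ht.1]

end IsEnergyFlow

/-! ### The entropy dissipation identity -/

/-- Cutoffs at radius of order `(n + 1)²`, with gradients of order `(n + 1)⁻²`: multiplied by the
truncation height `n + 1`, these gradients still tend to `0`. -/
theorem exists_cutoff_seq (d : ℕ) : ∃ (C : ℝ) (χ : ℕ → Rd d → ℝ), 0 ≤ C ∧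
    (∀ n, ContDiff ℝ 1 (χ n)) ∧
    (∀ n, tsupport (χ n) ⊆ Metric.closedBall 0 (2 * ((n : ℝ) + 1) ^ 2)) ∧
    (∀ n x, |χ n x| ≤ 1) ∧ (∀ n x, ‖fderiv ℝ (χ n) x‖ ≤ C / ((n : ℝ) + 1) ^ 2) ∧
    ∀ x, Filter.Tendsto (fun n => χ n x) Filter.atTop (nhds 1) := by
  let f : ContDiffBump (0 : Rd d) := ⟨1, 2, one_pos, one_lt_two⟩
  have hf : ContDiff ℝ 1 f := f.contDiff
  obtain ⟨C, hC⟩ := (hf.continuous_fderiv one_ne_zero).bounded_above_of_compact_support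
    (f.hasCompactSupport.fderiv ℝ)
  have hN : ∀ n : ℕ, (0 : ℝ) < ((n : ℝ) + 1) ^ 2 := fun n => by positivity
  refine ⟨C, fun n x => f ((((n : ℝ) + 1) ^ 2)⁻¹ • x), (norm_nonneg _).trans (hC 0), fun n => ?_,
    fun n => ?_, fun n x => ?_, fun n x => ?_, fun x => ?_⟩
  · exact hf.comp (contDiff_const_smul _)
  · refine closure_minimal (fun x hx => ?_) Metric.isClosed_closedBall
    have h1 : (((n : ℝ) + 1) ^ 2)⁻¹ • x ∈ Metric.ball (0 : Rd d) 2 := by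
      have : (((n : ℝ) + 1) ^ 2)⁻¹ • x ∈ Function.support f := hx
      rwa [f.support_eq] at this
    rw [mem_ball_zero_iff, norm_smul, norm_inv, Real.norm_of_nonneg (hN n).le,
      inv_mul_lt_iff₀ (hN n)] at h1
    rw [mem_closedBall_zero_iff]
    linarith
  · rw [abs_of_nonneg f.nonneg]
    exact f.le_one
  · have h1 : fderiv ℝ (fun x => f ((((n : ℝ) + 1) ^ 2)⁻¹ • x)) x
        = (((n : ℝ) + 1) ^ 2)⁻¹ • fderiv ℝ f ((((n : ℝ) + 1) ^ 2)⁻¹ • x) := by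
      rw [fderiv_comp_smul]
    rw [h1, norm_smul, norm_inv, Real.norm_of_nonneg (hN n).le, inv_mul_eq_div]
    exact div_le_div_of_nonneg_right (hC _) (hN n).le
  · have h1 : Filter.Tendsto (fun n : ℕ => (((n : ℝ) + 1) ^ 2)⁻¹ • x) Filter.atTop (nhds 0) := by
      have h2 : Filter.Tendsto (fun n : ℕ => (((n : ℝ) + 1) ^ 2)⁻¹) Filter.atTop (nhds 0) := by
        have h3 := (tendsto_one_div_add_atTop_nhds_zero_nat (𝕜 := ℝ)).pow 2
        simpa using h3
      simpa using h2.smul_const x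
    have h2 := (f.continuous.tendsto 0).comp h1
    rwa [f.one_of_mem_closedBall (Metric.mem_closedBall_self zero_le_one)] at h2

/-- A dominating function for the localized dissipation. Here `κ` is a truncation at height `N` with
derivative `κ'`, `ℓ` is the derivative of a cutoff along the velocity, of norm `V`, and `inn` is the
inner product of the velocity with the score, of norm `S`. -/
theorem abs_dissipation_le {C N χx ℓ κ κ' inn S V : ℝ} (hC : 0 ≤ C) (hN : 1 ≤ N)
    (hχ : |χx| ≤ 1) (hℓ : |ℓ| ≤ C / N ^ 2 * V) (hκ : |κ| ≤ 2 * N) (h0 : 0 ≤ κ') (h1 : κ' ≤ 1)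
    (hV : 0 ≤ V) (hinn : |inn| ≤ S * V) :
    |κ * ℓ + χx * (κ' * inn)| ≤ 2 * C * (1 + V ^ 2) + (S ^ 2 + V ^ 2) := by
  have hN0 : 0 < N := by linarith
  have e1 : |κ * ℓ| ≤ 2 * C * (1 + V ^ 2) := by
    rw [abs_mul]
    calc |κ| * |ℓ| ≤ 2 * N * (C / N ^ 2 * V) := by gcongr
      _ = 2 * C * V / N := by field_simp
      _ ≤ 2 * C * V := div_le_self (by positivity) hN
      _ ≤ 2 * C * (1 + V ^ 2) := by
        gcongr
        nlinarith [sq_nonneg (V - 1)]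
  have e2 : |χx * (κ' * inn)| ≤ S ^ 2 + V ^ 2 := by
    rw [abs_mul, abs_mul, abs_of_nonneg h0]
    calc |χx| * (κ' * |inn|) ≤ 1 * (1 * |inn|) := by gcongr
      _ ≤ S * V := by linarith
      _ ≤ S ^ 2 + V ^ 2 := by nlinarith [sq_nonneg (S - V), sq_nonneg (S + V)]
  exact (abs_add_le _ _).trans (add_le_add e1 e2)

namespace IsEnergyFlow

variable {d : ℕ} {π : Rd d → ℝ} {ρ : ℝ → Rd d → ℝ} {v : ℝ → Rd d → Rd d} {b : ℝ → ℝ} {T : ℝ}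
  (F : IsEnergyFlow π ρ v b T)

include F

theorem exists_isCutoff {χ : Rd d → ℝ} {R C : ℝ} (h1 : ContDiff ℝ 1 χ)
    (h2 : tsupport χ ⊆ Metric.closedBall 0 R) (h3 : ∀ x, |χ x| ≤ 1)
    (h4 : ∀ x, ‖fderiv ℝ χ x‖ ≤ C) : ∃ A, IsCutoff π χ R A := by
  have hc : Continuous fun x => ‖fderiv ℝ π x‖ / π x :=
    (F.target.contDiff_one.continuous_fderiv one_ne_zero).norm.div F.target.continuous
      fun x => (F.target.pos x).ne'
  obtain ⟨A, hA⟩ := (isCompact_closedBall (0 : Rd d) (R + 1)).exists_bound_of_continuousOn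
    hc.continuousOn
  exact ⟨max A C, h1, h2, h3, fun x => (h4 x).trans (le_max_right _ _),
    fun x hx => ((le_abs_self _).trans (hA x hx)).trans (le_max_left _ _)⟩

/-- The density of the localized dissipation, in terms of the score. -/
theorem fderiv_entropyTest_flux {m : ℝ} (hm : 0 < m) {χ : Rd d → ℝ} (hχ : ContDiff ℝ 1 χ) {s : ℝ}
    (hs : 0 ≤ s) (x : Rd d) :
    fderiv ℝ (entropyTest m χ π (ρ s)) x (ρ s x • v s x)
      = ρ s x * (truncId m (Real.log (ρ s x) - Real.log (π x)) * fderiv ℝ χ x (v s x)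
        + χ x * (truncIdDeriv m (Real.log (ρ s x) - Real.log (π x))
          * ⟪score (ρ s) π x, v s x⟫_ℝ)) := by
  have hρ := F.isDensity s hs
  have hπ := F.target
  rw [fderiv_entropyTest hm hχ hπ.contDiff_one hπ.pos hρ.contDiff_one hρ.pos, inner_score hρ hπ]
  simp only [map_smul, smul_eq_mul]
  ring

/-- The entropy dissipation identity, for finite entropies: along the flow the relative entropy is
absolutely continuous, and its rate of decrease is `∫ ⟪∇ log (ρ / π), v⟫ ρ`. -/
theorem entropy_sub_eq {t : ℝ} (ht : t ∈ Icc 0 T)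
    (h0 : Integrable fun x => InformationTheory.klFun (ρ 0 x / π x) * π x)
    (h1 : Integrable fun x => InformationTheory.klFun (ρ t x / π x) * π x) :
    IntervalIntegrable (fun s => ∫ x, ρ s x * ⟪score (ρ s) π x, v s x⟫_ℝ) volume 0 t ∧
    (∫ x, InformationTheory.klFun (ρ t x / π x) * π x)
      - ∫ x, InformationTheory.klFun (ρ 0 x / π x) * π x
      = - ∫ s in (0 : ℝ)..t, ∫ x, ρ s x * ⟪score (ρ s) π x, v s x⟫_ℝ := by
  have hπ := F.target
  obtain ⟨C, χ, hC0, c1, c2, c3, c4, c5⟩ := exists_cutoff_seq d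
  obtain ⟨V, hV0, hV⟩ := F.velocity_le
  have hNpos : ∀ n : ℕ, (0 : ℝ) < (n : ℝ) + 1 := fun n => by positivity
  have hN1 : ∀ n : ℕ, (1 : ℝ) ≤ (n : ℝ) + 1 := fun n => by linarith [n.cast_nonneg (α := ℝ)]
  have hNlim : Filter.Tendsto (fun n : ℕ => (n : ℝ) + 1) Filter.atTop Filter.atTop :=
    Filter.tendsto_atTop_add_const_right _ _ tendsto_natCast_atTop_atTop
  choose A hA using fun n => F.exists_isCutoff (c1 n) (c2 n) (c3 n) (c4 n)
  have hid := fun n => F.localEntropy_sub_eq (hNpos n) (hA n) ht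
  set D : ℝ → ℝ := fun s => ∫ x, ρ s x * ⟪score (ρ s) π x, v s x⟫_ℝ with hD
  set G : ℕ → ℝ → ℝ := fun n s => ∫ x,
    fderiv ℝ (entropyTest ((n : ℝ) + 1) (χ n) π (ρ s)) x (ρ s x • v s x) with hG
  -- the entropies
  have hent : ∀ s, 0 ≤ s → Integrable (fun x => InformationTheory.klFun (ρ s x / π x) * π x) →
      Filter.Tendsto (fun n : ℕ => localEntropy ((n : ℝ) + 1) (χ n) π (ρ s)) Filter.atTop
        (nhds (∫ x, InformationTheory.klFun (ρ s x / π x) * π x)) := fun s hs hi => by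
    have hρ := F.isDensity s hs
    refine tendsto_integral_of_dominated_convergence _ (fun n => ?_) hi (fun n => ?_) ?_
    · exact ((c1 n).continuous.mul (continuous_truncEntropy_div hπ.continuous hπ.pos
        hρ.continuous hρ.pos)).aestronglyMeasurable
    · refine Filter.Eventually.of_forall fun x => ?_
      have hπx := hπ.pos x
      have hq := div_pos (hρ.pos x) hπx
      rw [norm_mul, norm_mul, Real.norm_of_nonneg hπx.le,
        Real.norm_of_nonneg (truncEntropy_nonneg (hNpos n) hq)]
      have h2 := mul_le_mul_of_nonneg_right (truncEntropy_le_klFun (hNpos n) hq) hπx.le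
      have h3 := mul_nonneg (truncEntropy_nonneg (hNpos n) hq) hπx.le
      calc _ ≤ 1 * (truncEntropy ((n : ℝ) + 1) (ρ s x / π x) * π x) :=
            mul_le_mul_of_nonneg_right (c3 n x) h3
        _ ≤ _ := by rwa [one_mul]
    · refine Filter.Eventually.of_forall fun x => ?_
      have h2 := (tendsto_truncEntropy (div_pos (hρ.pos x) (hπ.pos x))).comp hNlim
      simpa using (c5 x).mul (h2.mul_const (π x))
  -- the dominating functions in space
  have hdom : ∀ n : ℕ, ∀ s ∈ Ioc 0 t, ∀ x,
      |fderiv ℝ (entropyTest ((n : ℝ) + 1) (χ n) π (ρ s)) x (ρ s x • v s x)|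
        ≤ ρ s x * (2 * C * (1 + ‖v s x‖ ^ 2) + (‖score (ρ s) π x‖ ^ 2 + ‖v s x‖ ^ 2)) := by
    intro n s hs x
    have hρx := ((F.isDensity s hs.1.le).pos x).le
    rw [F.fderiv_entropyTest_flux (hNpos n) (c1 n) hs.1.le, abs_mul, abs_of_nonneg hρx]
    refine mul_le_mul_of_nonneg_left (abs_dissipation_le hC0 (hN1 n) (c3 n x) ?_
      (abs_truncId_le (hNpos n) _) (truncIdDeriv_nonneg _ _) (truncIdDeriv_le_one _ _)
      (norm_nonneg _) (abs_real_inner_le_norm _ _)) hρx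
    exact (ContinuousLinearMap.le_opNorm _ _).trans
      (mul_le_mul_of_nonneg_right (c4 n x) (norm_nonneg _))
  have hdomi : ∀ s ∈ Ioc 0 t, Integrable fun x =>
      ρ s x * (2 * C * (1 + ‖v s x‖ ^ 2) + (‖score (ρ s) π x‖ ^ 2 + ‖v s x‖ ^ 2)) := by
    intro s hs
    have hsT : s ∈ Ioc 0 T := ⟨hs.1, hs.2.trans ht.2⟩
    have := (((F.isDensity s hs.1.le).integrable.add (F.integrable_velocity_sq hsT)).const_mul
      (2 * C)).add ((F.integrable_score_sq hsT).add (F.integrable_velocity_sq hsT))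
    refine this.congr (Filter.Eventually.of_forall fun x => ?_)
    simp only [Pi.add_apply]
    ring
  have hdomle : ∀ s ∈ Ioc 0 t, ∫ x,
      ρ s x * (2 * C * (1 + ‖v s x‖ ^ 2) + (‖score (ρ s) π x‖ ^ 2 + ‖v s x‖ ^ 2))
      ≤ 2 * C * (1 + (V * b s) ^ 2) + (b s ^ 2 + (V * b s) ^ 2) := by
    intro s hs
    have hsT : s ∈ Ioc 0 T := ⟨hs.1, hs.2.trans ht.2⟩
    have hρ := F.isDensity s hs.1.le
    have i1 := hρ.integrable
    have i2 := F.integrable_velocity_sq hsT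
    have i3 := F.integrable_score_sq hsT
    have e : ∫ x, ρ s x * (2 * C * (1 + ‖v s x‖ ^ 2) + (‖score (ρ s) π x‖ ^ 2 + ‖v s x‖ ^ 2))
        = 2 * C * ((∫ x, ρ s x) + ∫ x, ρ s x * ‖v s x‖ ^ 2)
          + ((∫ x, ρ s x * ‖score (ρ s) π x‖ ^ 2) + ∫ x, ρ s x * ‖v s x‖ ^ 2) := by
      have i4 : Integrable fun x => 2 * C * (ρ s x + ρ s x * ‖v s x‖ ^ 2) :=
        (i1.add i2).const_mul _
      have i5 : Integrable fun x => ρ s x * ‖score (ρ s) π x‖ ^ 2 + ρ s x * ‖v s x‖ ^ 2 :=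
        i3.add i2
      rw [← integral_add i1 i2, ← integral_add i3 i2, ← integral_const_mul, ← integral_add i4 i5]
      refine integral_congr_ae (Filter.Eventually.of_forall fun x => ?_)
      simp only
      ring
    have h2 := hV s hsT
    rw [integral_dens hρ.continuous hρ.pos] at h2
    have h3 := F.integral_score_sq_le hsT
    rw [e, hρ.integral_eq_one]
    gcongr
  -- the dissipation at a fixed time
  have hGlim : ∀ s ∈ Ioc 0 t, Filter.Tendsto (fun n => G n s) Filter.atTop (nhds (D s)) := by
    intro s hs
    have hρ := F.isDensity s hs.1.le
    refine tendsto_integral_of_dominated_convergence _ (fun n => ?_) (hdomi s hs)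
      (fun n => Filter.Eventually.of_forall (hdom n s hs)) (Filter.Eventually.of_forall fun x => ?_)
    · exact ((hA n).continuous_fderiv_entropyTest hπ.contDiff_one hπ.pos hρ.contDiff_one hρ.pos
        (F.continuous_flux hs.1)).aestronglyMeasurable
    · simp_rw [fun n : ℕ => F.fderiv_entropyTest_flux (hNpos n) (c1 n) hs.1.le x]
      refine Filter.Tendsto.const_mul _ ?_
      set L := Real.log (ρ s x) - Real.log (π x)
      have t1 := (tendsto_truncId L).comp hNlim
      have t2 := (tendsto_truncIdDeriv L).comp hNlim
      have t3 : Filter.Tendsto (fun n => fderiv ℝ (χ n) x (v s x)) Filter.atTop (nhds 0) := by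
        have h2 : Filter.Tendsto (fun n : ℕ => C / ((n : ℝ) + 1) ^ 2 * ‖v s x‖) Filter.atTop
            (nhds 0) := by
          have h3 : Filter.Tendsto (fun n : ℕ => C / ((n : ℝ) + 1) ^ 2) Filter.atTop (nhds 0) :=
            ((Filter.tendsto_pow_atTop two_ne_zero).comp hNlim).const_div_atTop C
          simpa using h3.mul_const ‖v s x‖
        exact squeeze_zero_norm (fun n => (ContinuousLinearMap.le_opNorm _ _).trans
          (mul_le_mul_of_nonneg_right (c4 n x) (norm_nonneg _))) h2
      simpa using (t1.mul t3).add ((c5 x).mul (t2.mul_const ⟪score (ρ s) π x, v s x⟫_ℝ))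
  have hGbound : ∀ n : ℕ, ∀ s ∈ Ioc 0 t, |G n s|
      ≤ 2 * C * (1 + (V * b s) ^ 2) + (b s ^ 2 + (V * b s) ^ 2) := fun n s hs => by
    rw [← Real.norm_eq_abs]
    exact (norm_integral_le_of_norm_le (hdomi s hs)
      (Filter.Eventually.of_forall (hdom n s hs))).trans (hdomle s hs)
  have hb2 : IntegrableOn (fun s => b s ^ 2) (Ioc 0 t) :=
    F.bound_integrable.mono_set (Ioc_subset_Ioc_right ht.2)
  have hone : IntegrableOn (fun _ : ℝ => (1 : ℝ)) (Ioc 0 t) := integrableOn_const (by simp)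
  have hbi : IntegrableOn (fun s => 2 * C * (1 + (V * b s) ^ 2) + (b s ^ 2 + (V * b s) ^ 2))
      (Ioc 0 t) := by
    have := ((hone.add (hb2.const_mul (V ^ 2))).const_mul (2 * C)).add
      (hb2.add (hb2.const_mul (V ^ 2)))
    refine this.congr (Filter.Eventually.of_forall fun s => ?_)
    simp only [Pi.add_apply]
    ring
  have hlim' : ∀ᵐ s ∂(volume.restrict (Ioc 0 t)), Filter.Tendsto (fun n => G n s) Filter.atTop
      (nhds (D s)) := by
    filter_upwards [ae_restrict_mem measurableSet_Ioc] with s hs using hGlim s hs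
  have hDm : AEStronglyMeasurable D (volume.restrict (Ioc 0 t)) :=
    aestronglyMeasurable_of_tendsto_ae _ (fun n => (hid n).1) hlim'
  have hDi : IntegrableOn D (Ioc 0 t) := by
    refine Integrable.mono' hbi hDm ?_
    filter_upwards [ae_restrict_mem measurableSet_Ioc] with s hs
    exact le_of_tendsto (hGlim s hs).norm (Filter.Eventually.of_forall fun n => hGbound n s hs)
  refine ⟨(intervalIntegrable_iff_integrableOn_Ioc_of_le ht.1).mpr hDi, ?_⟩
  have hR : Filter.Tendsto (fun n => - ∫ s in Ioc 0 t, G n s) Filter.atTop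
      (nhds (- ∫ s in Ioc 0 t, D s)) := by
    refine (tendsto_integral_of_dominated_convergence _ (fun n => (hid n).1) hbi (fun n => ?_)
      hlim').neg
    filter_upwards [ae_restrict_mem measurableSet_Ioc] with s hs using hGbound n s hs
  rw [intervalIntegral.integral_of_le ht.1]
  refine tendsto_nhds_unique ((hent t ht.1 h1).sub (hent 0 le_rfl h0)) (hR.congr fun n => ?_)
  rw [(hid n).2, intervalIntegral.integral_of_le ht.1]

end IsEnergyFlow

/-! ### Relative entropy and measurability of the Fisher information -/

section KL

variable {d : ℕ} {r π : Rd d → ℝ}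

theorem KL_eq_lintegral (hr : IsDensity r) (hπ : IsDensity π) :
    KL r π = ∫⁻ x, ENNReal.ofReal (InformationTheory.klFun (r x / π x) * π x) := by
  have hc : Continuous fun x => r x / π x :=
    hr.continuous.div hπ.continuous fun x => (hπ.pos x).ne'
  have e : dens r = (dens π).withDensity fun x => ENNReal.ofReal (r x / π x) := by
    rw [dens, dens, ← withDensity_mul _ (by have := hπ.continuous; fun_prop)
      (hc.measurable.ennreal_ofReal)]
    congr 1
    funext x
    rw [Pi.mul_apply, ← ENNReal.ofReal_mul (hπ.pos x).le, mul_div_cancel₀ _ (hπ.pos x).ne']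
  have := hr.isProbabilityMeasure
  have := hπ.isProbabilityMeasure
  have hac : dens r ≪ dens π := by
    rw [e]
    exact withDensity_absolutelyContinuous _ _
  have hrn : (dens r).rnDeriv (dens π) =ᵐ[dens π] fun x => ENNReal.ofReal (r x / π x) := by
    rw [e]
    exact Measure.rnDeriv_withDensity _ hc.measurable.ennreal_ofReal
  rw [KL, InformationTheory.klDiv_eq_lintegral_klFun_of_ac hac]
  have h1 : ∫⁻ x, ENNReal.ofReal (InformationTheory.klFun
      ((dens r).rnDeriv (dens π) x).toReal) ∂(dens π)
      = ∫⁻ x, ENNReal.ofReal (InformationTheory.klFun (r x / π x)) ∂(dens π) := by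
    refine lintegral_congr_ae ?_
    filter_upwards [hrn] with x hx
    rw [hx, ENNReal.toReal_ofReal (div_pos (hr.pos x) (hπ.pos x)).le]
  have h2 : Measurable fun x => ENNReal.ofReal (InformationTheory.klFun (r x / π x)) :=
    (InformationTheory.continuous_klFun.comp hc).measurable.ennreal_ofReal
  rw [h1, dens, lintegral_withDensity_eq_lintegral_mul _
    (by have := hπ.continuous; fun_prop) h2]
  refine lintegral_congr fun x => ?_
  rw [Pi.mul_apply, ← ENNReal.ofReal_mul (hπ.pos x).le, mul_comm]

theorem klFun_div_mul_nonneg (hr : IsDensity r) (hπ : IsDensity π) (x : Rd d) :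
    0 ≤ InformationTheory.klFun (r x / π x) * π x :=
  mul_nonneg (InformationTheory.klFun_nonneg (div_pos (hr.pos x) (hπ.pos x)).le) (hπ.pos x).le

theorem integrable_klFun_of_KL_lt_top (hr : IsDensity r) (hπ : IsDensity π) (h : KL r π < ⊤) :
    Integrable fun x => InformationTheory.klFun (r x / π x) * π x := by
  have hc : Continuous fun x => InformationTheory.klFun (r x / π x) * π x :=
    (InformationTheory.continuous_klFun.comp
      (hr.continuous.div hπ.continuous fun x => (hπ.pos x).ne')).mul hπ.continuous
  refine ⟨hc.aestronglyMeasurable, ?_⟩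
  rw [hasFiniteIntegral_iff_ofReal (Filter.Eventually.of_forall (klFun_div_mul_nonneg hr hπ)),
    ← KL_eq_lintegral hr hπ]
  exact h

theorem KL_eq_ofReal_integral (hr : IsDensity r) (hπ : IsDensity π) (h : KL r π < ⊤) :
    KL r π = ENNReal.ofReal (∫ x, InformationTheory.klFun (r x / π x) * π x) := by
  rw [KL_eq_lintegral hr hπ, ofReal_integral_eq_lintegral_ofReal
    (integrable_klFun_of_KL_lt_top hr hπ h)
    (Filter.Eventually.of_forall (klFun_div_mul_nonneg hr hπ))]

end KL

section measurability

variable {d : ℕ} {π : Rd d → ℝ} {ρ : ℝ → Rd d → ℝ}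

/-- Joint measurability in time and space follows from weak continuity, because the density is the
limit of its mollifications. -/
theorem measurable_density (hρ : ∀ t, 0 ≤ t → IsDensity (ρ t))
    (hc : ∀ f : Rd d →ᵇ ℝ, ContinuousOn (fun t => ∫ x, f x * ρ t x) (Ici 0)) :
    Measurable fun p : ℝ × Rd d => ρ (max p.1 0) p.2 :=
  measurable_of_tendsto_metrizable
    (fun n => (stronglyMeasurable_mollify hρ hc (isMollifier_stdMollifier d n)).measurable)
    (tendsto_pi_nhds.mpr fun p =>
      tendsto_mollify_stdMollifier (hρ _ (le_max_right p.1 0)).continuous p.2)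

theorem measurable_inner_score (hπ : IsDensity π) (hρ : ∀ t, 0 ≤ t → IsDensity (ρ t))
    (hc : ∀ f : Rd d →ᵇ ℝ, ContinuousOn (fun t => ∫ x, f x * ρ t x) (Ici 0)) (e : Rd d) :
    Measurable fun p : ℝ × Rd d => ⟪score (ρ (max p.1 0)) π p.2, e⟫_ℝ := by
  have hm := measurable_density hρ hc
  have hL : Measurable fun p : ℝ × Rd d => Real.log (ρ (max p.1 0) p.2 / π p.2) :=
    (hm.div (hπ.continuous.measurable.comp measurable_snd)).log
  -- the derivative is a limit of difference quotients
  refine measurable_of_tendsto_metrizable (f := fun (n : ℕ) (p : ℝ × Rd d) =>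
    (n : ℝ) • (Real.log (ρ (max p.1 0) (p.2 + (n : ℝ)⁻¹ • e) / π (p.2 + (n : ℝ)⁻¹ • e))
      - Real.log (ρ (max p.1 0) p.2 / π p.2))) (fun n => ?_) (tendsto_pi_nhds.mpr fun p => ?_)
  · have hshift : Measurable fun p : ℝ × Rd d => (p.1, p.2 + (n : ℝ)⁻¹ • e) := by fun_prop
    exact ((hL.comp hshift).sub hL).const_smul (n : ℝ)
  · have hρp := hρ _ (le_max_right p.1 0)
    have hd : DifferentiableAt ℝ (fun y => Real.log (ρ (max p.1 0) y / π y)) p.2 :=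
      ((hρp.contDiff_one.div hπ.contDiff_one fun x => (hπ.pos x).ne').log
        fun x => (div_pos (hρp.pos x) (hπ.pos x)).ne').differentiable one_ne_zero p.2
    have h1 := (hd.hasFDerivAt.lim_real e).comp tendsto_natCast_atTop_atTop
    rw [score, gradient, InnerProductSpace.toDual_symm_apply]
    exact h1

theorem measurable_integral_score_sq (hπ : IsDensity π) (hρ : ∀ t, 0 ≤ t → IsDensity (ρ t))
    (hc : ∀ f : Rd d →ᵇ ℝ, ContinuousOn (fun t => ∫ x, f x * ρ t x) (Ici 0)) :
    Measurable fun t : ℝ => ∫ x, ρ (max t 0) x * ‖score (ρ (max t 0)) π x‖ ^ 2 := by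
  have h1 : Measurable fun p : ℝ × Rd d =>
      ρ (max p.1 0) p.2 * ‖score (ρ (max p.1 0)) π p.2‖ ^ 2 := by
    refine (measurable_density hρ hc).mul ?_
    have e : (fun p : ℝ × Rd d => ‖score (ρ (max p.1 0)) π p.2‖ ^ 2) = fun p => ∑ i,
        ⟪score (ρ (max p.1 0)) π p.2, EuclideanSpace.single i (1 : ℝ)⟫_ℝ ^ 2 := by
      funext p
      rw [EuclideanSpace.real_norm_sq_eq]
      simp [EuclideanSpace.inner_single_right]
    rw [e]
    exact Finset.measurable_sum _ fun i _ => (measurable_inner_score hπ hρ hc _).pow_const 2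
  exact h1.stronglyMeasurable.integral_prod_right.measurable

end measurability

/-! ### The velocity of the regularized flow at a fixed time -/

section velocity

variable {d : ℕ} {H : Type*} [NormedAddCommGroup H] [InnerProductSpace ℝ H] [CompleteSpace H]
  [RKHS ℝ H (Rd d) ℝ] {ν : ℝ} {ρ π : Rd d → ℝ}

theorem direction_eq (hν : ν ∈ Ioo (0 : ℝ) 1) (ρ π : Rd d → ℝ) :
    (1 - ν) • (inclusion H (dens ρ)).adjoint (inclusion H (dens ρ) (direction H ν ρ π))
      + ν • direction H ν ρ π = (inclusion H (dens ρ)).adjoint (scoreLp ρ π) :=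
  (isInvertible_regOp H hν.1 hν.2.le (dens ρ)).self_apply_inverse _

theorem norm_inclusion_sq_le {μ : Measure (Rd d)} (h : Admissible H μ) :
    ‖inclusion H μ‖ ^ 2 ≤ ∫ x, ker H x x ∂μ := by
  have h0 : 0 ≤ ∫ x, ker H x x ∂μ := integral_nonneg fun x => by
    rw [Pi.zero_apply, ker_eq_inner]
    exact real_inner_self_nonneg
  have h1 : ‖inclusion H μ‖ ≤ Real.sqrt (∫ x, ker H x x ∂μ) := by
    refine ContinuousLinearMap.opNorm_le_bound _ (Real.sqrt_nonneg _) fun φ => ?_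
    rw [inclusion, dif_pos h]
    exact norm_toLp_evalVec_le h φ
  calc ‖inclusion H μ‖ ^ 2 ≤ Real.sqrt (∫ x, ker H x x ∂μ) ^ 2 := by gcongr
    _ = _ := Real.sq_sqrt h0

theorem integralOp_isSymmetric (μ : Measure (Rd d)) :
    (integralOp H μ : Lp (Rd d) 2 μ →ₗ[ℝ] Lp (Rd d) 2 μ).IsSymmetric := fun f g => by
  change ⟪inclusion H μ ((inclusion H μ).adjoint f), g⟫_ℝ
    = ⟪f, inclusion H μ ((inclusion H μ).adjoint g)⟫_ℝ
  rw [← ContinuousLinearMap.adjoint_inner_right, ContinuousLinearMap.adjoint_inner_left]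

theorem continuous_evalVec (hk : Continuous (fun p : Rd d × Rd d => ker H p.1 p.2)) (φ : Hd d H) :
    Continuous (evalVec φ) :=
  (PiLp.continuous_toLp 2 (fun _ : Fin d => ℝ)).comp
    (continuous_pi fun i => continuous_eval hk (φ i))

theorem scoreLp_eq (hS : MemLp (score ρ π) 2 (dens ρ)) : scoreLp ρ π = hS.toLp :=
  dif_pos hS

theorem norm_sq_eq_integral {μ : Measure (Rd d)} {f : Lp (Rd d) 2 μ} {g : Rd d → Rd d}
    (h : f =ᵐ[μ] g) : ‖f‖ ^ 2 = ∫ x, ‖g x‖ ^ 2 ∂μ := by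
  rw [← real_inner_self_eq_norm_sq, L2.inner_def]
  refine integral_congr_ae ?_
  filter_upwards [h] with x hx
  rw [hx, real_inner_self_eq_norm_sq]

theorem norm_scoreLp_sq (hS : MemLp (score ρ π) 2 (dens ρ)) :
    ‖scoreLp ρ π‖ ^ 2 = ∫ x, ‖score ρ π x‖ ^ 2 ∂(dens ρ) := by
  rw [scoreLp_eq hS]
  exact norm_sq_eq_integral hS.coeFn_toLp

/-- The Fisher information is the squared norm of the score in `L²(ρ)`. -/
theorem fisher_eq_ofReal (hS : MemLp (score ρ π) 2 (dens ρ)) :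
    fisher ρ π = ENNReal.ofReal (‖scoreLp ρ π‖ ^ 2) := by
  rw [norm_scoreLp_sq hS, ofReal_integral_eq_lintegral_ofReal
    (hS.integrable_norm_pow two_ne_zero) (Filter.Eventually.of_forall fun x => by positivity),
    fisher]
  refine lintegral_congr fun x => ?_
  rw [ENNReal.ofReal_pow (norm_nonneg _), ofReal_norm]

theorem norm_evalVec_direction_le (hν : ν ∈ Ioo (0 : ℝ) 1) (x : Rd d) :
    ‖evalVec (direction H ν ρ π) x‖
      ≤ Real.sqrt (ker H x x / (ν * (1 - ν))) * ‖scoreLp ρ π‖ := by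
  have h1 := norm_sq_regularized_le hν (direction_eq (H := H) hν ρ π)
  have hν' : 0 < ν * (1 - ν) := mul_pos hν.1 (sub_pos.mpr hν.2)
  have hk0 : 0 ≤ ker H x x := by
    rw [ker_eq_inner]
    exact real_inner_self_nonneg
  refine (norm_evalVec_le _ x).trans (le_of_sq_le_sq ?_ (by positivity))
  rw [mul_pow, mul_pow, Real.sq_sqrt hk0, Real.sq_sqrt (by positivity)]
  calc _ ≤ ‖scoreLp ρ π‖ ^ 2 / (ν * (1 - ν)) * ker H x x := by gcongr
    _ = _ := by ring

theorem integral_norm_sq_evalVec_direction_le (hν : ν ∈ Ioo (0 : ℝ) 1)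
    (hadm : Admissible H (dens ρ)) :
    ∫ x, ‖evalVec (direction H ν ρ π) x‖ ^ 2 ∂(dens ρ) ≤ (1 / (1 - ν) * ‖scoreLp ρ π‖) ^ 2 := by
  rw [← norm_sq_eq_integral (coeFn_inclusion H hadm (direction H ν ρ π))]
  refine pow_le_pow_left₀ (norm_nonneg _) ?_ 2
  rw [one_div_mul_eq_div]
  exact norm_apply_regularized_le hν (direction_eq hν ρ π)

/-- The entropy dissipation as an inner product in `L²(ρ)`. -/
theorem integral_inner_score_eq (hρ : IsDensity ρ) (hadm : Admissible H (dens ρ))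
    (hS : MemLp (score ρ π) 2 (dens ρ)) :
    ∫ x, ρ x * ⟪score ρ π x, evalVec (direction H ν ρ π) x⟫_ℝ
      = ⟪scoreLp ρ π, inclusion H (dens ρ) (direction H ν ρ π)⟫_ℝ := by
  rw [← integral_dens hρ.continuous hρ.pos, L2.inner_def, scoreLp_eq hS]
  refine integral_congr_ae ?_
  filter_upwards [hS.coeFn_toLp, coeFn_inclusion H hadm (direction H ν ρ π)] with x h1 h2
  rw [h1, h2]

/-- The part of the Fisher information which `(1 - ν)` times the dissipation misses. -/
def defect (H : Type*) [NormedAddCommGroup H] [InnerProductSpace ℝ H] [CompleteSpace H]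
    [RKHS ℝ H (Rd d) ℝ] (ν : ℝ) (ρ π : Rd d → ℝ) : ℝ :=
  ‖scoreLp ρ π‖ ^ 2
    - (1 - ν) * ∫ x, ρ x * ⟪score ρ π x, evalVec (direction H ν ρ π) x⟫_ℝ

theorem defect_eq_inner (hρ : IsDensity ρ) (hadm : Admissible H (dens ρ))
    (hS : MemLp (score ρ π) 2 (dens ρ)) :
    defect H ν ρ π = ⟪scoreLp ρ π, scoreLp ρ π
      - (1 - ν) • inclusion H (dens ρ) (direction H ν ρ π)⟫_ℝ := by
  rw [defect, integral_inner_score_eq hρ hadm hS, inner_sub_right, inner_smul_right,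
    real_inner_self_eq_norm_sq]

/-- The defect controls the Fisher information: this is what turns a finite bound for the
approximation error into integrability of the Fisher information in time. -/
theorem norm_scoreLp_sq_le_mul_defect (hν : ν ∈ Ioo (0 : ℝ) 1) (hρ : IsDensity ρ)
    (hadm : Admissible H (dens ρ)) (hS : MemLp (score ρ π) 2 (dens ρ)) {K : ℝ}
    (hK : ∫ x, ker H x x ∂(dens ρ) ≤ K) :
    ‖scoreLp ρ π‖ ^ 2 ≤ (1 + (1 - ν) / ν * K) ^ 2 * defect H ν ρ π := by
  have h0 := hν.1
  have h1 : 0 < 1 - ν := sub_pos.mpr hν.2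
  have h2 := norm_sq_le_mul_inner_residual hν (direction_eq (H := H) hν ρ π)
  rw [← defect_eq_inner hρ hadm hS] at h2
  have hE : 0 ≤ defect H ν ρ π := by
    by_contra hneg
    have h3 : 0 < (1 + (1 - ν) / ν * ‖inclusion H (dens ρ)‖ ^ 2) ^ 2 := by positivity
    nlinarith [sq_nonneg ‖scoreLp ρ π‖, mul_neg_of_pos_of_neg h3 (not_le.mp hneg)]
  refine h2.trans (mul_le_mul_of_nonneg_right ?_ hE)
  gcongr
  exact (norm_inclusion_sq_le hadm).trans hK

theorem defect_nonneg (hν : ν ∈ Ioo (0 : ℝ) 1) (hρ : IsDensity ρ)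
    (hadm : Admissible H (dens ρ)) (hS : MemLp (score ρ π) 2 (dens ρ)) :
    0 ≤ defect H ν ρ π := by
  have h0 := hν.1
  have h1 : 0 < 1 - ν := sub_pos.mpr hν.2
  have hk0 : 0 ≤ ∫ x, ker H x x ∂(dens ρ) := integral_nonneg fun x => by
    rw [Pi.zero_apply, ker_eq_inner]
    exact real_inner_self_nonneg
  have h2 := norm_scoreLp_sq_le_mul_defect hν hρ hadm hS le_rfl
  have h3 : 0 < (1 + (1 - ν) / ν * ∫ x, ker H x x ∂(dens ρ)) ^ 2 := by positivity
  exact nonneg_of_mul_nonneg_right ((sq_nonneg _).trans h2) h3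

/-- The defect is bounded by the norm of the pre-image of the score. -/
theorem ofReal_defect_le (hν : ν ∈ Ioo (0 : ℝ) 1) (hρ : IsDensity ρ)
    (hadm : Admissible H (dens ρ)) (hS : MemLp (score ρ π) 2 (dens ρ)) {γ : ℝ}
    (hγ : γ ∈ Ioc (0 : ℝ) (1 / 2)) :
    ENNReal.ofReal (defect H ν ρ π)
      ≤ ENNReal.ofReal ((ν / (1 - ν)) ^ (2 * γ)) * preimageNorm H π ρ γ ^ 2 := by
  have h0 := hν.1
  have h1 : 0 < 1 - ν := sub_pos.mpr hν.2
  set K := (ν / (1 - ν)) ^ (2 * γ) with hK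
  have hK0 : 0 < K := by positivity
  have hE := defect_nonneg hν hρ hadm hS
  have hle : ENNReal.ofReal (Real.sqrt (defect H ν ρ π / K)) ≤ preimageNorm H π ρ γ := by
    refine le_iInf fun h => le_iInf fun hh => ?_
    have e1 : fracPow (integralOp H (dens ρ)) γ h = scoreLp ρ π := by
      rw [scoreLp_eq hS]
      exact Lp.ext (hh.trans hS.coeFn_toLp.symm)
    have h2 := inner_fracPow_le (integralOp_isSymmetric (H := H) (dens ρ)) hν hγ (h := h)
      (z := scoreLp ρ π - (1 - ν) • inclusion H (dens ρ) (direction H ν ρ π)) (by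
        rw [e1]
        exact residual_eq (direction_eq (H := H) hν ρ π))
    rw [e1, ← defect_eq_inner hρ hadm hS] at h2
    rw [← ofReal_norm]
    refine ENNReal.ofReal_le_ofReal (Real.sqrt_le_iff.mpr ⟨norm_nonneg _, ?_⟩)
    rw [div_le_iff₀ hK0, mul_comm]
    exact h2
  calc ENNReal.ofReal (defect H ν ρ π)
      = ENNReal.ofReal K * ENNReal.ofReal (Real.sqrt (defect H ν ρ π / K)) ^ 2 := by
        rw [← ENNReal.ofReal_pow (Real.sqrt_nonneg _), Real.sq_sqrt (by positivity),
          ← ENNReal.ofReal_mul hK0.le, mul_div_cancel₀ _ hK0.ne']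
    _ ≤ _ := by gcongr

end velocity

/-! ### Grönwall's inequality for primitives -/

/-- Grönwall's inequality for a primitive `y` of `-D`, where `D` is only integrable. -/
theorem le_exp_mul_add_integral_of_primitive {a T : ℝ} (hT : 0 ≤ T) {y D g : ℝ → ℝ}
    (hD : IntervalIntegrable D volume 0 T) (hg : IntervalIntegrable g volume 0 T)
    (hy : ∀ t ∈ Icc 0 T, y t = y 0 - ∫ s in (0 : ℝ)..t, D s)
    (h : ∀ t ∈ Ioc 0 T, a * y t - D t ≤ g t) :
    y T ≤ Real.exp (-(a * T)) * y 0 + ∫ t in (0 : ℝ)..T, Real.exp (a * (t - T)) * g t := by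
  set U : ℝ → ℝ := fun t => y 0 - ∫ s in (0 : ℝ)..t, D s with hU
  set f : ℝ → ℝ := fun t => Real.exp (a * (t - T)) with hf
  have h0T : (0 : ℝ) ∈ uIcc 0 T := left_mem_uIcc
  have hUac : AbsolutelyContinuousOnInterval U 0 T := by
    refine absolutelyContinuousOnInterval_of_dist_le (K := 1)
      (hD.absolutelyContinuousOnInterval_intervalIntegral h0T) fun p _ q _ => ?_
    rw [one_mul, hU, dist_sub_left]
  have hfd : ∀ t, HasDerivAt f (a * f t) t := fun t => by
    have h1 : HasDerivAt (fun t => a * (t - T)) (a * 1) t :=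
      ((hasDerivAt_id t).sub_const T).const_mul a
    have h2 := h1.exp
    rw [mul_one, mul_comm] at h2
    exact h2
  have hfc : Continuous f := by fun_prop
  have hfac : AbsolutelyContinuousOnInterval f 0 T :=
    (by fun_prop : ContDiff ℝ 1 f).contDiffOn.absolutelyContinuousOnInterval
  have e := hfac.integral_deriv_mul_eq_sub hUac
  have e2 : ∫ t in (0 : ℝ)..T, deriv f t * U t + f t * deriv U t
      = ∫ t in (0 : ℝ)..T, f t * (a * U t - D t) := by
    refine intervalIntegral.integral_congr_ae ?_
    filter_upwards [hD.ae_hasDerivAt_integral] with t ht htT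
    have h1 : HasDerivAt U (-D t) t := (ht (uIoc_subset_uIcc htT) 0 h0T).const_sub (y 0)
    rw [h1.deriv, (hfd t).deriv]
    ring
  have hle : ∫ t in (0 : ℝ)..T, f t * (a * U t - D t) ≤ ∫ t in (0 : ℝ)..T, f t * g t := by
    rw [intervalIntegral.integral_of_le hT, intervalIntegral.integral_of_le hT]
    refine setIntegral_mono_on ?_ ?_ measurableSet_Ioc fun t ht => ?_
    · exact (intervalIntegrable_iff_integrableOn_Ioc_of_le hT).mp
        (((hUac.continuousOn.intervalIntegrable.const_mul a).sub hD).continuousOn_mul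
          hfc.continuousOn)
    · exact (intervalIntegrable_iff_integrableOn_Ioc_of_le hT).mp
        (hg.continuousOn_mul hfc.continuousOn)
    · refine mul_le_mul_of_nonneg_left ?_ (Real.exp_pos _).le
      have h1 : U t = y t := (hy t ⟨ht.1.le, ht.2⟩).symm
      rw [h1]
      exact h t ht
  have hU0 : U 0 = y 0 := by simp [hU]
  have hUT : U T = y T := (hy T ⟨hT, le_rfl⟩).symm
  have hf0 : f 0 = Real.exp (-(a * T)) := by simp [hf]
  have hfT : f T = 1 := by simp [hf]
  rw [e2, hU0, hUT, hf0, hfT] at e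
  linarith

/-! ### Convergence of the regularized flow -/

section solution

variable {d : ℕ} {H : Type*} [NormedAddCommGroup H] [InnerProductSpace ℝ H] [CompleteSpace H]
  [RKHS ℝ H (Rd d) ℝ] {ν : ℝ} {π : Rd d → ℝ} {ρ : ℝ → Rd d → ℝ} {T : ℝ}

/-- The weight of the pre-image in the convergence estimate bounds the defect divided by
`1 - ν`. -/
theorem ofReal_weighted_defect_le (hν : ν ∈ Ioo (0 : ℝ) 1) {r : Rd d → ℝ} (hr : IsDensity r)
    (hadm : Admissible H (dens r)) (hS : MemLp (score r π) 2 (dens r)) {γ : ℝ}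
    (hγ : γ ∈ Ioc (0 : ℝ) (1 / 2)) {w : ℝ} (hw : 0 ≤ w) :
    ENNReal.ofReal (w * (defect H ν r π / (1 - ν)))
      ≤ ENNReal.ofReal (ν ^ (2 * γ) * (1 - ν) ^ (-(2 * γ) - 1) * w)
        * preimageNorm H π r γ ^ 2 := by
  have h1 : 0 < 1 - ν := sub_pos.mpr hν.2
  have e : ν ^ (2 * γ) * (1 - ν) ^ (-(2 * γ) - 1) * w
      = w / (1 - ν) * (ν / (1 - ν)) ^ (2 * γ) := by
    rw [Real.div_rpow hν.1.le h1.le, Real.rpow_sub h1, Real.rpow_neg h1.le, Real.rpow_one]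
    field_simp
  have h2 : 0 ≤ w / (1 - ν) := div_nonneg hw h1.le
  rw [e, ← mul_div_assoc, mul_div_right_comm, ENNReal.ofReal_mul h2, ENNReal.ofReal_mul h2,
    mul_assoc]
  gcongr
  exact ofReal_defect_le hν hr hadm hS hγ

theorem IsSolution.admissible (hk : Continuous (fun p : Rd d × Rd d => ker H p.1 p.2))
    (hρ : IsSolution H ν π ρ) {t : ℝ} (ht : 0 ≤ t) : Admissible H (dens (ρ t)) :=
  ⟨hk, hρ.kernel_integrable t ht⟩

theorem IsSolution.aemeasurable_norm_scoreLp_sq (hπ : IsDensity π) (hρ : IsSolution H ν π ρ) :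
    AEMeasurable (fun t => ‖scoreLp (ρ t) π‖ ^ 2) (volume.restrict (Ioc 0 T)) := by
  refine (measurable_integral_score_sq hπ hρ.isDensity hρ.continuousOn).aemeasurable.congr ?_
  filter_upwards [ae_restrict_mem measurableSet_Ioc] with t ht
  have h := hρ.isDensity t ht.1.le
  rw [max_eq_left ht.1.le, norm_scoreLp_sq (hρ.score_memLp t ht.1),
    integral_dens h.continuous h.pos]

/-- The Fisher information is integrable in time as soon as the weighted squared norms of the
pre-images are. -/
theorem IsSolution.integrableOn_norm_scoreLp_sq
    (hk : Continuous (fun p : Rd d × Rd d => ker H p.1 p.2)) (hν : ν ∈ Ioo (0 : ℝ) 1)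
    (hπ : IsDensity π) (hρ : IsSolution H ν π ρ) {γ : ℝ → ℝ}
    (hγ : ∀ t, 0 < t → γ t ∈ Ioc (0 : ℝ) (1 / 2)) {a : ℝ} (ha : 0 ≤ a)
    (hfin : ∫⁻ t in Ioc 0 T, ENNReal.ofReal (ν ^ (2 * γ t) * (1 - ν) ^ (-(2 * γ t) - 1)
          * Real.exp (a * (t - T))) * preimageNorm H π (ρ t) (γ t) ^ 2 ≠ ⊤) :
    IntegrableOn (fun t => ‖scoreLp (ρ t) π‖ ^ 2) (Ioc 0 T) := by
  have h1 : 0 < 1 - ν := sub_pos.mpr hν.2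
  obtain ⟨K, hK⟩ := hρ.kernel_bounded T
  set M := (1 + (1 - ν) / ν * K) ^ 2 with hM
  set c := M * (1 - ν) * Real.exp (a * T) with hc
  have hc0 : 0 ≤ c := by positivity
  refine ⟨(hρ.aemeasurable_norm_scoreLp_sq hπ).aestronglyMeasurable, ?_⟩
  rw [hasFiniteIntegral_iff_ofReal (Filter.Eventually.of_forall fun t => sq_nonneg _)]
  have hle : ∫⁻ t in Ioc 0 T, ENNReal.ofReal (‖scoreLp (ρ t) π‖ ^ 2)
      ≤ ∫⁻ t in Ioc 0 T, ENNReal.ofReal c * (ENNReal.ofReal (ν ^ (2 * γ t)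
          * (1 - ν) ^ (-(2 * γ t) - 1) * Real.exp (a * (t - T)))
          * preimageNorm H π (ρ t) (γ t) ^ 2) := by
    refine lintegral_mono_ae ?_
    filter_upwards [ae_restrict_mem measurableSet_Ioc] with t ht
    have hr := hρ.isDensity t ht.1.le
    have hadm := hρ.admissible hk ht.1.le
    have hS := hρ.score_memLp t ht.1
    -- the constant `c` compensates the weight, which is at least `exp (-a T)`
    refine le_trans ?_ (mul_le_mul_right (ofReal_weighted_defect_le hν hr hadm hS (hγ t ht.1)
      (Real.exp_pos (a * (t - T))).le) _)
    rw [← ENNReal.ofReal_mul hc0]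
    refine ENNReal.ofReal_le_ofReal ?_
    have h2 := norm_scoreLp_sq_le_mul_defect hν hr hadm hS (hK ⟨t, ⟨ht.1.le, ht.2⟩, rfl⟩)
    have h3 : 0 ≤ M * defect H ν (ρ t) π :=
      mul_nonneg (sq_nonneg _) (defect_nonneg hν hr hadm hS)
    have h4 : 1 ≤ Real.exp (a * T) * Real.exp (a * (t - T)) := by
      rw [← Real.exp_add, Real.one_le_exp_iff, ← mul_add]
      exact mul_nonneg ha (by linarith [ht.1])
    have e : c * (Real.exp (a * (t - T)) * (defect H ν (ρ t) π / (1 - ν)))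
        = (Real.exp (a * T) * Real.exp (a * (t - T))) * (M * defect H ν (ρ t) π) := by
      rw [hc]
      field_simp
    rw [e]
    exact h2.trans (le_mul_of_one_le_left h3 h4)
  refine hle.trans_lt ?_
  rw [lintegral_const_mul' _ _ ENNReal.ofReal_ne_top]
  exact ENNReal.mul_lt_top ENNReal.ofReal_lt_top hfin.lt_top

/-- A solution of the regularized flow whose Fisher information is integrable in time is an energy
flow. -/
theorem IsSolution.isEnergyFlow (hk : Continuous (fun p : Rd d × Rd d => ker H p.1 p.2))
    (hν : ν ∈ Ioo (0 : ℝ) 1) (hπ : IsDensity π) (hρ : IsSolution H ν π ρ)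
    (hI : IntegrableOn (fun t => ‖scoreLp (ρ t) π‖ ^ 2) (Ioc 0 T)) :
    IsEnergyFlow π ρ (fun t => evalVec (direction H ν (ρ t) π)) (fun t => ‖scoreLp (ρ t) π‖) T where
  target := hπ
  isDensity := hρ.isDensity
  weakly_continuous := hρ.continuousOn
  continuous_velocity _ _ := continuous_evalVec hk _
  flux_integrable := hρ.flux_integrable
  weak_form := hρ.weak_form
  bound_nonneg _ := norm_nonneg _
  bound_integrable := hI
  speed_le R := by
    have hc : Continuous fun x : Rd d => Real.sqrt (ker H x x / (ν * (1 - ν))) :=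
      ((hk.comp (f := fun x : Rd d => (x, x)) (by fun_prop)).div_const _).sqrt
    obtain ⟨C, hC⟩ := (isCompact_closedBall (0 : Rd d) R).exists_bound_of_continuousOn
      hc.continuousOn
    refine ⟨max C 0, le_max_right _ _, fun t _ x hx => (norm_evalVec_direction_le hν x).trans ?_⟩
    gcongr
    exact (Real.le_norm_self _).trans ((hC x hx).trans (le_max_left _ _))
  velocity_memLp t ht := memLp_evalVec (hρ.admissible hk ht.1.le) _
  velocity_le := ⟨1 / (1 - ν), one_div_nonneg.mpr (sub_nonneg.mpr hν.2.le), fun t ht =>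
    integral_norm_sq_evalVec_direction_le hν (hρ.admissible hk ht.1.le)⟩
  score_memLp t ht := hρ.score_memLp t ht.1
  score_le t ht := (norm_scoreLp_sq (hρ.score_memLp t ht.1)).ge

/-- The convergence estimate in real numbers, where the error term is the defect. -/
theorem IsSolution.integral_klFun_le (hk : Continuous (fun p : Rd d × Rd d => ker H p.1 p.2))
    (hν : ν ∈ Ioo (0 : ℝ) 1) (hπ : IsDensity π) {lam : ℝ} (hlam : 0 < lam)
    (hLSI : SatisfiesLSI π lam) (hρ : IsSolution H ν π ρ) (hT : 0 < T)
    (hI : IntegrableOn (fun t => ‖scoreLp (ρ t) π‖ ^ 2) (Ioc 0 T)) (h0 : KL (ρ 0) π < ⊤) :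
    KL (ρ T) π < ⊤ ∧ IntegrableOn (fun t => Real.exp (2 * lam / (1 - ν) * (t - T))
        * (defect H ν (ρ t) π / (1 - ν))) (Ioc 0 T) ∧
    ∫ x, InformationTheory.klFun (ρ T x / π x) * π x
      ≤ Real.exp (-(2 * lam / (1 - ν) * T))
          * (∫ x, InformationTheory.klFun (ρ 0 x / π x) * π x)
        + ∫ t in Ioc 0 T, Real.exp (2 * lam / (1 - ν) * (t - T))
            * (defect H ν (ρ t) π / (1 - ν)) := by
  have h1 : 0 < 1 - ν := sub_pos.mpr hν.2
  have F := hρ.isEnergyFlow hk hν hπ hI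
  have hfisher : ∀ t, 0 < t → KL (ρ t) π
      ≤ ENNReal.ofReal (1 / (2 * lam) * ‖scoreLp (ρ t) π‖ ^ 2) := fun t ht => by
    rw [ENNReal.ofReal_mul (by positivity), ← fisher_eq_ofReal (hρ.score_memLp t ht)]
    exact hLSI _ (hρ.isDensity t ht.le)
  have hKL : ∀ t ∈ Icc 0 T, KL (ρ t) π < ⊤ := fun t ht => by
    rcases ht.1.eq_or_lt with rfl | h
    · exact h0
    · exact (hfisher t h).trans_lt ENNReal.ofReal_lt_top
  have hint := fun t (ht : t ∈ Icc 0 T) =>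
    integrable_klFun_of_KL_lt_top (hρ.isDensity t ht.1) hπ (hKL t ht)
  have h0T : (0 : ℝ) ∈ Icc 0 T := ⟨le_rfl, hT.le⟩
  have hTT : T ∈ Icc 0 T := ⟨hT.le, le_rfl⟩
  have hD := (F.entropy_sub_eq hTT (hint 0 h0T) (hint T hTT)).1
  have hg : IntervalIntegrable (fun t => defect H ν (ρ t) π / (1 - ν)) volume 0 T :=
    (((intervalIntegrable_iff_integrableOn_Ioc_of_le hT.le).mpr hI).sub
      (hD.const_mul (1 - ν))).div_const _
  refine ⟨hKL T hTT, ?_, ?_⟩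
  · refine (intervalIntegrable_iff_integrableOn_Ioc_of_le hT.le).mp (hg.continuousOn_mul ?_)
    exact (by fun_prop : Continuous fun t : ℝ =>
      Real.exp (2 * lam / (1 - ν) * (t - T))).continuousOn
  · rw [← intervalIntegral.integral_of_le hT.le]
    refine le_exp_mul_add_integral_of_primitive
      (y := fun t => ∫ x, InformationTheory.klFun (ρ t x / π x) * π x) hT.le hD hg
      (fun t ht => ?_) fun t ht => ?_
    · linarith [(F.entropy_sub_eq ht (hint 0 h0T) (hint t ht)).2]
    · have ht' : t ∈ Icc 0 T := ⟨ht.1.le, ht.2⟩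
      have h2 := hfisher t ht.1
      rw [KL_eq_ofReal_integral (hρ.isDensity t ht.1.le) hπ (hKL t ht'),
        ENNReal.ofReal_le_ofReal_iff (by positivity)] at h2
      have h3 : 2 * lam / (1 - ν) * ∫ x, InformationTheory.klFun (ρ t x / π x) * π x
          ≤ ‖scoreLp (ρ t) π‖ ^ 2 / (1 - ν) := by
        calc _ ≤ 2 * lam / (1 - ν) * (1 / (2 * lam) * ‖scoreLp (ρ t) π‖ ^ 2) := by gcongr
          _ = _ := by field_simp
      have e : defect H ν (ρ t) π / (1 - ν) = ‖scoreLp (ρ t) π‖ ^ 2 / (1 - ν)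
          - ∫ x, ρ t x * ⟪score (ρ t) π x, evalVec (direction H ν (ρ t) π) x⟫_ℝ := by
        rw [defect, sub_div, mul_div_cancel_left₀ _ h1.ne']
      rw [e]
      linarith

end solution

end RSVGF

end

theorem mainTheorem3 {d : ℕ} {H : Type*} [NormedAddCommGroup H] [InnerProductSpace ℝ H]
    [CompleteSpace H] [RKHS ℝ H (Rd d) ℝ]
    (hk : Continuous (fun p : Rd d × Rd d => ker H p.1 p.2))
    {ν : ℝ} (hν : ν ∈ Ioo (0 : ℝ) 1)
    {π : Rd d → ℝ} (hπ : IsDensity π)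
    {lam : ℝ} (hlam : 0 < lam) (hLSI : SatisfiesLSI π lam)
    {ρ : ℝ → Rd d → ℝ} (hρ : IsSolution H ν π ρ)
    {γ : ℝ → ℝ} (hγ : ∀ t, 0 < t → γ t ∈ Ioc (0 : ℝ) (1 / 2) ∧ preimageNorm H π (ρ t) (γ t) < ⊤)
    {T : ℝ} (hT : 0 < T) :
    KL (ρ T) π ≤ ENNReal.ofReal (Real.exp (-(2 * lam * T / (1 - ν)))) * KL (ρ 0) π
      + ∫⁻ t in Ioc 0 T, ENNReal.ofReal (ν ^ (2 * γ t) * (1 - ν) ^ (-(2 * γ t) - 1)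
          * Real.exp (2 * lam * (t - T) / (1 - ν))) * preimageNorm H π (ρ t) (γ t) ^ 2 := by
  have h1 : 0 < 1 - ν := sub_pos.mpr hν.2
  set a := 2 * lam / (1 - ν) with ha
  have ha0 : 0 ≤ a := by positivity
  have e1 : ∀ s, 2 * lam * s / (1 - ν) = a * s := fun s => mul_div_right_comm _ _ _
  simp only [e1]
  by_cases h0 : KL (ρ 0) π = ⊤
  · rw [h0, ENNReal.mul_top (ENNReal.ofReal_pos.mpr (Real.exp_pos _)).ne', top_add]
    exact le_top
  by_cases hfin : ∫⁻ t in Ioc 0 T, ENNReal.ofReal (ν ^ (2 * γ t) * (1 - ν) ^ (-(2 * γ t) - 1)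
      * Real.exp (a * (t - T))) * preimageNorm H π (ρ t) (γ t) ^ 2 = ⊤
  · rw [hfin, add_top]
    exact le_top
  have hI := hρ.integrableOn_norm_scoreLp_sq hk hν hπ (fun t ht => (hγ t ht).1) ha0 hfin
  obtain ⟨hKT, hg, hle⟩ := hρ.integral_klFun_le hk hν hπ hlam hLSI hT hI (lt_top_iff_ne_top.mpr h0)
  have hd0 := hρ.isDensity 0 le_rfl
  have hdefect : ∀ᵐ t ∂(volume.restrict (Ioc 0 T)),
      0 ≤ Real.exp (a * (t - T)) * (defect H ν (ρ t) π / (1 - ν)) := by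
    filter_upwards [ae_restrict_mem measurableSet_Ioc] with t ht
    exact mul_nonneg (Real.exp_pos _).le (div_nonneg (defect_nonneg hν (hρ.isDensity t ht.1.le)
      (hρ.admissible hk ht.1.le) (hρ.score_memLp t ht.1)) h1.le)
  rw [KL_eq_ofReal_integral (hρ.isDensity T hT.le) hπ hKT,
    KL_eq_ofReal_integral hd0 hπ (lt_top_iff_ne_top.mpr h0),
    ← ENNReal.ofReal_mul (Real.exp_pos _).le]
  refine (ENNReal.ofReal_le_ofReal hle).trans (ENNReal.ofReal_add_le.trans ?_)
  rw [ofReal_integral_eq_lintegral_ofReal hg hdefect]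
  refine add_le_add_right ?_ _
  refine lintegral_mono_ae ?_
  filter_upwards [ae_restrict_mem measurableSet_Ioc] with t ht
  exact ofReal_weighted_defect_le hν (hρ.isDensity t ht.1.le) (hρ.admissible hk ht.1.le)
    (hρ.score_memLp t ht.1) (hγ t ht.1).1 (Real.exp_pos _).le
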